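/- **Notation.** Scales $\delta,\Delta$ lie in $2^{-\mathbb N}=\{1,\tfrac12,\tfrac14,\dots\}$. $\mathcal D_\delta(A)$ is the set of squares $[a\delta,(a+1)\delta)\times[b\delta,(b+1)\delta)$, $a,b\in\mathbb Z$, that meet $A\subset\mathbb R^2$; $|A|_\delta=|\mathcal D_\delta(A)|$; $\mathcal D_\delta=\mathcal D_\delta([0,1)^2)$. A non-empty bounded set $A\subset\mathbb R^2$ is a $(\delta,s,C)$-set if $|A\cap B(x,r)|_\delta\le C r^s|A|_\delta$ for all $x\in\mathbb R^2$, $r\in[\delta,1]$. A dyadic $\delta$-tube is a set $\mathbf D(p)=\bigcup_{(a,b)\in p}\{(x,y):y=ax+b\}$ with $p\in\mathcal D_\delta([-1,1]\times\mathbb R)$; a finite family $\{\mathbf D(p)\}_{p\in\mathcal Q}$ is a $(\delta,s,C)$-set if $\bigcup\mathcal Q$ is. For $\mathcal P\subset\mathcal D_\delta$ and $E\subset\mathbb R^2$ put $|\mathcal P\cap E|_\delta=|(\bigcup\mathcal P)\cap E|_\delta$, so that $|\mathcal P|_\delta=|\mathcal P|$. For $\mathcal P\subset\mathcal D_\delta$,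 a finite set $\mathcal T$ of dyadic $\delta$-tubes and $M\in\mathbb N$, the pair $(\mathcal P,\mathcal T)$ is a $(\delta,s,C,M)$-nice configuration if for every $p\in\mathcal P$ there is a $(\delta,s,C)$-set $\mathcal T(p)\subset\mathcal T$ of tubes, all meeting $p$, with $A^{-1}M\le|\mathcal T(p)|\le AM$. Here $A\ge1$ is a fixed constant, the implicit constant in $|\mathcal T(p)|\sim M$. **Proposition.** For every $\varepsilon>0$ and $A\ge 1$ there is $c=c(\varepsilon,A)>0$ such that the following holds. Let $\delta\le\Delta$ be in $2^{-\mathbb N}$, let $s\in(0,1]$, $M\in\mathbb N$, and let $(\mathcal P,\mathcal T)$ be a $(\delta,s,\delta^{-\varepsilon^2},M)$-nice configuration such that for all $x\in\mathbb R^2$ $$|\mathcal P\cap B(x,\rho)|_\delta\le\delta^{-\varepsilon^2}\rho^{2-s}|\mathcal P|\quad(\Delta<\rho<1),\qquad |\mathcal P\cap B(x,\rho)|_\delta\le\delta^{-\varepsilon^2}(\rho/\delta)^s\quad(\delta<\rho<\Delta).$$ Then $$|\mathcal T|\ \ge\ c\,\delta^{35\varepsilon}\min\bigl(M|\mathcal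 P|,\;M^{3/2}|\mathcal P|^{1/2},\;\delta^{-1}M\bigr).$$ **Corollary.** For every $\varepsilon>0$ and $A\ge1$ there is $c=c(\varepsilon,A)>0$ such that, with $\eta=\varepsilon^2/1225$, for all $s\in(0,1]$ and $t\in[s,2-s]$ there is $\delta_0>0$ (depending on $s,t,\varepsilon,A$) such that the following holds for all $\delta\in2^{-\mathbb N}$ with $\delta<\delta_0$. Let $(\mathcal P,\mathcal T)$ be a $(\delta,s,\delta^{-\eta},M)$-nice configuration with $A^{-1}\delta^{-t}\le|\mathcal P|\le A\delta^{-t}$ and $$|\mathcal P\cap Q|_\delta\le A\,\delta^{-\eta}\max\bigl(\rho^{2-s}|\mathcal P|,(\rho/\delta)^s\bigr)\quad\text{for all }\rho\in2^{-\mathbb N}\cap[\delta,1],\ Q\in\mathcal D_\rho\bigl(\textstyle\bigcup\mathcal P\bigr).$$ Then $$|\mathcal T|\ \ge\ c\,\delta^{-\frac{s+t}2+\varepsilon}M.$$ -/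

import Mathlib

namespace Furstenberg

/-- The Euclidean plane. -/
abbrev Plane : Type := EuclideanSpace ℝ (Fin 2)

/-- `δ ∈ 2^{-ℕ}`. -/
def IsDyadicScale (δ : ℝ) : Prop := ∃ n : ℕ, δ = (2 : ℝ)⁻¹ ^ n

/-- The half-open square `[aδ, (a+1)δ) × [bδ, (b+1)δ)`. -/
def dyadicCube (δ : ℝ) (a b : ℤ) : Set Plane :=
  {x | x 0 ∈ Set.Ico ((a : ℝ) * δ) (((a : ℝ) + 1) * δ) ∧
       x 1 ∈ Set.Ico ((b : ℝ) * δ) (((b : ℝ) + 1) * δ)}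

/-- `𝒟_δ(A)`: the dyadic cubes of side `δ` that meet `A`. -/
def dyadicCubes (δ : ℝ) (A : Set Plane) : Set (Set Plane) :=
  {Q | (∃ a b : ℤ, Q = dyadicCube δ a b) ∧ (Q ∩ A).Nonempty}

/-- The dyadic covering number `|A|_δ` (used for bounded `A`, where it is finite). -/
noncomputable def coveringNumber (δ : ℝ) (A : Set Plane) : ℕ := (dyadicCubes δ A).ncard

/-- The unit square `[0,1)²`. -/
def unitSquare : Set Plane := {x | x 0 ∈ Set.Ico (0 : ℝ) 1 ∧ x 1 ∈ Set.Ico (0 : ℝ) 1}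

/-- A `(δ, s, C)`-set in the plane. -/
def IsDeltaSet (δ s C : ℝ) (A : Set Plane) : Prop :=
  A.Nonempty ∧ Bornology.IsBounded A ∧
    ∀ (x : Plane) (r : ℝ), δ ≤ r → r ≤ 1 →
      (coveringNumber δ (A ∩ Metric.ball x r) : ℝ) ≤ C * r ^ s * (coveringNumber δ A : ℝ)

/-- Point-line duality: `(a, b)` is sent to the line `y = a x + b`. -/
def dualLine (z : Plane) : Set Plane := {w | w 1 = z 0 * w 0 + z 1}

/-- The union of the lines dual to the points of `p`. -/
def dualSet (p : Set Plane) : Set Plane := ⋃ z ∈ p, dualLine z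

/-- The vertical strip `[-1,1] × ℝ`. -/
def strip : Set Plane := {x | x 0 ∈ Set.Icc (-1 : ℝ) 1}

/-- `𝒯^δ`: the dyadic `δ`-tubes. -/
def dyadicTubes (δ : ℝ) : Set (Set Plane) := dualSet '' dyadicCubes δ strip

/-- A finite collection of dyadic `δ`-tubes is a `(δ, s, C)`-set if the union of the
corresponding dyadic cubes of the parameter plane is one. -/
def IsTubeDeltaSet (δ s C : ℝ) (𝒯 : Finset (Set Plane)) : Prop :=
  ∃ 𝒬 : Set (Set Plane), 𝒬 ⊆ dyadicCubes δ strip ∧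
    (𝒯 : Set (Set Plane)) = dualSet '' 𝒬 ∧ IsDeltaSet δ s C (⋃₀ 𝒬)

/-- A `(δ, s, C, M)`-nice configuration, where `|𝒯(p)| ∼ M` is read with the implicit
constant `A`. -/
structure IsNiceConfiguration (A δ s C : ℝ) (M : ℕ) (P 𝒯 : Finset (Set Plane)) : Prop where
  cubes : ∀ p ∈ P, p ∈ dyadicCubes δ unitSquare
  tubes : ∀ T ∈ 𝒯, T ∈ dyadicTubes δ
  nice : ∀ p ∈ P, ∃ 𝒯p : Finset (Set Plane), 𝒯p ⊆ 𝒯 ∧ IsTubeDeltaSet δ s C 𝒯p ∧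
    A⁻¹ * (M : ℝ) ≤ (𝒯p.card : ℝ) ∧ (𝒯p.card : ℝ) ≤ A * (M : ℝ) ∧
    ∀ T ∈ 𝒯p, (T ∩ p).Nonempty

/-- `|P ∩ E|_δ` for a collection `P` of dyadic `δ`-cubes and a set `E` in the plane. -/
noncomputable def coveringIn (δ : ℝ) (P : Finset (Set Plane)) (E : Set Plane) : ℕ :=
  coveringNumber δ (⋃₀ (P : Set (Set Plane)) ∩ E)

end Furstenberg

/-!
The proof compares a large number of scales. For `K` of order `1 / ε` choose a power `S` of `2` such
that `S ^ K` is `δ⁻¹` up to a bounded factor; then constants and fixed powers of `S` are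
harmless. A dyadic tube is replaced by one line, with slope and intercept in a `δ`-square, and a
pigeonholing over the `S`-adic tree (`exists_uniform_subset`) makes the configuration uniform:
a square of side `S⁻ⁿ` contains `S ^ γ n` points, or `S ^ μ n` of the lines through a given point,
if it contains any (`UniformConfiguration`). There are `S ^ (κ + μ 0)` incidences, and the lower
bound for the number of tubes comes from upper bounds for the second moments of the number of
points along tubes.

Two estimates are combined. The first counts pairs of points on a common line of scale `S⁻ʳ`
directly (`UniformConfiguration.card_pairs_le`). It is sharp if points and lines are in balance,
`γ i + μ (r - i) ≤ K - r + μ 0` up to a slack, for the relevant horizontal distances `S⁻ⁱ`. As the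
lines through a point and, below the scale `Δ`, the points themselves are `s`-dimensional, this is
always so for the distances at most `Δ` (`UniformConfiguration.gamma_add_mu_le`). The second is the
high-low method (`sum_sq_lineCount_le`): if a line at scale `S⁻⁽ˡ⁺¹⁾` has clearly more points than its
ancestor at scale `S⁻ˡ` would suggest, then their number is detected by a kernel of mean zero across
the line, a difference of two tent functions. Two points at horizontal distance `d` then interact
only by `O(d⁻²)`, and a Schur test bounds the second moment over all lines by the energy of the
points, without any Fourier transform. An affine change of variables transports the estimate to the
lines with parameters in a given square (`UniformConfiguration.sum_sq_localCount_le`).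

For a uniform configuration there are three cases (`UniformConfiguration.card_tubes_ge`). If points
and lines are in balance at the finest scale, the Cauchy–Schwarz inequality gives `M |P|` tubes.
Otherwise the tubes whose neighbourhood at some scale above `Δ` contains many more points than
expected are discarded; by the high-low estimate and the dimension `2 - s` of the points they carry
few incidences (`UniformConfiguration.le_sum_multiplicity_poor`). For each of the other tubes `T`
and each `t`, consider the smallest `r ≥ t` such that the points near `T` at scale `S⁻ʳ` that have a
line close to `T` at scale `S⁻ᵗ` are about as many as the points on `T`, times `S ^ (K - r)`. By
minimality the high-low estimate applies at this critical scale `r`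
(`UniformConfiguration.exists_critical`). As `t` grows from `0` to `K`, either there is already
imbalance for `t = 0`, so that `r` belongs to the scales above `Δ` and the tube has about
`S ^ (κ - K)` points, which gives `δ⁻¹ M` tubes; or there is a transition from balance to imbalance.
At the transition balance controls the points near a line, through the high-low estimate, and
imbalance means that the points concentrate in squares of which a line meets few
(`UniformConfiguration.exists_sum_sq_card_localPoints_le`); the Cauchy–Schwarz inequality then gives
`M ^ (3 / 2) |P| ^ (1 / 2)` tubes.

The Furstenberg bound is the case where `Δ = δ ^ ((t - s) / (2 - 2 s))` is the scale at which
`ρ ^ (2 - s) |P|` equals `(ρ / δ) ^ s`; as the tubes through a square form a `(δ, s)`-set, `M` is at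
least about `δ ^ (-s)`, and each term of the minimum is at least about `δ ^ (-(s + t) / 2) M`.
-/

namespace Furstenberg

open MeasureTheory

/-! ### Correlations of mean-zero profiles along lines -/

/-- A trapezoidal cutoff in the slope variable: `1` on `[-2, 2]`, `0` off `[-3, 3]`,
and `1`-Lipschitz. -/
noncomputable def slopeCutoff (u : ℝ) : ℝ := max 0 (min 1 (3 - |u|))

lemma slopeCutoff_nonneg (u : ℝ) : 0 ≤ slopeCutoff u := le_max_left _ _

lemma slopeCutoff_le_one (u : ℝ) : slopeCutoff u ≤ 1 := by
  unfold slopeCutoff; exact max_le zero_le_one (min_le_left _ _)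

lemma slopeCutoff_eq_one {u : ℝ} (hu : |u| ≤ 2) : slopeCutoff u = 1 := by
  unfold slopeCutoff
  rw [min_eq_left (by linarith), max_eq_right zero_le_one]

lemma slopeCutoff_eq_zero {u : ℝ} (hu : 3 ≤ |u|) : slopeCutoff u = 0 := by
  unfold slopeCutoff
  exact max_eq_left ((min_le_right _ _).trans (by linarith))

lemma continuous_slopeCutoff : Continuous slopeCutoff := by
  unfold slopeCutoff; fun_prop

lemma abs_slopeCutoff_sub_le (u v : ℝ) : |slopeCutoff u - slopeCutoff v| ≤ |u - v| := by
  unfold slopeCutoff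
  have h1 : |max 0 (min 1 (3 - |u|)) - max 0 (min 1 (3 - |v|))|
      ≤ |min 1 (3 - |u|) - min 1 (3 - |v|)| := by
    simpa [max_comm] using abs_max_sub_max_le_abs (min 1 (3 - |u|)) (min 1 (3 - |v|)) 0
  have h2 : |min 1 (3 - |u|) - min 1 (3 - |v|)| ≤ |(3 - |u|) - (3 - |v|)| := by
    simpa using abs_min_sub_min_le_max 1 (3 - |u|) 1 (3 - |v|)
  refine h1.trans (h2.trans ?_)
  have : (3 - |u|) - (3 - |v|) = |v| - |u| := by ring
  rw [this, abs_sub_comm u v]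
  exact abs_abs_sub_abs_le v u

lemma hasCompactSupport_slopeCutoff : HasCompactSupport slopeCutoff :=
  HasCompactSupport.intro (isCompact_Icc (a := (-3 : ℝ)) (b := 3)) fun u hu => by
    apply slopeCutoff_eq_zero
    by_contra h
    push Not at h
    exact hu ⟨by linarith [(abs_lt.1 h).1], by linarith [(abs_lt.1 h).2]⟩

/-- The properties of a difference of bumps that the high-low estimate uses: `W` is the half-width
of its support and `Q` a bound for its `L¹` norm. The vanishing mean makes the interaction of two
points decay with their horizontal distance. -/
structure MeanZeroProfile (η : ℝ → ℝ) (W Q : ℝ) : Prop where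
  cont : Continuous η
  width_nonneg : 0 ≤ W
  supp : ∀ t, W ≤ |t| → η t = 0
  bound : ∀ t, |η t| ≤ 3
  mean_zero : ∫ t, η t = 0
  mass : ∫ t, |η t| ≤ Q

namespace MeanZeroProfile

variable {η : ℝ → ℝ} {W Q : ℝ}

lemma hasCompactSupport (h : MeanZeroProfile η W Q) : HasCompactSupport η :=
  HasCompactSupport.intro (isCompact_Icc (a := -W) (b := W)) fun t ht => by
    apply h.supp
    by_contra h'
    push Not at h'
    exact ht ⟨by linarith [(abs_lt.1 h').1], by linarith [(abs_lt.1 h').2]⟩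

lemma integrable (h : MeanZeroProfile η W Q) : Integrable η :=
  h.cont.integrable_of_hasCompactSupport h.hasCompactSupport

lemma mass_nonneg (h : MeanZeroProfile η W Q) : 0 ≤ Q :=
  (integral_nonneg fun _ => abs_nonneg _).trans h.mass

/-- Along the slope variable a mean-zero profile of width `W` sees the `1`-Lipschitz cutoff as
constant up to `W / |B|`. -/
lemma abs_integral_cutoff_le (h : MeanZeroProfile η W Q) {B : ℝ} (hB : B ≠ 0) (c : ℝ) :
    |∫ u, slopeCutoff u * η (c - u * B)| ≤ W * Q / B ^ 2 := by
  have hB' : 0 < |B| := abs_pos.2 hB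
  have hcomp : ∀ g : ℝ → ℝ, ∫ u, g (c - u * B) = |B|⁻¹ * ∫ t, g t := by
    intro g
    rw [Measure.integral_comp_mul_right (fun t => g (c - t)) B, integral_sub_left_eq_self]
    simp [abs_inv]
  have hzero : ∫ u, η (c - u * B) = 0 := by rw [hcomp, h.mean_zero, mul_zero]
  have hmass : ∫ u, |η (c - u * B)| ≤ |B|⁻¹ * Q := by
    rw [hcomp (fun t => |η t|)]
    exact mul_le_mul_of_nonneg_left h.mass (by positivity)
  have hcont : Continuous fun u => η (c - u * B) := h.cont.comp (by fun_prop)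
  have hint : Integrable fun u => η (c - u * B) := by
    have := (h.integrable.comp_sub_left c).comp_mul_right' hB
    exact this
  have hsplit : ∫ u, slopeCutoff u * η (c - u * B)
      = ∫ u, (slopeCutoff u - slopeCutoff (c / B)) * η (c - u * B) := by
    have hi1 : Integrable fun u => slopeCutoff u * η (c - u * B) :=
      (continuous_slopeCutoff.mul hcont).integrable_of_hasCompactSupport
        hasCompactSupport_slopeCutoff.mul_right
    have : (fun u => (slopeCutoff u - slopeCutoff (c / B)) * η (c - u * B))
        = fun u => slopeCutoff u * η (c - u * B) - slopeCutoff (c / B) * η (c - u * B) := by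
      funext u; ring
    rw [this, integral_sub hi1 (hint.const_mul _), integral_const_mul, hzero]
    simp
  rw [hsplit]
  have hpt : ∀ u, |(slopeCutoff u - slopeCutoff (c / B)) * η (c - u * B)|
      ≤ W / |B| * |η (c - u * B)| := by
    intro u
    rw [abs_mul]
    by_cases hu : W ≤ |c - u * B|
    · rw [h.supp _ hu]; simp
    · push Not at hu
      refine mul_le_mul_of_nonneg_right ?_ (abs_nonneg _)
      refine (abs_slopeCutoff_sub_le _ _).trans ?_
      rw [le_div_iff₀ hB', ← abs_mul, sub_mul, div_mul_cancel₀ _ hB, abs_sub_comm]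
      exact hu.le
  calc |∫ u, (slopeCutoff u - slopeCutoff (c / B)) * η (c - u * B)|
      ≤ ∫ u, |(slopeCutoff u - slopeCutoff (c / B)) * η (c - u * B)| := abs_integral_le_integral_abs
    _ ≤ ∫ u, W / |B| * |η (c - u * B)| := by
        apply integral_mono_of_nonneg (Filter.Eventually.of_forall fun _ => abs_nonneg _)
          (hint.abs.const_mul _) (Filter.Eventually.of_forall hpt)
    _ = W / |B| * ∫ u, |η (c - u * B)| := integral_const_mul _ _
    _ ≤ W / |B| * (|B|⁻¹ * Q) :=
        mul_le_mul_of_nonneg_left hmass (div_nonneg h.width_nonneg (abs_nonneg _))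
    _ = W * Q / B ^ 2 := by rw [← sq_abs B]; field_simp

end MeanZeroProfile

/-- The interaction of two points `(X, Y)`, `(X', Y')`: the profile `η` is evaluated at the
signed vertical distances to the line `y = u x + w`, and the product is integrated over the
parameters `(u, w)` of the line. -/
noncomputable def lineCorrelation (η : ℝ → ℝ) (X Y X' Y' : ℝ) : ℝ :=
  ∫ z : ℝ × ℝ, slopeCutoff z.1 * (η (Y - z.1 * X - z.2) * η (Y' - z.1 * X' - z.2))

namespace MeanZeroProfile

variable {η : ℝ → ℝ} {W Q : ℝ}

lemma integrable_correlation (h : MeanZeroProfile η W Q) (X Y X' Y' : ℝ) :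
    Integrable (fun z : ℝ × ℝ =>
      slopeCutoff z.1 * (η (Y - z.1 * X - z.2) * η (Y' - z.1 * X' - z.2))) := by
  have hc := h.cont
  have hs := continuous_slopeCutoff
  apply Continuous.integrable_of_hasCompactSupport (by fun_prop)
  refine HasCompactSupport.intro
    (K := Set.Icc (-3 : ℝ) 3 ×ˢ Set.Icc (-(|Y| + 3 * |X| + W)) (|Y| + 3 * |X| + W))
    (isCompact_Icc.prod isCompact_Icc) fun z hz => ?_
  by_cases h1 : 3 ≤ |z.1|
  · rw [slopeCutoff_eq_zero h1, zero_mul]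
  push Not at h1
  rw [h.supp (Y - z.1 * X - z.2), zero_mul, mul_zero]
  by_contra h2
  push Not at h2
  apply hz
  have h3 : |z.2| ≤ |Y| + 3 * |X| + W := by
    have e : z.2 = Y - z.1 * X - (Y - z.1 * X - z.2) := by ring
    have h4 : |z.1 * X| ≤ 3 * |X| := by
      rw [abs_mul]; exact mul_le_mul_of_nonneg_right h1.le (abs_nonneg _)
    calc |z.2| = |Y - z.1 * X - (Y - z.1 * X - z.2)| := by rw [← e]
      _ ≤ |Y - z.1 * X| + |Y - z.1 * X - z.2| := abs_sub _ _
      _ ≤ |Y| + |z.1 * X| + |Y - z.1 * X - z.2| := by gcongr; exact abs_sub _ _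
      _ ≤ _ := by linarith
  exact ⟨⟨by linarith [(abs_lt.1 h1).1], (abs_lt.1 h1).2.le⟩, abs_le.1 h3⟩

lemma lineCorrelation_eq (h : MeanZeroProfile η W Q) (X Y X' Y' : ℝ) :
    lineCorrelation η X Y X' Y'
      = ∫ u, slopeCutoff u * ∫ v, η v * η ((Y' - Y + v) - u * (X' - X)) := by
  unfold lineCorrelation
  rw [Measure.volume_eq_prod, integral_prod _ (h.integrable_correlation X Y X' Y')]
  congr 1
  funext u
  simp only
  rw [integral_const_mul]
  congr 1
  rw [← integral_sub_left_eq_self (fun v => η v * η ((Y' - Y + v) - u * (X' - X))) volume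
    (Y - u * X)]
  congr 1
  funext w
  congr 2
  ring

lemma abs_lineCorrelation_le (h : MeanZeroProfile η W Q) (X Y X' Y' : ℝ) :
    |lineCorrelation η X Y X' Y'| ≤ 18 * Q := by
  rw [h.lineCorrelation_eq]
  have hin : ∀ c : ℝ, |∫ v, η v * η (c + v)| ≤ 3 * Q := by
    intro c
    calc |∫ v, η v * η (c + v)| ≤ ∫ v, |η v * η (c + v)| := abs_integral_le_integral_abs
      _ ≤ ∫ v, 3 * |η v| := by
          apply integral_mono_of_nonneg (Filter.Eventually.of_forall fun _ => abs_nonneg _)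
            (h.integrable.abs.const_mul _) (Filter.Eventually.of_forall fun v => ?_)
          simp only [abs_mul]
          rw [mul_comm]
          exact mul_le_mul_of_nonneg_right (h.bound _) (abs_nonneg _)
      _ = 3 * ∫ v, |η v| := integral_const_mul _ _
      _ ≤ 3 * Q := by linarith [h.mass]
  have hcut : ∫ u, slopeCutoff u ≤ 6 := by
    have hI : ∫ u, slopeCutoff u = ∫ u in Set.Icc (-3 : ℝ) 3, slopeCutoff u := by
      rw [setIntegral_eq_integral_of_forall_compl_eq_zero]
      intro u hu
      apply slopeCutoff_eq_zero
      by_contra h'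
      push Not at h'
      exact hu ⟨(abs_lt.1 h').1.le, (abs_lt.1 h').2.le⟩
    rw [hI]
    have := setIntegral_mono_on (μ := volume) (s := Set.Icc (-3 : ℝ) 3) (f := slopeCutoff)
      (g := fun _ => (1 : ℝ)) (continuous_slopeCutoff.integrableOn_Icc)
      (continuous_const.integrableOn_Icc) measurableSet_Icc (fun u _ => slopeCutoff_le_one u)
    refine this.trans ?_
    simp
    norm_num
  have hcint : Integrable slopeCutoff :=
    continuous_slopeCutoff.integrable_of_hasCompactSupport hasCompactSupport_slopeCutoff
  calc |∫ u, slopeCutoff u * ∫ v, η v * η ((Y' - Y + v) - u * (X' - X))|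
      ≤ ∫ u, |slopeCutoff u * ∫ v, η v * η ((Y' - Y + v) - u * (X' - X))| :=
        abs_integral_le_integral_abs
    _ ≤ ∫ u, slopeCutoff u * (3 * Q) := by
        apply integral_mono_of_nonneg (Filter.Eventually.of_forall fun _ => abs_nonneg _)
          (hcint.mul_const _) (Filter.Eventually.of_forall fun u => ?_)
        simp only [abs_mul, abs_of_nonneg (slopeCutoff_nonneg u)]
        refine mul_le_mul_of_nonneg_left ?_ (slopeCutoff_nonneg u)
        have := hin (Y' - Y - u * (X' - X))
        have e : ∀ v, Y' - Y + v - u * (X' - X) = Y' - Y - u * (X' - X) + v := fun v => by ring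
        simpa only [e] using this
    _ = (∫ u, slopeCutoff u) * (3 * Q) := integral_mul_const _ _
    _ ≤ 6 * (3 * Q) := mul_le_mul_of_nonneg_right hcut (by linarith [h.mass_nonneg])
    _ = 18 * Q := by ring

/-- The decay of the interaction in the horizontal distance, from the mean-zero property. -/
lemma abs_lineCorrelation_le_div (h : MeanZeroProfile η W Q) {X X' : ℝ} (hX : X' - X ≠ 0)
    (Y Y' : ℝ) :
    |lineCorrelation η X Y X' Y'| ≤ W * Q ^ 2 / (X' - X) ^ 2 := by
  rw [h.lineCorrelation_eq]
  have hc := h.cont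
  have hs := continuous_slopeCutoff
  have hswap : ∫ u, slopeCutoff u * ∫ v, η v * η ((Y' - Y + v) - u * (X' - X))
      = ∫ v, η v * ∫ u, slopeCutoff u * η ((Y' - Y + v) - u * (X' - X)) := by
    simp_rw [← integral_const_mul]
    rw [integral_integral_swap]
    · congr 1; funext v; congr 1; funext u; ring
    · apply Continuous.integrable_of_hasCompactSupport (by fun_prop)
      refine HasCompactSupport.intro
        (K := Set.Icc (-3 : ℝ) 3 ×ˢ Set.Icc (-W) W)
        (isCompact_Icc.prod isCompact_Icc) fun z hz => ?_
      simp only [Function.uncurry]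
      by_cases h1 : 3 ≤ |z.1|
      · rw [slopeCutoff_eq_zero h1, zero_mul]
      push Not at h1
      rw [h.supp z.2, zero_mul, mul_zero]
      by_contra h2
      push Not at h2
      exact hz ⟨abs_le.1 h1.le, abs_le.1 h2.le⟩
  rw [hswap]
  have hWQ : 0 ≤ W * Q / (X' - X) ^ 2 :=
    div_nonneg (mul_nonneg h.width_nonneg h.mass_nonneg) (sq_nonneg _)
  calc |∫ v, η v * ∫ u, slopeCutoff u * η ((Y' - Y + v) - u * (X' - X))|
      ≤ ∫ v, |η v * ∫ u, slopeCutoff u * η ((Y' - Y + v) - u * (X' - X))| :=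
        abs_integral_le_integral_abs
    _ ≤ ∫ v, |η v| * (W * Q / (X' - X) ^ 2) := by
        apply integral_mono_of_nonneg (Filter.Eventually.of_forall fun _ => abs_nonneg _)
          (h.integrable.abs.mul_const _) (Filter.Eventually.of_forall fun v => ?_)
        simp only [abs_mul]
        exact mul_le_mul_of_nonneg_left (h.abs_integral_cutoff_le hX _) (abs_nonneg _)
    _ = (∫ v, |η v|) * (W * Q / (X' - X) ^ 2) := integral_mul_const _ _
    _ ≤ Q * (W * Q / (X' - X) ^ 2) := mul_le_mul_of_nonneg_right h.mass hWQ
    _ = W * Q ^ 2 / (X' - X) ^ 2 := by ring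

/-- No line with slope in the range of the cutoff passes near both points. -/
lemma lineCorrelation_eq_zero (h : MeanZeroProfile η W Q) {X Y X' Y' : ℝ}
    (hfar : 3 * |X' - X| + 2 * W ≤ |Y' - Y|) : lineCorrelation η X Y X' Y' = 0 := by
  unfold lineCorrelation
  rw [integral_eq_zero_of_ae]
  refine Filter.Eventually.of_forall fun z => ?_
  simp only [Pi.zero_apply]
  by_cases h1 : 3 ≤ |z.1|
  · rw [slopeCutoff_eq_zero h1, zero_mul]
  push Not at h1
  by_cases h2 : W ≤ |Y - z.1 * X - z.2|
  · rw [h.supp _ h2, zero_mul, mul_zero]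
  by_cases h3 : W ≤ |Y' - z.1 * X' - z.2|
  · rw [h.supp _ h3, mul_zero, mul_zero]
  push Not at h2 h3
  exfalso
  have e : Y' - Y = (Y' - z.1 * X' - z.2) - (Y - z.1 * X - z.2) + z.1 * (X' - X) := by ring
  have h4 : |z.1 * (X' - X)| ≤ 3 * |X' - X| := by
    rw [abs_mul]; exact mul_le_mul_of_nonneg_right h1.le (abs_nonneg _)
  have h5 : |Y' - Y| ≤ |Y' - z.1 * X' - z.2| + |Y - z.1 * X - z.2| + |z.1 * (X' - X)| := by
    rw [e]
    exact (abs_add_le _ _).trans (by gcongr; exact abs_sub _ _)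
  linarith

end MeanZeroProfile

/-! ### The difference of two tent functions -/

/-- The tent function of height one on `[-1, 1]`. -/
noncomputable def tent (t : ℝ) : ℝ := max 0 (1 - |t|)

lemma continuous_tent : Continuous tent := by unfold tent; fun_prop

lemma tent_nonneg (t : ℝ) : 0 ≤ tent t := le_max_left _ _

lemma tent_le_one (t : ℝ) : tent t ≤ 1 := max_le zero_le_one (by linarith [abs_nonneg t])

lemma tent_eq_zero {t : ℝ} (ht : 1 ≤ |t|) : tent t = 0 := max_eq_left (by linarith)

lemma half_le_tent {t : ℝ} (ht : |t| ≤ 1 / 2) : 1 / 2 ≤ tent t :=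
  le_max_of_le_right (by linarith)

lemma hasCompactSupport_tent : HasCompactSupport tent :=
  HasCompactSupport.intro (isCompact_Icc (a := (-1 : ℝ)) (b := 1)) fun t ht => by
    apply tent_eq_zero
    by_contra h'
    push Not at h'
    exact ht ⟨(abs_lt.1 h').1.le, (abs_lt.1 h').2.le⟩

lemma integral_tent_le : ∫ t, tent t ≤ 2 := by
  have hI : ∫ u, tent u = ∫ u in Set.Icc (-1 : ℝ) 1, tent u := by
    rw [setIntegral_eq_integral_of_forall_compl_eq_zero]
    intro u hu
    apply tent_eq_zero
    by_contra h'
    push Not at h'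
    exact hu ⟨(abs_lt.1 h').1.le, (abs_lt.1 h').2.le⟩
  rw [hI]
  have := setIntegral_mono_on (μ := volume) (s := Set.Icc (-1 : ℝ) 1) (f := tent)
    (g := fun _ => (1 : ℝ)) (continuous_tent.integrableOn_Icc)
    (continuous_const.integrableOn_Icc) measurableSet_Icc (fun u _ => tent_le_one u)
  refine this.trans ?_
  simp
  norm_num

/-- A narrow tent of width `w₁` minus a wide tent of width `w₂` with the same integral. -/
noncomputable def tentDiff (w₁ w₂ t : ℝ) : ℝ := tent (t / w₁) - w₁ / w₂ * tent (t / w₂)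

lemma meanZeroProfile_tentDiff {w₁ w₂ W : ℝ} (h₁ : 0 < w₁) (h₂ : 0 < w₂) (h₁₂ : w₁ ≤ 3 * w₂)
    (hW₁ : w₁ ≤ W) (hW₂ : w₂ ≤ W) : MeanZeroProfile (tentDiff w₁ w₂) W (4 * w₁) := by
  have hint : Integrable tent :=
    continuous_tent.integrable_of_hasCompactSupport hasCompactSupport_tent
  have hi : ∀ {w : ℝ}, 0 < w → Integrable fun t => tent (t / w) := fun hw =>
    hint.comp_div hw.ne'
  have hv : ∀ {w : ℝ}, 0 < w → ∫ t, tent (t / w) = w * ∫ t, tent t := fun {w} hw => by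
    rw [Measure.integral_comp_div tent w, abs_of_pos hw, smul_eq_mul]
  have hr : 0 ≤ w₁ / w₂ := (div_pos h₁ h₂).le
  have hr3 : w₁ / w₂ ≤ 3 := by rw [div_le_iff₀ h₂]; exact h₁₂
  refine ⟨?_, h₁.le.trans hW₁, ?_, ?_, ?_, ?_⟩
  · have := continuous_tent
    unfold tentDiff
    fun_prop
  · intro t ht
    have hd : ∀ {w : ℝ}, 0 < w → w ≤ W → tent (t / w) = 0 := fun {w} hw hle => by
      apply tent_eq_zero
      rw [abs_div, abs_of_pos hw, le_div_iff₀ hw]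
      linarith
    simp [tentDiff, hd h₁ hW₁, hd h₂ hW₂]
  · intro t
    unfold tentDiff
    have a1 := tent_nonneg (t / w₁)
    have a2 := tent_le_one (t / w₁)
    have b1 := mul_nonneg hr (tent_nonneg (t / w₂))
    have b2 : w₁ / w₂ * tent (t / w₂) ≤ 3 * 1 :=
      mul_le_mul hr3 (tent_le_one _) (tent_nonneg _) (by norm_num)
    rw [abs_le]; constructor <;> linarith
  · unfold tentDiff
    rw [integral_sub (hi h₁) ((hi h₂).const_mul _), integral_const_mul, hv h₁, hv h₂]
    field_simp
    ring
  · have hle : ∀ t, |tentDiff w₁ w₂ t| ≤ tent (t / w₁) + w₁ / w₂ * tent (t / w₂) := by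
      intro t
      unfold tentDiff
      refine (abs_sub _ _).trans ?_
      rw [abs_of_nonneg (tent_nonneg _), abs_of_nonneg (mul_nonneg hr (tent_nonneg _))]
    calc ∫ t, |tentDiff w₁ w₂ t| ≤ ∫ t, (tent (t / w₁) + w₁ / w₂ * tent (t / w₂)) := by
          apply integral_mono_of_nonneg (Filter.Eventually.of_forall fun _ => abs_nonneg _)
            ((hi h₁).add ((hi h₂).const_mul _)) (Filter.Eventually.of_forall hle)
      _ = 2 * (w₁ * ∫ t, tent t) := by
          rw [integral_add (hi h₁) ((hi h₂).const_mul _), integral_const_mul, hv h₁, hv h₂]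
          field_simp
          ring
      _ ≤ 4 * w₁ := by nlinarith [integral_tent_le]

/-! ### The high-low estimate -/

/-- The index of the square of side `S⁻ⁿ` that contains `z`. -/
noncomputable def cell (S n : ℕ) (z : ℝ × ℝ) : ℤ × ℤ :=
  (⌊z.1 * (S : ℝ) ^ n⌋, ⌊z.2 * (S : ℝ) ^ n⌋)

/-- The index of the `k`-th ancestor of a square in the `S`-adic grid. -/
def ancestor (S k : ℕ) (g : ℤ × ℤ) : ℤ × ℤ := (g.1 / (S : ℤ) ^ k, g.2 / (S : ℤ) ^ k)

/-- The point `z` is within `10 S⁻ⁿ`, vertically, of the line whose parameters are the corner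
of the square with index `g` at level `n`. -/
def Near (S n : ℕ) (z : ℝ × ℝ) (g : ℤ × ℤ) : Prop :=
  |z.2 * (S : ℝ) ^ n - g.1 * z.1 - g.2| ≤ 10

open Classical in
/-- The number of points of the family `F` near the line with index `g`. -/
noncomputable def lineCount {ι : Type*} (S n : ℕ) (F : Finset ι) (z : ι → ℝ × ℝ) (g : ℤ × ℤ) : ℕ :=
  (F.filter fun p => Near S n (z p) g).card

open Classical in
/-- The number of ordered pairs of points of `F` in a common square of side `S⁻ⁿ`; it is the
sum of the squares of the numbers of points in these squares. -/
noncomputable def cellEnergy {ι : Type*} (S n : ℕ) (F : Finset ι) (z : ι → ℝ × ℝ) : ℕ :=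
  ((F ×ˢ F).filter fun q => cell S n (z q.1) = cell S n (z q.2)).card

section Combinatorics

open Classical in
lemma card_filter_prod_eq_sum {ι β : Type*} (F : Finset ι) (f g : ι → β) (T : Finset β)
    (hT : ∀ p ∈ F, f p ∈ T) :
    ((F ×ˢ F).filter fun q => g q.2 = f q.1).card
      = ∑ c ∈ T, (F.filter fun p => f p = c).card * (F.filter fun p => g p = c).card := by
  rw [Finset.card_eq_sum_card_fiberwise (f := fun q : ι × ι => f q.1) (t := T)]
  · refine Finset.sum_congr rfl fun c _ => ?_
    rw [← Finset.card_product]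
    congr 1
    ext ⟨p, q⟩
    simp only [Finset.mem_filter, Finset.mem_product]
    constructor
    · rintro ⟨⟨⟨h1, h2⟩, h3⟩, h4⟩
      exact ⟨⟨h1, h4⟩, h2, h3.trans h4⟩
    · rintro ⟨⟨h1, h2⟩, h3, h4⟩
      exact ⟨⟨⟨h1, h3⟩, h4.trans h2.symm⟩, h2⟩
  · intro q hq
    simp only [Finset.coe_filter, Finset.mem_product, Set.mem_ofPred_eq] at hq
    exact hT _ hq.1.1

open Classical in
/-- Among all translations, the identity maximises the number of pairs of points whose labels
differ by a given vector. -/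
lemma card_filter_offset_le {ι β : Type*} [AddCommGroup β] (F : Finset ι) (f : ι → β) (v : β) :
    ((F ×ˢ F).filter fun q => f q.2 - f q.1 = v).card
      ≤ ((F ×ˢ F).filter fun q => f q.1 = f q.2).card := by
  set T : Finset β := F.image f ∪ F.image (fun p => f p - v) with hT
  have hf : ∀ p ∈ F, f p ∈ T := fun p hp =>
    Finset.mem_union_left _ (Finset.mem_image_of_mem _ hp)
  have hg : ∀ p ∈ F, f p - v ∈ T := fun p hp =>
    Finset.mem_union_right _ (Finset.mem_image_of_mem (fun p => f p - v) hp)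
  have e1 : ((F ×ˢ F).filter fun q => f q.2 - f q.1 = v).card
      = ((F ×ˢ F).filter fun q => f q.2 - v = f q.1).card := by
    congr 1; ext q
    simp only [Finset.mem_filter]
    exact and_congr_right fun _ => ⟨fun h => by rw [← h]; abel, fun h => by rw [← h]; abel⟩
  have e2 : ((F ×ˢ F).filter fun q => f q.1 = f q.2).card
      = ((F ×ˢ F).filter fun q => f q.2 = f q.1).card := by
    congr 1; ext q; simp only [Finset.mem_filter, eq_comm]
  have e3 : ((F ×ˢ F).filter fun q => f q.2 = f q.1).card
      = ((F ×ˢ F).filter fun q => f q.2 - v = f q.1 - v).card := by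
    congr 1; ext q; simp only [Finset.mem_filter, sub_left_inj]
  have s1 := card_filter_prod_eq_sum F f (fun p => f p - v) T hf
  have s2 := card_filter_prod_eq_sum F f f T hf
  have s3 := card_filter_prod_eq_sum F (fun p => f p - v) (fun p => f p - v) T hg
  have key : 2 * ((F ×ˢ F).filter fun q => f q.2 - v = f q.1).card
      ≤ ((F ×ˢ F).filter fun q => f q.2 = f q.1).card
        + ((F ×ˢ F).filter fun q => f q.2 - v = f q.1 - v).card := by
    rw [s1, s2, s3, ← Finset.sum_add_distrib, Finset.mul_sum]
    refine Finset.sum_le_sum fun c _ => ?_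
    generalize (F.filter fun p => f p = c).card = a
    generalize (F.filter fun p => f p - v = c).card = b
    rcases le_total a b with h | h
    · obtain ⟨k, rfl⟩ := Nat.exists_eq_add_of_le h; nlinarith [Nat.zero_le (k * k)]
    · obtain ⟨k, rfl⟩ := Nat.exists_eq_add_of_le h; nlinarith [Nat.zero_le (k * k)]
  rw [e1, e2]
  rw [← e3] at key
  omega

lemma sum_inv_natAbs_le (N : ℕ) :
    ∑ m ∈ Finset.Ioo (-(N : ℤ)) N, (1 : ℝ) / ((m.natAbs : ℝ) + 1) ≤ 2 * (1 + Real.log N) := by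
  have h1 : ∀ m ∈ Finset.Ioo (-(N : ℤ)) N, m.natAbs ∈ Finset.range N := by
    intro m hm
    rw [Finset.mem_Ioo] at hm
    rw [Finset.mem_range]
    omega
  rw [← Finset.sum_fiberwise_of_maps_to h1]
  have h2 : ∀ j ∈ Finset.range N,
      ∑ m ∈ (Finset.Ioo (-(N : ℤ)) N).filter (fun m => m.natAbs = j),
        (1 : ℝ) / ((m.natAbs : ℝ) + 1) ≤ 2 * (((j : ℝ) + 1)⁻¹) := by
    intro j _
    have h3 : ∀ m ∈ (Finset.Ioo (-(N : ℤ)) N).filter (fun m => m.natAbs = j),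
        (1 : ℝ) / ((m.natAbs : ℝ) + 1) = ((j : ℝ) + 1)⁻¹ := by
      intro m hm
      rw [(Finset.mem_filter.1 hm).2, one_div]
    rw [Finset.sum_congr rfl h3, Finset.sum_const, nsmul_eq_mul]
    refine mul_le_mul_of_nonneg_right ?_ (by positivity)
    have h4 : (Finset.Ioo (-(N : ℤ)) N).filter (fun m => m.natAbs = j) ⊆ {(j : ℤ), -(j : ℤ)} := by
      intro m hm
      have := (Finset.mem_filter.1 hm).2
      simp only [Finset.mem_insert, Finset.mem_singleton]
      omega
    exact_mod_cast (Finset.card_le_card h4).trans Finset.card_le_two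
  refine (Finset.sum_le_sum h2).trans ?_
  rw [← Finset.mul_sum]
  have h5 := harmonic_le_one_add_log N
  have h6 : ((harmonic N : ℚ) : ℝ) = ∑ j ∈ Finset.range N, ((j : ℝ) + 1)⁻¹ := by
    simp [harmonic]
  rw [← h6]
  linarith

end Combinatorics

section Energy

variable {ι : Type*} (F : Finset ι) (z : ι → ℝ × ℝ)

/-- Bound for a single interaction in terms of the offset `v` of the squares of side `N⁻¹` that
contain the two points. -/
lemma abs_lineCorrelation_le_of_offset {η : ℝ → ℝ} {S N : ℕ} (hS : 1 ≤ S) (hN : 1 ≤ N)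
    (h : MeanZeroProfile η (32 * S / N) (96 / N)) {X Y X' Y' : ℝ} {v : ℤ × ℤ}
    (h1 : ⌊X' * N⌋ - ⌊X * N⌋ = v.1) (h2 : ⌊Y' * N⌋ - ⌊Y * N⌋ = v.2) :
    |lineCorrelation η X Y X' Y'| ≤
      if v.2.natAbs ≤ 71 * S * (v.1.natAbs + 1) then
        3000000 * S / N / ((v.1.natAbs : ℝ) + 1) ^ 2 else 0 := by
  have hNR : (0 : ℝ) < N := by exact_mod_cast hN
  have hSR : (1 : ℝ) ≤ S := by exact_mod_cast hS
  have hv1 : |((X' - X) * N) - v.1| ≤ 1 := by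
    rw [← h1]; push_cast
    have a1 := Int.floor_le (X * N); have a2 := Int.lt_floor_add_one (X * N)
    have b1 := Int.floor_le (X' * N); have b2 := Int.lt_floor_add_one (X' * N)
    rw [abs_le]; constructor <;> nlinarith
  have hv2 : |((Y' - Y) * N) - v.2| ≤ 1 := by
    rw [← h2]; push_cast
    have a1 := Int.floor_le (Y * N); have a2 := Int.lt_floor_add_one (Y * N)
    have b1 := Int.floor_le (Y' * N); have b2 := Int.lt_floor_add_one (Y' * N)
    rw [abs_le]; constructor <;> nlinarith
  have na1 : ((v.1.natAbs : ℕ) : ℝ) = |(v.1 : ℝ)| := by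
    rw [Nat.cast_natAbs, Int.cast_abs]
  have na2 : ((v.2.natAbs : ℕ) : ℝ) = |(v.2 : ℝ)| := by
    rw [Nat.cast_natAbs, Int.cast_abs]
  have e1 : |(X' - X) * N| = |X' - X| * N := by rw [abs_mul, abs_of_pos hNR]
  have e2 : |(Y' - Y) * N| = |Y' - Y| * N := by rw [abs_mul, abs_of_pos hNR]
  have x1 : |X' - X| * N ≤ |(v.1 : ℝ)| + 1 := by
    rw [← e1]
    have := abs_sub_abs_le_abs_sub ((X' - X) * N) v.1
    linarith
  have x2 : |(v.1 : ℝ)| - 1 ≤ |X' - X| * N := by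
    rw [← e1]
    have := abs_sub_abs_le_abs_sub (v.1 : ℝ) ((X' - X) * N)
    rw [abs_sub_comm] at this
    linarith
  have y2 : |(v.2 : ℝ)| - 1 ≤ |Y' - Y| * N := by
    rw [← e2]
    have := abs_sub_abs_le_abs_sub (v.2 : ℝ) ((Y' - Y) * N)
    rw [abs_sub_comm] at this
    linarith
  split_ifs with hif
  · -- For adjacent columns the trivial bound is enough; the decay is used for the others.
    by_cases hm : v.1.natAbs ≤ 1
    · refine (h.abs_lineCorrelation_le _ _ _ _).trans ?_
      have hm' : (v.1.natAbs : ℝ) ≤ 1 := by exact_mod_cast hm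
      have hm0 : (0 : ℝ) ≤ v.1.natAbs := Nat.cast_nonneg _
      rw [div_div, ← mul_div_assoc, div_le_div_iff₀ hNR (by positivity)]
      have : ((v.1.natAbs : ℝ) + 1) ^ 2 ≤ 4 := by nlinarith
      nlinarith [mul_pos hNR hNR]
    · push Not at hm
      have hm' : (2 : ℝ) ≤ |(v.1 : ℝ)| := by rw [← na1]; exact_mod_cast hm
      have hpos : 0 < |X' - X| * N := by linarith
      have hX : X' - X ≠ 0 := by
        intro h0; rw [h0] at hpos; simp at hpos
      refine (h.abs_lineCorrelation_le_div hX _ _).trans ?_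
      rw [na1]
      have h3 : |(v.1 : ℝ)| + 1 ≤ 3 * (|X' - X| * N) := by linarith
      have h4 : (|(v.1 : ℝ)| + 1) ^ 2 ≤ 9 * ((X' - X) ^ 2 * N ^ 2) := by
        have : (|(v.1 : ℝ)| + 1) ^ 2 ≤ (3 * (|X' - X| * N)) ^ 2 := by gcongr
        rw [mul_pow, mul_pow, sq_abs] at this
        linarith
      have hX2 : 0 < (X' - X) ^ 2 := by positivity
      have e : 32 * (S : ℝ) / N * (96 / N) ^ 2 / (X' - X) ^ 2
          = 294912 * S / N * (1 / (N ^ 2 * (X' - X) ^ 2)) := by field_simp; ring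
      rw [e, div_eq_mul_one_div (3000000 * (S : ℝ) / N)]
      have h5 : 1 / (N ^ 2 * (X' - X) ^ 2) ≤ 9 * (1 / (|(v.1 : ℝ)| + 1) ^ 2) := by
        rw [mul_one_div, div_le_div_iff₀ (by positivity) (by positivity)]
        linarith
      calc 294912 * (S : ℝ) / N * (1 / (N ^ 2 * (X' - X) ^ 2))
          ≤ 294912 * (S : ℝ) / N * (9 * (1 / (|(v.1 : ℝ)| + 1) ^ 2)) := by gcongr
        _ = 2654208 * ((S : ℝ) / N * (1 / (|(v.1 : ℝ)| + 1) ^ 2)) := by ring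
        _ ≤ 3000000 * ((S : ℝ) / N * (1 / (|(v.1 : ℝ)| + 1) ^ 2)) := by gcongr; norm_num
        _ = _ := by ring
  · push Not at hif
    have hif' : (71 : ℝ) * S * (|(v.1 : ℝ)| + 1) + 1 ≤ |(v.2 : ℝ)| := by
      rw [← na1, ← na2]; exact_mod_cast hif
    have hz : lineCorrelation η X Y X' Y' = 0 := by
      apply h.lineCorrelation_eq_zero
      have hm0 := abs_nonneg (v.1 : ℝ)
      have p1 : (1 : ℝ) * (|(v.1 : ℝ)| + 1) ≤ S * (|(v.1 : ℝ)| + 1) := by gcongr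
      have p2 : (S : ℝ) * 1 ≤ S * (|(v.1 : ℝ)| + 1) := by gcongr; linarith
      have : (3 * |X' - X| + 2 * (32 * S / N)) * N ≤ |Y' - Y| * N := by
        have e : (3 * |X' - X| + 2 * (32 * S / N)) * N = 3 * (|X' - X| * N) + 64 * S := by
          field_simp; ring
        rw [e]
        nlinarith
      exact le_of_mul_le_mul_right this hNR
    rw [hz, abs_zero]

/-- A Schur test: the interactions of all pairs are controlled by the energy. -/
lemma sum_abs_lineCorrelation_le {η : ℝ → ℝ} {S l : ℕ} (hS : 1 ≤ S)
    (h : MeanZeroProfile η (32 * S / (S ^ l : ℕ)) (96 / (S ^ l : ℕ)))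
    (hX : ∀ p ∈ F, 0 ≤ (z p).1 ∧ (z p).1 < 1) :
    ∑ q ∈ F ×ˢ F, |lineCorrelation η (z q.1).1 (z q.1).2 (z q.2).1 (z q.2).2|
      ≤ 900000000 * S ^ 2 / (S ^ l : ℕ) * (1 + Real.log (S ^ l : ℕ)) * cellEnergy S l F z := by
  classical
  set N : ℕ := S ^ l with hNdef
  have hN : 1 ≤ N := Nat.one_le_pow _ _ hS
  have hNR : (0 : ℝ) < N := by exact_mod_cast hN
  set off : ι × ι → ℤ × ℤ := fun q => cell S l (z q.2) - cell S l (z q.1) with hoff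
  set k : ℤ → ℝ := fun m => 3000000 * S / N / ((m.natAbs : ℝ) + 1) ^ 2 with hk
  have hk0 : ∀ m, 0 ≤ k m := fun m => by simp only [hk]; positivity
  set Ker : ℤ × ℤ → ℝ := fun v =>
    if v.2.natAbs ≤ 71 * S * (v.1.natAbs + 1) then k v.1 else 0 with hKer
  have hKer0 : ∀ v, 0 ≤ Ker v := fun v => by
    simp only [hKer]; split_ifs; exacts [hk0 _, le_rfl]
  have hpt : ∀ q ∈ F ×ˢ F,
      |lineCorrelation η (z q.1).1 (z q.1).2 (z q.2).1 (z q.2).2| ≤ Ker (off q) := by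
    intro q _
    apply abs_lineCorrelation_le_of_offset hS hN h
    · simp [hoff, cell, hNdef]
    · simp [hoff, cell, hNdef]
  set T := (F ×ˢ F).image off with hT
  have hmaps : ∀ q ∈ F ×ˢ F, off q ∈ T := fun q hq => Finset.mem_image_of_mem _ hq
  set E : ℝ := (cellEnergy S l F z : ℝ) with hE
  have hfib : ∀ v, (((F ×ˢ F).filter fun q => off q = v).card : ℝ) ≤ E := by
    intro v
    simp only [hE, cellEnergy]
    refine Nat.cast_le.2 ?_
    convert card_filter_offset_le F (fun p => cell S l (z p)) v
  have hTsub : T ⊆ Finset.Ioo (-(N : ℤ)) N ×ˢ T.image Prod.snd := by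
    intro v hv
    rw [Finset.mem_product]
    refine ⟨?_, Finset.mem_image_of_mem _ hv⟩
    obtain ⟨q, hq, rfl⟩ := Finset.mem_image.1 hv
    rw [Finset.mem_product] at hq
    have hfl : ∀ p ∈ F, 0 ≤ (cell S l (z p)).1 ∧ (cell S l (z p)).1 < N := by
      intro p hp
      have hNR' : (0 : ℝ) < (S : ℝ) ^ l := by exact_mod_cast hN
      have hNe : (N : ℝ) = (S : ℝ) ^ l := by simp [hNdef]
      constructor
      · exact Int.floor_nonneg.2 (mul_nonneg (hX p hp).1 hNR'.le)
      · simp only [cell]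
        rw [Int.floor_lt]
        push_cast
        rw [hNe]
        nlinarith [(hX p hp).2]
    have f1 := hfl q.1 hq.1
    have f2 := hfl q.2 hq.2
    rw [Finset.mem_Ioo]
    simp only [hoff, Prod.fst_sub]
    omega
  have hinner : ∀ m : ℤ, ∑ n ∈ T.image Prod.snd, Ker (m, n)
      ≤ 429000000 * S ^ 2 / N * (1 / ((m.natAbs : ℝ) + 1)) := by
    intro m
    simp only [hKer]
    rw [← Finset.sum_filter, Finset.sum_const, nsmul_eq_mul]
    have hsub : (T.image Prod.snd).filter (fun n => n.natAbs ≤ 71 * S * (m.natAbs + 1))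
        ⊆ Finset.Icc (-((71 * S * (m.natAbs + 1) : ℕ) : ℤ)) ((71 * S * (m.natAbs + 1) : ℕ) : ℤ) := by
      intro n hn
      have := (Finset.mem_filter.1 hn).2
      rw [Finset.mem_Icc]
      omega
    have hc := Finset.card_le_card hsub
    rw [Int.card_Icc] at hc
    have hc' : ((T.image Prod.snd).filter
        (fun n => n.natAbs ≤ 71 * S * (m.natAbs + 1))).card ≤ 143 * (S * (m.natAbs + 1)) := by
      have h1 : 1 ≤ S * (m.natAbs + 1) := Nat.mul_pos hS (Nat.succ_pos _)
      have h2 : 71 * S * (m.natAbs + 1) = 71 * (S * (m.natAbs + 1)) := by ring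
      rw [h2] at hc
      rw [h2]
      omega
    have hc'' : (((T.image Prod.snd).filter
        (fun n => n.natAbs ≤ 71 * S * (m.natAbs + 1))).card : ℝ)
          ≤ 143 * (S * ((m.natAbs : ℝ) + 1)) := by exact_mod_cast hc'
    calc _ ≤ 143 * (S * ((m.natAbs : ℝ) + 1)) * k m :=
          mul_le_mul_of_nonneg_right hc'' (hk0 m)
      _ = _ := by
          simp only [hk]
          have : ((m.natAbs : ℝ) + 1) ≠ 0 := by positivity
          field_simp
          ring
  -- The sum over the vertical offsets costs one factor `m + 1`; the remaining sum is harmonic.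
  have hKerSum : ∑ v ∈ T, Ker v ≤ 900000000 * S ^ 2 / N * (1 + Real.log N) := by
    calc ∑ v ∈ T, Ker v ≤ ∑ v ∈ Finset.Ioo (-(N : ℤ)) N ×ˢ T.image Prod.snd, Ker v :=
          Finset.sum_le_sum_of_subset_of_nonneg hTsub fun v _ _ => hKer0 v
      _ = ∑ m ∈ Finset.Ioo (-(N : ℤ)) N, ∑ n ∈ T.image Prod.snd, Ker (m, n) :=
          Finset.sum_product _ _ _
      _ ≤ ∑ m ∈ Finset.Ioo (-(N : ℤ)) N, 429000000 * S ^ 2 / N * (1 / ((m.natAbs : ℝ) + 1)) :=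
          Finset.sum_le_sum fun m _ => hinner m
      _ = 429000000 * S ^ 2 / N *
            ∑ m ∈ Finset.Ioo (-(N : ℤ)) N, (1 / ((m.natAbs : ℝ) + 1)) := by
          rw [Finset.mul_sum]
      _ ≤ 429000000 * S ^ 2 / N * (2 * (1 + Real.log N)) := by
          gcongr; exact sum_inv_natAbs_le N
      _ = 858000000 * (S ^ 2 / N * (1 + Real.log N)) := by ring
      _ ≤ 900000000 * (S ^ 2 / N * (1 + Real.log N)) := by
          have : 0 ≤ Real.log N := Real.log_natCast_nonneg N
          gcongr; norm_num
      _ = _ := by ring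
  calc ∑ q ∈ F ×ˢ F, |lineCorrelation η (z q.1).1 (z q.1).2 (z q.2).1 (z q.2).2|
      ≤ ∑ q ∈ F ×ˢ F, Ker (off q) := Finset.sum_le_sum hpt
    _ = ∑ v ∈ T, ∑ q ∈ (F ×ˢ F).filter (fun q => off q = v), Ker (off q) :=
        (Finset.sum_fiberwise_of_maps_to hmaps _).symm
    _ = ∑ v ∈ T, (((F ×ˢ F).filter fun q => off q = v).card : ℝ) * Ker v := by
        refine Finset.sum_congr rfl fun v _ => ?_
        rw [← nsmul_eq_mul, ← Finset.sum_const]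
        exact Finset.sum_congr rfl fun q hq => by rw [(Finset.mem_filter.1 hq).2]
    _ ≤ ∑ v ∈ T, E * Ker v :=
        Finset.sum_le_sum fun v _ => mul_le_mul_of_nonneg_right (hfib v) (hKer0 v)
    _ = E * ∑ v ∈ T, Ker v := by rw [Finset.mul_sum]
    _ ≤ E * (900000000 * S ^ 2 / N * (1 + Real.log N)) :=
        mul_le_mul_of_nonneg_left hKerSum (Nat.cast_nonneg _)
    _ = _ := by ring

/-- The `L²` norm of the high-frequency part, over all lines, is the sum of all interactions. -/
lemma integral_sq_sum_eq {η : ℝ → ℝ} {W Q : ℝ} (h : MeanZeroProfile η W Q) :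
    ∫ y : ℝ × ℝ, slopeCutoff y.1 * (∑ p ∈ F, η ((z p).2 - y.1 * (z p).1 - y.2)) ^ 2
      = ∑ q ∈ F ×ˢ F, lineCorrelation η (z q.1).1 (z q.1).2 (z q.2).1 (z q.2).2 := by
  unfold lineCorrelation
  rw [← integral_finsetSum _ fun q _ => h.integrable_correlation _ _ _ _]
  congr 1
  funext y
  rw [sq, Finset.sum_mul_sum, ← Finset.sum_product', Finset.mul_sum]

lemma integrable_sq_sum {η : ℝ → ℝ} {W Q : ℝ} (h : MeanZeroProfile η W Q) :
    Integrable fun y : ℝ × ℝ =>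
      slopeCutoff y.1 * (∑ p ∈ F, η ((z p).2 - y.1 * (z p).1 - y.2)) ^ 2 := by
  have : Integrable fun y : ℝ × ℝ => ∑ q ∈ F ×ˢ F, slopeCutoff y.1 *
      (η ((z q.1).2 - y.1 * (z q.1).1 - y.2) * η ((z q.2).2 - y.1 * (z q.2).1 - y.2)) :=
    integrable_finsetSum _ fun q _ => h.integrable_correlation _ _ _ _
  convert this using 2 with y
  rw [sq, Finset.sum_mul_sum, ← Finset.sum_product', Finset.mul_sum]

/-- The square of side `1 / N` with index `g` in the plane of the parameters of lines. -/
def paramSquare (N : ℕ) (g : ℤ × ℤ) : Set (ℝ × ℝ) :=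
  Set.Ico ((g.1 : ℝ) / N) ((g.1 + 1) / N) ×ˢ Set.Ico ((g.2 : ℝ) / N) ((g.2 + 1) / N)

lemma mem_paramSquare {N : ℕ} (hN : 1 ≤ N) {g : ℤ × ℤ} {y : ℝ × ℝ} :
    y ∈ paramSquare N g ↔ ⌊y.1 * N⌋ = g.1 ∧ ⌊y.2 * N⌋ = g.2 := by
  have hNR : (0 : ℝ) < N := by exact_mod_cast hN
  simp only [paramSquare, Set.mem_prod, Set.mem_Ico, Int.floor_eq_iff, div_le_iff₀ hNR,
    lt_div_iff₀ hNR]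

lemma volume_paramSquare {N : ℕ} (g : ℤ × ℤ) :
    volume.real (paramSquare N g) = 1 / (N : ℝ) ^ 2 := by
  unfold paramSquare
  rw [Measure.real, Measure.volume_eq_prod, Measure.prod_prod, ENNReal.toReal_mul]
  rw [Real.volume_Ico, Real.volume_Ico]
  have : ∀ a : ℝ, (a + 1) / N - a / N = 1 / N := fun a => by ring
  rw [this, this, ENNReal.toReal_ofReal (by positivity)]
  ring

end Energy

/-- On the square with index `g`, the high-frequency part is at least a quarter of the number of
points near the line, as soon as the low-frequency part is small. -/
lemma quarter_lineCount_le {ι : Type*} {F : Finset ι} {z : ι → ℝ × ℝ} {S l : ℕ} (hS : 1 ≤ S)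
    (hX : ∀ p ∈ F, 0 ≤ (z p).1 ∧ (z p).1 < 1) {g : ℤ × ℤ}
    (hhigh : 16 * lineCount S l F z (ancestor S 1 g) ≤ S * lineCount S (l + 1) F z g)
    {y : ℝ × ℝ} (hy : y ∈ paramSquare (S ^ (l + 1)) g) :
    (lineCount S (l + 1) F z g : ℝ) / 4
      ≤ ∑ p ∈ F, tentDiff (24 / (S ^ (l + 1) : ℕ)) (8 * S / (S ^ (l + 1) : ℕ))
          ((z p).2 - y.1 * (z p).1 - y.2) := by
  classical
  set N : ℕ := S ^ (l + 1) with hNdef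
  have hN : 1 ≤ N := Nat.one_le_pow _ _ hS
  have hNR : (0 : ℝ) < N := by exact_mod_cast hN
  have hSR : (1 : ℝ) ≤ S := by exact_mod_cast hS
  have hS0 : (0 : ℝ) < S := by linarith
  have hNe : (N : ℝ) = (S : ℝ) ^ (l + 1) := by simp [hNdef]
  have hNS : (N : ℝ) = (S : ℝ) ^ l * S := by rw [hNe, pow_succ]
  rw [mem_paramSquare hN] at hy
  obtain ⟨hy1, hy2⟩ := hy
  have a1 := Int.floor_le (y.1 * N); have a2 := Int.lt_floor_add_one (y.1 * N)
  have b1 := Int.floor_le (y.2 * N); have b2 := Int.lt_floor_add_one (y.2 * N)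
  rw [hy1] at a1 a2
  rw [hy2] at b1 b2
  set A := F.filter fun p => Near S (l + 1) (z p) g with hA
  set B := F.filter fun p => Near S l (z p) (ancestor S 1 g) with hB
  have hsum : ∑ p ∈ F, tentDiff (24 / N) (8 * S / N) ((z p).2 - y.1 * (z p).1 - y.2)
      = ∑ p ∈ F, tent (((z p).2 - y.1 * (z p).1 - y.2) / (24 / N))
        - 3 / S * ∑ p ∈ F, tent (((z p).2 - y.1 * (z p).1 - y.2) / (8 * S / N)) := by
    rw [Finset.mul_sum, ← Finset.sum_sub_distrib]
    refine Finset.sum_congr rfl fun p _ => ?_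
    unfold tentDiff
    have : 24 / (N : ℝ) / (8 * S / N) = 3 / S := by field_simp; norm_num
    rw [this]
  have hlow : ∑ p ∈ F, tent (((z p).2 - y.1 * (z p).1 - y.2) / (8 * S / N)) ≤ B.card := by
    have hz : ∀ p ∈ F, p ∉ B → tent (((z p).2 - y.1 * (z p).1 - y.2) / (8 * S / N)) = 0 := by
      intro p hp hpB
      apply tent_eq_zero
      by_contra hlt
      push Not at hlt
      apply hpB
      rw [hB, Finset.mem_filter]
      refine ⟨hp, ?_⟩
      rw [abs_div, abs_of_pos (show (0 : ℝ) < 8 * S / N by positivity),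
        div_lt_one (by positivity), lt_div_iff₀ hNR] at hlt
      have hd : |((z p).2 - y.1 * (z p).1 - y.2) * N / S| < 8 := by
        rw [abs_div, abs_mul, abs_of_pos hNR, abs_of_pos hS0, div_lt_iff₀ hS0]
        exact hlt
      have key : ∀ (m : ℤ) (c : ℝ), (m : ℝ) ≤ c → c < m + 1 →
          ((m / (S : ℤ) : ℤ) : ℝ) ≤ c / S ∧ c / S < ((m / (S : ℤ) : ℤ) : ℝ) + 1 := by
        intro m c h1 h2
        have hSZ : (0 : ℤ) < S := by exact_mod_cast hS
        have q1 := Int.ediv_mul_le m hSZ.ne'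
        have q2 := Int.lt_ediv_add_one_mul_self m hSZ
        have q1' : ((m / (S : ℤ) : ℤ) : ℝ) * S ≤ m := by exact_mod_cast q1
        have q2' : (m : ℝ) + 1 ≤ (((m / (S : ℤ) : ℤ) : ℝ) + 1) * S := by exact_mod_cast q2
        constructor
        · rw [le_div_iff₀ hS0]; linarith
        · rw [div_lt_iff₀ hS0]; linarith
      have k1 := key g.1 _ a1 a2
      have k2 := key g.2 _ b1 b2
      unfold Near ancestor
      simp only [pow_one]
      have hx := hX p hp
      have e : ((z p).2 - y.1 * (z p).1 - y.2) * N / S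
          = (z p).2 * (S : ℝ) ^ l - y.1 * N / S * (z p).1 - y.2 * N / S := by
        rw [hNS]; field_simp
      rw [e] at hd
      rw [abs_lt] at hd
      rw [abs_le]
      constructor <;> nlinarith
    have := Finset.sum_subset (Finset.filter_subset (fun p => Near S l (z p) (ancestor S 1 g)) F)
      (fun p hp hpB => hz p hp hpB)
    rw [← this]
    calc ∑ p ∈ B, tent (((z p).2 - y.1 * (z p).1 - y.2) / (8 * S / N)) ≤ ∑ p ∈ B, (1 : ℝ) :=
          Finset.sum_le_sum fun p _ => tent_le_one _
      _ = B.card := by simp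
  have hup : (A.card : ℝ) / 2 ≤ ∑ p ∈ F, tent (((z p).2 - y.1 * (z p).1 - y.2) / (24 / N)) := by
    calc (A.card : ℝ) / 2 = ∑ p ∈ A, (1 / 2 : ℝ) := by simp; ring
      _ ≤ ∑ p ∈ A, tent (((z p).2 - y.1 * (z p).1 - y.2) / (24 / N)) := by
          refine Finset.sum_le_sum fun p hp => ?_
          rw [hA, Finset.mem_filter] at hp
          apply half_le_tent
          rw [abs_div, abs_of_pos (show (0 : ℝ) < 24 / N by positivity),
            div_le_iff₀ (by positivity)]
          have hx := hX p hp.1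
          have hn := hp.2
          unfold Near at hn
          rw [← hNe] at hn
          have : |((z p).2 - y.1 * (z p).1 - y.2) * N| ≤ 12 := by
            have e : ((z p).2 - y.1 * (z p).1 - y.2) * N
              = ((z p).2 * N - g.1 * (z p).1 - g.2) - (y.1 * N - g.1) * (z p).1
                - (y.2 * N - g.2) := by ring
            rw [e]
            rw [abs_le] at hn ⊢
            constructor <;> nlinarith
          rw [abs_mul, abs_of_pos hNR] at this
          have e2 : (1 : ℝ) / 2 * (24 / N) = 12 / N := by ring
          rw [e2, le_div_iff₀ hNR]
          exact this
      _ ≤ _ := Finset.sum_le_sum_of_subset_of_nonneg (Finset.filter_subset _ _)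
          fun p _ _ => tent_nonneg _
  have hAB : 16 * (B.card : ℝ) ≤ S * A.card := by
    have : 16 * B.card ≤ S * A.card := by
      simpa only [lineCount, hA, hB] using hhigh
    exact_mod_cast this
  have hlc : (lineCount S (l + 1) F z g : ℝ) = A.card := by simp only [lineCount, hA]
  rw [hsum, hlc]
  have h3 : 3 / (S : ℝ) * ∑ p ∈ F, tent (((z p).2 - y.1 * (z p).1 - y.2) / (8 * S / N))
      ≤ A.card / 4 := by
    calc _ ≤ 3 / (S : ℝ) * B.card := by gcongr
      _ ≤ 3 / (S : ℝ) * (S * A.card / 16) := by gcongr; linarith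
      _ = 3 / 16 * A.card := by field_simp
      _ ≤ _ := by linarith [Nat.cast_nonneg (α := ℝ) A.card]
  linarith

/-- **High-low estimate.** On a family of lines at scale `S⁻⁽ˡ⁺¹⁾` each of which has near it at
least the proportion `16 / S` of the points near its ancestor at scale `S⁻ˡ`, the number of points
near a line is controlled in `L²` by the energy of the points. -/
theorem sum_sq_lineCount_le {ι : Type*} (F : Finset ι) (z : ι → ℝ × ℝ) {S l : ℕ} (hS : 1 ≤ S)
    (hX : ∀ p ∈ F, 0 ≤ (z p).1 ∧ (z p).1 < 1) (Γ : Finset (ℤ × ℤ))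
    (hΓ : ∀ g ∈ Γ, |g.1| ≤ (S : ℤ) ^ (l + 1))
    (hhigh : ∀ g ∈ Γ, 16 * lineCount S l F z (ancestor S 1 g) ≤ S * lineCount S (l + 1) F z g) :
    ∑ g ∈ Γ, (lineCount S (l + 1) F z g : ℝ) ^ 2
      ≤ 20000000000 * (l + 2) * S ^ 3 * S ^ (l + 1) * cellEnergy S (l + 1) F z := by
  set N : ℕ := S ^ (l + 1) with hNdef
  have hN : 1 ≤ N := Nat.one_le_pow _ _ hS
  have hNR : (1 : ℝ) ≤ N := by exact_mod_cast hN
  have hSR : (1 : ℝ) ≤ S := by exact_mod_cast hS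
  have hN0 : (0 : ℝ) < N := by linarith
  have hNe : (N : ℝ) = (S : ℝ) ^ (l + 1) := by simp [hNdef]
  have hprof : MeanZeroProfile (tentDiff (24 / N) (8 * S / N)) (32 * S / N) (96 / N) := by
    have := meanZeroProfile_tentDiff (w₁ := 24 / (N : ℝ)) (w₂ := 8 * S / N) (W := 32 * S / N)
      (by positivity) (by positivity)
      (by rw [← mul_div_assoc]; gcongr; linarith) (by gcongr; linarith) (by gcongr; norm_num)
    have e : 4 * (24 / (N : ℝ)) = 96 / N := by ring
    rwa [e] at this
  set f : ℝ × ℝ → ℝ := fun y => slopeCutoff y.1 *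
    (∑ p ∈ F, tentDiff (24 / N) (8 * S / N) ((z p).2 - y.1 * (z p).1 - y.2)) ^ 2 with hf
  have hfint : Integrable f := integrable_sq_sum F z hprof
  have hf0 : ∀ y, 0 ≤ f y := fun y => mul_nonneg (slopeCutoff_nonneg _) (sq_nonneg _)
  have hmeas : ∀ g ∈ Γ, MeasurableSet (paramSquare N g) := fun g _ =>
    measurableSet_Ico.prod measurableSet_Ico
  have hdisj : (Γ : Set (ℤ × ℤ)).Pairwise (Function.onFun Disjoint (paramSquare N)) := by
    intro g _ g' _ hne
    rw [Function.onFun, Set.disjoint_left]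
    intro y hy hy'
    rw [mem_paramSquare hN] at hy hy'
    exact hne (Prod.ext (hy.1.symm.trans hy'.1) (hy.2.symm.trans hy'.2))
  have hlower : ∑ g ∈ Γ, (lineCount S (l + 1) F z g : ℝ) ^ 2 / 16 * (1 / (N : ℝ) ^ 2)
      ≤ ∫ y, f y := by
    calc _ ≤ ∑ g ∈ Γ, ∫ y in paramSquare N g, f y := by
          refine Finset.sum_le_sum fun g hg => ?_
          have hconst : ∫ y in paramSquare N g, ((lineCount S (l + 1) F z g : ℝ) ^ 2 / 16)
              = (lineCount S (l + 1) F z g : ℝ) ^ 2 / 16 * (1 / (N : ℝ) ^ 2) := by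
            rw [setIntegral_const, volume_paramSquare, smul_eq_mul, mul_comm]
          rw [← hconst]
          have hfin : volume (paramSquare N g) ≠ ⊤ := by
            unfold paramSquare
            rw [Measure.volume_eq_prod, Measure.prod_prod, Real.volume_Ico, Real.volume_Ico]
            exact ENNReal.mul_ne_top ENNReal.ofReal_ne_top ENNReal.ofReal_ne_top
          apply setIntegral_mono_on (integrableOn_const hfin) hfint.integrableOn (hmeas g hg)
          intro y hy
          have hq := quarter_lineCount_le hS hX (hhigh g hg) hy
          have hy1 : |y.1| ≤ 2 := by
            rw [mem_paramSquare hN] at hy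
            have a1 := Int.floor_le (y.1 * N); have a2 := Int.lt_floor_add_one (y.1 * N)
            rw [hy.1] at a1 a2
            have hg1 := hΓ g hg
            have hg2 : |(g.1 : ℝ)| ≤ N := by rw [hNe]; exact_mod_cast hg1
            rw [abs_le] at hg2 ⊢
            constructor <;> nlinarith
          simp only [hf]
          rw [slopeCutoff_eq_one hy1, one_mul]
          have h0 : (0 : ℝ) ≤ (lineCount S (l + 1) F z g : ℝ) / 4 := by positivity
          calc (lineCount S (l + 1) F z g : ℝ) ^ 2 / 16
              = ((lineCount S (l + 1) F z g : ℝ) / 4) ^ 2 := by ring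
            _ ≤ _ := by gcongr
      _ = ∫ y in ⋃ g ∈ Γ, paramSquare N g, f y :=
          (integral_biUnion_finset Γ hmeas hdisj fun g _ => hfint.integrableOn).symm
      _ ≤ ∫ y, f y := setIntegral_le_integral hfint (Filter.Eventually.of_forall hf0)
  have hupper : ∫ y, f y
      ≤ 900000000 * S ^ 2 / N * (1 + Real.log N) * cellEnergy S (l + 1) F z := by
    rw [hf, integral_sq_sum_eq F z hprof]
    exact (Finset.sum_le_sum fun q _ => le_abs_self _).trans
      (sum_abs_lineCorrelation_le F z hS hprof hX)
  have hlog : 1 + Real.log N ≤ (l + 2) * S := by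
    rw [hNe, Real.log_pow]
    have h1 : Real.log S ≤ S := (Real.log_le_sub_one_of_pos (by linarith)).trans (by linarith)
    push_cast
    have h2 : ((l : ℝ) + 1) * Real.log S ≤ (l + 1) * S := by gcongr
    linarith
  have hE0 : (0 : ℝ) ≤ cellEnergy S (l + 1) F z := Nat.cast_nonneg _
  have hcomb := hlower.trans hupper
  rw [← Finset.sum_mul, ← Finset.sum_div] at hcomb
  have h2 : (∑ g ∈ Γ, (lineCount S (l + 1) F z g : ℝ) ^ 2)
      ≤ 16 * N ^ 2 * (900000000 * S ^ 2 / N * (1 + Real.log N) * cellEnergy S (l + 1) F z) := by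
    have := mul_le_mul_of_nonneg_left hcomb (show (0 : ℝ) ≤ 16 * N ^ 2 by positivity)
    refine le_trans (le_of_eq ?_) this
    field_simp
  refine h2.trans ?_
  have e1 : 16 * (N : ℝ) ^ 2 *
      (900000000 * S ^ 2 / N * (1 + Real.log N) * cellEnergy S (l + 1) F z)
      = 14400000000 * ((N : ℝ) * (S : ℝ) ^ 2 * (1 + Real.log N) * cellEnergy S (l + 1) F z) := by
    field_simp
    ring
  rw [e1]
  calc 14400000000 * ((N : ℝ) * (S : ℝ) ^ 2 * (1 + Real.log N) * cellEnergy S (l + 1) F z)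
      ≤ 20000000000 * ((N : ℝ) * (S : ℝ) ^ 2 * (((l : ℝ) + 2) * S)
          * cellEnergy S (l + 1) F z) := by
        gcongr
        norm_num
    _ = _ := by rw [hNe]; ring

/-! ### Powers of the base scale -/

/-- The real power `S ^ x`; sizes of all families are recorded by their exponents in base `S`. -/
noncomputable def scalePow (S : ℕ) (x : ℝ) : ℝ := (S : ℝ) ^ x

section scalePow

variable {S : ℕ}

lemma scalePow_pos (hS : 1 ≤ S) (x : ℝ) : 0 < scalePow S x :=
  Real.rpow_pos_of_pos (by exact_mod_cast hS) x

lemma scalePow_add (hS : 1 ≤ S) (x y : ℝ) : scalePow S (x + y) = scalePow S x * scalePow S y :=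
  Real.rpow_add (by exact_mod_cast hS) x y

lemma scalePow_sub (hS : 1 ≤ S) (x y : ℝ) : scalePow S (x - y) = scalePow S x / scalePow S y :=
  Real.rpow_sub (by exact_mod_cast hS) x y

lemma scalePow_mono (hS : 1 ≤ S) {x y : ℝ} (h : x ≤ y) : scalePow S x ≤ scalePow S y :=
  Real.rpow_le_rpow_of_exponent_le (by exact_mod_cast hS) h

lemma scalePow_natCast (n : ℕ) : scalePow S n = (S : ℝ) ^ n := Real.rpow_natCast _ _

lemma scalePow_one : scalePow S 1 = S := Real.rpow_one _

lemma scalePow_zero : scalePow S 0 = 1 := Real.rpow_zero _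

lemma scalePow_mul_le (hS : 1 ≤ S) {x y v : ℝ} (h : x + y ≤ v) :
    scalePow S x * scalePow S y ≤ scalePow S v := by
  rw [← scalePow_add hS]; exact scalePow_mono hS h

/-- A constant `C ≤ S` costs one unit in the exponent. -/
lemma mul_scalePow_le (hS : 1 ≤ S) {C x y : ℝ} (hC : C ≤ S) (h : x + 1 ≤ y) :
    C * scalePow S x ≤ scalePow S y := by
  refine le_trans ?_ (scalePow_mul_le hS (x := 1) (y := x) (by linarith))
  rw [scalePow_one]
  exact mul_le_mul_of_nonneg_right hC (scalePow_pos hS x).le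

lemma le_of_scalePow_le (hS : 2 ≤ S) {x y : ℝ} (h : scalePow S x ≤ scalePow S y) : x ≤ y :=
  (Real.rpow_le_rpow_left_iff (by exact_mod_cast hS)).1 h

end scalePow

/-! ### Counting -/

lemma card_le_card_mul_of_fiber {α β : Type*} [DecidableEq β] {A : Finset α} {B : Finset β}
    (f : α → β) (hf : ∀ a ∈ A, f a ∈ B) {C : ℝ}
    (hC : ∀ b ∈ B, ((A.filter fun a => f a = b).card : ℝ) ≤ C) : (A.card : ℝ) ≤ B.card * C := by
  rw [Finset.card_eq_sum_card_fiberwise hf]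
  push_cast
  calc _ ≤ ∑ _b ∈ B, C := Finset.sum_le_sum hC
    _ = _ := by rw [Finset.sum_const, nsmul_eq_mul]

lemma card_mul_le_card_of_fiber {α β : Type*} [DecidableEq β] {A : Finset α} {B : Finset β}
    (f : α → β) {C : ℝ}
    (hC : ∀ b ∈ B, C ≤ ((A.filter fun a => f a = b).card : ℝ)) : B.card * C ≤ (A.card : ℝ) := by
  classical
  calc (B.card : ℝ) * C = ∑ _b ∈ B, C := by rw [Finset.sum_const, nsmul_eq_mul]
    _ ≤ ∑ b ∈ B, ((A.filter fun a => f a = b).card : ℝ) := Finset.sum_le_sum hC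
    _ = (((A.filter fun a => f a ∈ B)).card : ℝ) := by
        rw [Finset.card_eq_sum_card_fiberwise (s := A.filter fun a => f a ∈ B) (f := f) (t := B)
          (fun a ha => (Finset.mem_filter.1 ha).2)]
        push_cast
        refine Finset.sum_congr rfl fun b hb => ?_
        congr 2
        ext a
        simp only [Finset.mem_filter]
        constructor
        · rintro ⟨h1, h2⟩; exact ⟨⟨h1, h2 ▸ hb⟩, h2⟩
        · rintro ⟨⟨h1, _⟩, h2⟩; exact ⟨h1, h2⟩
    _ ≤ _ := by exact_mod_cast Finset.card_le_card (Finset.filter_subset _ _)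

lemma exists_step_of_not {p : ℕ → Prop} {l r : ℕ} (hlr : l ≤ r) (hl : p l) (hr : ¬ p r) :
    ∃ i, l ≤ i ∧ i < r ∧ p i ∧ ¬ p (i + 1) := by
  by_contra hcon
  push Not at hcon
  have : ∀ i, l ≤ i → i ≤ r → p i := by
    intro i hi
    induction i, hi using Nat.le_induction with
    | base => exact fun _ => hl
    | succ n hn ih => exact fun hnr => hcon n hn (by omega) (ih (by omega))
  exact hr (this r hlr le_rfl)

lemma card_Icc_floor_le (u L : ℝ) (hL : 0 ≤ L) :
    ((Finset.Icc ⌊u - L⌋ ⌊u + L⌋).card : ℝ) ≤ 2 * L + 2 := by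
  rw [Int.card_Icc]
  have h1 := Int.lt_floor_add_one (u - L)
  have h2 := Int.floor_le (u + L)
  have h3 : ⌊u - L⌋ ≤ ⌊u + L⌋ := Int.floor_le_floor (by linarith)
  have h4 : (((⌊u + L⌋ + 1 - ⌊u - L⌋).toNat : ℤ) : ℝ) = ⌊u + L⌋ + 1 - ⌊u - L⌋ := by
    rw [Int.toNat_of_nonneg (by omega)]; push_cast; ring
  rw [← Int.cast_natCast (R := ℝ), h4]
  linarith

lemma mem_Icc_floor {u L v : ℝ} (h : |v - u| ≤ L) : ⌊v⌋ ∈ Finset.Icc ⌊u - L⌋ ⌊u + L⌋ := by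
  rw [abs_le] at h
  rw [Finset.mem_Icc]
  exact ⟨Int.floor_le_floor (by linarith), Int.floor_le_floor (by linarith)⟩

lemma ancestor_cell {S : ℕ} (hS : 1 ≤ S) (k m : ℕ) (z : ℝ × ℝ) :
    ancestor S k (cell S (m + k) z) = cell S m z := by
  have hSk : ((S : ℝ) ^ k) ≠ 0 := by positivity
  have key : ∀ u : ℝ, ⌊u * (S : ℝ) ^ (m + k)⌋ / (S : ℤ) ^ k = ⌊u * (S : ℝ) ^ m⌋ := by
    intro u
    have h := Int.floor_div_natCast (u * (S : ℝ) ^ (m + k)) (S ^ k)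
    push_cast at h
    rw [← h, pow_add]
    congr 1
    field_simp
  exact Prod.ext (key z.1) (key z.2)

lemma ancestor_cell_of_le {S : ℕ} (hS : 1 ≤ S) {m n : ℕ} (h : m ≤ n) (z : ℝ × ℝ) :
    ancestor S (n - m) (cell S n z) = cell S m z := by
  obtain ⟨k, rfl⟩ := Nat.exists_eq_add_of_le h
  rw [Nat.add_sub_cancel_left, ancestor_cell hS]

lemma cell_eq_of_le {S : ℕ} (hS : 1 ≤ S) {m n : ℕ} (h : m ≤ n) {z z' : ℝ × ℝ}
    (hz : cell S n z = cell S n z') : cell S m z = cell S m z' := by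
  rw [← ancestor_cell_of_le hS h, hz, ancestor_cell_of_le hS h]

/-! ### Uniform configurations -/

open Classical in
/-- A uniform configuration: points `pos p` and, through each of them, non-vertical lines with
slope and intercept `par T`, `T ∈ Tp p`. Up to a factor `S`, every square of side `S⁻ⁿ` in the
parameter plane that contains a line of `Tp p` contains `S ^ μ n` of them, and every square of
side `S⁻ⁿ` that contains a point contains `S ^ γ n` of them. The lines through a point form an
`s`-dimensional set; the points spread like a `(2 - s)`-dimensional set at the scales up to `D`,
and like an `s`-dimensional set at the later ones. The number of points is `S ^ κ`, and `w` is the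
slack in the exponents of the dimension conditions. The base `S` is so large that all constants,
including those that depend on the number `K` of scales, are absorbed by powers of `S`. -/
structure UniformConfiguration {ι τ : Type*} (S K D : ℕ) (s w κ : ℝ) (μ γ : ℕ → ℝ)
    (P : Finset ι) (Tp : ι → Finset τ) (pos : ι → ℝ × ℝ) (par : τ → ℝ × ℝ) : Prop where
  large : 10 ^ 12 * (K + 2) ^ 3 * 16 ^ K ≤ S
  s_le_one : s ≤ 1
  w_nonneg : 0 ≤ w
  D_le : D ≤ K
  card_eq : (P.card : ℝ) = scalePow S κ
  pos_mem : ∀ p ∈ P, (0 ≤ (pos p).1 ∧ (pos p).1 < 1) ∧ (0 ≤ (pos p).2 ∧ (pos p).2 < 1)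
  slope_le : ∀ p ∈ P, ∀ T ∈ Tp p, |(par T).1| ≤ 1
  incident : ∀ p ∈ P, ∀ T ∈ Tp p,
    |(pos p).2 - (par T).1 * (pos p).1 - (par T).2| * (S : ℝ) ^ K ≤ 4
  nonempty : ∀ p ∈ P, (Tp p).Nonempty
  tubes_lower : ∀ p ∈ P, ∀ T ∈ Tp p, ∀ n ≤ K, scalePow S (μ n) ≤
    (((Tp p).filter fun T' => cell S n (par T') = cell S n (par T)).card : ℝ)
  tubes_upper : ∀ p ∈ P, ∀ T ∈ Tp p, ∀ n ≤ K,
    (((Tp p).filter fun T' => cell S n (par T') = cell S n (par T)).card : ℝ)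
      ≤ scalePow S (μ n + 1)
  points_lower : ∀ p ∈ P, ∀ n ≤ K, scalePow S (γ n) ≤
    ((P.filter fun p' => cell S n (pos p') = cell S n (pos p)).card : ℝ)
  points_upper : ∀ p ∈ P, ∀ n ≤ K,
    ((P.filter fun p' => cell S n (pos p') = cell S n (pos p)).card : ℝ) ≤ scalePow S (γ n + 1)
  tubes_dim : ∀ n ≤ K, μ n + s * n ≤ μ 0 + w
  tubes_triv : ∀ n ≤ K, μ n ≤ (K : ℝ) - n + 2
  points_coarse : ∀ n ≤ D, γ n + n * (2 - s) ≤ κ + w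
  points_fine : ∀ n ≤ K, D ≤ n → γ n ≤ ((K : ℝ) - n) * s + w

namespace UniformConfiguration

variable {ι τ : Type*} {S K D : ℕ} {s w κ : ℝ} {μ γ : ℕ → ℝ}
    {P : Finset ι} {Tp : ι → Finset τ} {pos : ι → ℝ × ℝ} {par : τ → ℝ × ℝ}

section Basic

variable (h : UniformConfiguration S K D s w κ μ γ P Tp pos par)

include h

lemma one_le : 1 ≤ S := by
  have : 0 < 10 ^ 12 * (K + 2) ^ 3 * 16 ^ K := by positivity
  exact this.trans_le h.large

lemma const_le {C : ℕ} (hC : C ≤ 10 ^ 12) : (C : ℝ) ≤ S := by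
  have h1 : 10 ^ 12 * (1 * 1) ≤ 10 ^ 12 * ((K + 2) ^ 3 * 16 ^ K) := by
    gcongr <;> exact Nat.one_le_pow _ _ (by omega)
  have := h.large
  rw [mul_assoc] at this
  exact_mod_cast (by omega : C ≤ S)

lemma const_mul_le {C : ℕ} (hC : C ≤ 10 ^ 12) : (C : ℝ) * (K + 2) ^ 3 ≤ S := by
  have h1 : C * (K + 2) ^ 3 * 1 ≤ 10 ^ 12 * (K + 2) ^ 3 * 16 ^ K := by
    gcongr; exact Nat.one_le_pow _ _ (by omega)
  have := h1.trans h.large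
  rw [mul_one] at this
  exact_mod_cast this

lemma const_pow_le : (16 : ℝ) ^ K ≤ S := by
  have h1 : 1 * 16 ^ K ≤ 10 ^ 12 * (K + 2) ^ 3 * 16 ^ K := by
    gcongr; exact Nat.mul_pos (by norm_num) (by positivity)
  have := h1.trans h.large
  rw [one_mul] at this
  exact_mod_cast this

lemma realS_pos : (0 : ℝ) < S := by exact_mod_cast h.one_le

lemma one_le_realS : (1 : ℝ) ≤ S := by exact_mod_cast h.one_le

/-- A point is close to the discretisation at any scale of each of its lines. -/
lemma abs_sub_cell_le {p : ι} (hp : p ∈ P) {T : τ} (hT : T ∈ Tp p) {n : ℕ} (hn : n ≤ K) :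
    |(pos p).2 * (S : ℝ) ^ n - (cell S n (par T)).1 * (pos p).1 - (cell S n (par T)).2| ≤ 6 := by
  have hx := (h.pos_mem p hp).1
  have hi := h.incident p hp T hT
  have hle : (S : ℝ) ^ n ≤ (S : ℝ) ^ K := pow_le_pow_right₀ h.one_le_realS hn
  have hpos : (0 : ℝ) < (S : ℝ) ^ n := pow_pos h.realS_pos n
  have h4 : |((pos p).2 - (par T).1 * (pos p).1 - (par T).2) * (S : ℝ) ^ n| ≤ 4 := by
    rw [abs_mul, abs_of_pos hpos]
    exact (mul_le_mul_of_nonneg_left hle (abs_nonneg _)).trans hi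
  simp only [cell]
  have a1 := Int.floor_le ((par T).1 * (S : ℝ) ^ n)
  have a2 := Int.lt_floor_add_one ((par T).1 * (S : ℝ) ^ n)
  have b1 := Int.floor_le ((par T).2 * (S : ℝ) ^ n)
  have b2 := Int.lt_floor_add_one ((par T).2 * (S : ℝ) ^ n)
  rw [abs_le] at h4 ⊢
  constructor <;> nlinarith

lemma near_cell {p : ι} (hp : p ∈ P) {T : τ} (hT : T ∈ Tp p) {n : ℕ} (hn : n ≤ K) :
    Near S n (pos p) (cell S n (par T)) :=
  (h.abs_sub_cell_le hp hT hn).trans (by norm_num)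

lemma abs_cell_fst_le {p : ι} (hp : p ∈ P) {T : τ} (hT : T ∈ Tp p) (n : ℕ) :
    |(cell S n (par T)).1| ≤ (S : ℤ) ^ n := by
  have hs := abs_le.1 (h.slope_le p hp T hT)
  have hpos : (0 : ℝ) < (S : ℝ) ^ n := pow_pos h.realS_pos n
  simp only [cell]
  rw [abs_le]
  constructor
  · rw [Int.le_floor]; push_cast; nlinarith
  · have : (⌊(par T).1 * (S : ℝ) ^ n⌋ : ℝ) ≤ (S : ℝ) ^ n :=
      (Int.floor_le _).trans (by nlinarith)
    exact_mod_cast this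

lemma exists_mem (h0 : P.Nonempty) : ∃ p ∈ P, ∃ T, T ∈ Tp p := by
  obtain ⟨p, hp⟩ := h0
  obtain ⟨T, hT⟩ := h.nonempty p hp
  exact ⟨p, hp, T, hT⟩

lemma two_le : 2 ≤ S := by
  have := h.const_le (C := 2) (by norm_num)
  exact_mod_cast this

lemma points_nonempty : P.Nonempty := by
  rw [← Finset.card_pos]
  have := h.card_eq ▸ scalePow_pos h.one_le κ
  exact_mod_cast this

open Classical in
lemma card_tubes_cell_le {p : ι} (hp : p ∈ P) {n : ℕ} (hn : n ≤ K) (g : ℤ × ℤ) :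
    (((Tp p).filter fun T => cell S n (par T) = g).card : ℝ) ≤ scalePow S (μ n + 1) := by
  rcases ((Tp p).filter fun T => cell S n (par T) = g).eq_empty_or_nonempty with h0 | ⟨T, hT⟩
  · rw [h0, Finset.card_empty, Nat.cast_zero]; exact (scalePow_pos h.one_le _).le
  · rw [Finset.mem_filter] at hT
    rw [← hT.2]
    exact h.tubes_upper p hp T hT.1 n hn

open Classical in
lemma card_points_cell_le {n : ℕ} (hn : n ≤ K) (g : ℤ × ℤ) :
    ((P.filter fun p => cell S n (pos p) = g).card : ℝ) ≤ scalePow S (γ n + 1) := by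
  rcases (P.filter fun p => cell S n (pos p) = g).eq_empty_or_nonempty with h0 | ⟨p, hp⟩
  · rw [h0, Finset.card_empty, Nat.cast_zero]; exact (scalePow_pos h.one_le _).le
  · rw [Finset.mem_filter] at hp
    rw [← hp.2]
    exact h.points_upper p hp.1 n hn

open Classical in
/-- The number of lines through a point with slope in a given window. -/
lemma card_slope_window_le {p : ι} (hp : p ∈ P) {k : ℕ} (hk : k ≤ K) (α : ℝ) :
    (((Tp p).filter fun T => |(par T).1 - α| * (S : ℝ) ^ k ≤ 21 * S).card : ℝ)
      ≤ scalePow S (μ k + 4) := by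
  set Sk : ℝ := (S : ℝ) ^ k with hSk
  have hpos : 0 < Sk := pow_pos h.realS_pos k
  have hS1 := h.one_le_realS
  have hx := (h.pos_mem p hp).1
  set A := Finset.Icc ⌊α * Sk - 21 * S⌋ ⌊α * Sk + 21 * S⌋ with hA
  set B := Finset.Icc ⌊((pos p).2 - α * (pos p).1) * Sk - 25 * S⌋
    ⌊((pos p).2 - α * (pos p).1) * Sk + 25 * S⌋ with hB
  have h1 := card_le_card_mul_of_fiber
    (A := (Tp p).filter fun T => |(par T).1 - α| * Sk ≤ 21 * S) (B := A ×ˢ B)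
    (fun T => cell S k (par T)) (C := scalePow S (μ k + 1)) ?_ ?_
  · refine h1.trans ?_
    rw [Finset.card_product]
    push_cast
    have hA1 : (A.card : ℝ) ≤ 44 * S := by
      refine (card_Icc_floor_le _ _ (by positivity)).trans ?_
      linarith
    have hB1 : (B.card : ℝ) ≤ 52 * S := by
      refine (card_Icc_floor_le _ _ (by positivity)).trans ?_
      linarith
    have h2 : (A.card : ℝ) * B.card ≤ (44 * S) * (52 * S) := by gcongr
    have h3 : ((44 : ℝ) * S) * (52 * S) ≤ scalePow S 3 := by
      have : (2288 : ℝ) ≤ S := by exact_mod_cast h.const_le (C := 2288) (by norm_num)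
      have e : scalePow S 3 = (S : ℝ) ^ 3 := by
        have := scalePow_natCast (S := S) 3; exact_mod_cast this
      rw [e]
      nlinarith [mul_pos h.realS_pos h.realS_pos]
    calc _ ≤ scalePow S 3 * scalePow S (μ k + 1) := by
          refine mul_le_mul_of_nonneg_right (h2.trans h3) (scalePow_pos h.one_le _).le
      _ ≤ _ := scalePow_mul_le h.one_le (by linarith)
  · intro T hT
    rw [Finset.mem_filter] at hT
    have e1 : |(par T).1 * Sk - α * Sk| ≤ 21 * S := by
      rw [← sub_mul, abs_mul, abs_of_pos hpos]; exact hT.2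
    rw [Finset.mem_product]
    refine ⟨mem_Icc_floor e1, mem_Icc_floor ?_⟩
    have hi := h.incident p hp T hT.1
    have hle : Sk ≤ (S : ℝ) ^ K := pow_le_pow_right₀ h.one_le_realS hk
    have h4 : |((pos p).2 - (par T).1 * (pos p).1 - (par T).2) * Sk| ≤ 4 := by
      rw [abs_mul, abs_of_pos hpos]
      exact (mul_le_mul_of_nonneg_left hle (abs_nonneg _)).trans hi
    have e2 : |((par T).1 * Sk - α * Sk) * (pos p).1| ≤ 21 * S := by
      rw [abs_mul, abs_of_nonneg hx.1]
      exact (mul_le_mul e1 hx.2.le hx.1 (by positivity)).trans (by linarith)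
    rw [abs_le] at h4 e2 ⊢
    constructor <;> nlinarith
  · intro g _
    refine le_trans ?_ (h.card_tubes_cell_le hp hk g)
    exact_mod_cast Finset.card_le_card
      (Finset.filter_subset_filter _ (Finset.filter_subset _ _))

open Classical in
/-- The number of squares of side `S⁻ᵗ` of the parameter plane that meet the lines through a
point and have slope in a window of length about `S¹⁻ᵏ`. -/
lemma card_cells_window_le {p : ι} (hp : p ∈ P) {k t : ℕ} (hkt : k ≤ t) (ht : t ≤ K) (α : ℝ) :
    (((((Tp p).image fun T => cell S t (par T))).filter
      fun g => |(g.1 : ℝ) / (S : ℝ) ^ t - α| * (S : ℝ) ^ k ≤ 20 * S).card : ℝ)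
      ≤ scalePow S (μ k + 4 - μ t) := by
  have hpk : (0 : ℝ) < (S : ℝ) ^ k := pow_pos h.realS_pos k
  have hpt : (0 : ℝ) < (S : ℝ) ^ t := pow_pos h.realS_pos t
  have hle : (S : ℝ) ^ k ≤ (S : ℝ) ^ t := pow_le_pow_right₀ h.one_le_realS hkt
  rw [scalePow_sub h.one_le, le_div_iff₀ (scalePow_pos h.one_le _)]
  refine le_trans ?_ (h.card_slope_window_le hp (hkt.trans ht) α)
  apply card_mul_le_card_of_fiber fun T => cell S t (par T)
  intro g hg
  rw [Finset.mem_filter, Finset.mem_image] at hg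
  obtain ⟨⟨T, hT, rfl⟩, hg2⟩ := hg
  refine (h.tubes_lower p hp T hT t ht).trans ?_
  refine Nat.cast_le.2 (Finset.card_le_card ?_)
  intro T' hT'
  rw [Finset.mem_filter] at hT'
  rw [Finset.mem_filter, Finset.mem_filter]
  refine ⟨⟨hT'.1, ?_⟩, hT'.2⟩
  rw [← hT'.2] at hg2
  simp only [cell] at hg2
  have a1 := Int.floor_le ((par T').1 * (S : ℝ) ^ t)
  have a2 := Int.lt_floor_add_one ((par T').1 * (S : ℝ) ^ t)
  set m : ℝ := (⌊(par T').1 * (S : ℝ) ^ t⌋ : ℝ) with hm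
  have h1 : |(par T').1 - m / (S : ℝ) ^ t| * (S : ℝ) ^ k ≤ 1 := by
    have : |(par T').1 - m / (S : ℝ) ^ t| * (S : ℝ) ^ t ≤ 1 := by
      have e : |(par T').1 - m / (S : ℝ) ^ t| * (S : ℝ) ^ t
          = |(par T').1 * (S : ℝ) ^ t - m| := by
        conv_lhs => rw [← abs_of_pos hpt]
        rw [← abs_mul, sub_mul, abs_of_pos hpt, div_mul_cancel₀ _ hpt.ne']
      rw [e, abs_le]
      constructor <;> linarith
    exact (mul_le_mul_of_nonneg_left hle (abs_nonneg _)).trans this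
  have h2 := abs_sub_le (par T').1 (m / (S : ℝ) ^ t) α
  have h3 := h.one_le_realS
  nlinarith

open Classical in
lemma card_box_le (p : ι) {i : ℕ} (hi : i ≤ K) :
    ((P.filter fun p' => |(pos p).1 - (pos p').1| * (S : ℝ) ^ i ≤ 1 ∧
      |(pos p).2 - (pos p').2| * (S : ℝ) ^ i ≤ 21).card : ℝ) ≤ 176 * scalePow S (γ i + 1) := by
  set Si : ℝ := (S : ℝ) ^ i with hSi
  have hpos : 0 < Si := pow_pos h.realS_pos i
  set A := Finset.Icc ⌊(pos p).1 * Si - 1⌋ ⌊(pos p).1 * Si + 1⌋ with hA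
  set B := Finset.Icc ⌊(pos p).2 * Si - 21⌋ ⌊(pos p).2 * Si + 21⌋ with hB
  have h1 := card_le_card_mul_of_fiber
    (A := P.filter fun p' => |(pos p).1 - (pos p').1| * Si ≤ 1 ∧
      |(pos p).2 - (pos p').2| * Si ≤ 21) (B := A ×ˢ B)
    (fun p' => cell S i (pos p')) (C := scalePow S (γ i + 1)) ?_ ?_
  · refine h1.trans (mul_le_mul_of_nonneg_right ?_ (scalePow_pos h.one_le _).le)
    rw [Finset.card_product]
    push_cast
    have hA1 : (A.card : ℝ) ≤ 4 :=
      (card_Icc_floor_le _ _ (by norm_num)).trans (by norm_num)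
    have hB1 : (B.card : ℝ) ≤ 44 :=
      (card_Icc_floor_le _ _ (by norm_num)).trans (by norm_num)
    calc (A.card : ℝ) * B.card ≤ 4 * 44 := by gcongr
      _ = 176 := by norm_num
  · intro p' hp'
    rw [Finset.mem_filter] at hp'
    rw [Finset.mem_product]
    refine ⟨mem_Icc_floor ?_, mem_Icc_floor ?_⟩
    · rw [← sub_mul, abs_mul, abs_of_pos hpos, abs_sub_comm]; exact hp'.2.1
    · rw [← sub_mul, abs_mul, abs_of_pos hpos, abs_sub_comm]; exact hp'.2.2
  · intro g _
    refine le_trans ?_ (h.card_points_cell_le hi g)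
    exact_mod_cast Finset.card_le_card
      (Finset.filter_subset_filter _ (Finset.filter_subset _ _))

open Classical in
/-- The main counting estimate for pairs: the number of pairs of a point `p'` at horizontal
distance at most `S⁻ˡ` from `p`, and a direction at scale `S⁻ᵗ` of a line through `p`, such that
`p'` is within `20 S⁻ʳ` of the line through `p` in that direction. Points are grouped according
to the horizontal distance `S⁻ⁱ`: there are about `S ^ γ i` of them, each of which fixes the
direction up to `S⁻⁽ʳ⁻ⁱ⁾`, and the hypothesis says that the product of the two numbers is small. -/
lemma card_pairs_le {p : ι} (hp : p ∈ P) {l r t : ℕ} (hlr : l ≤ r) (hr : r ≤ K)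
    (hrt : r ≤ t + l) (htr : t ≤ r) {e : ℝ}
    (hOK : ∀ i, l ≤ i → i ≤ r → γ i + μ (r - i) ≤ (K : ℝ) - r + e + μ 0) :
    (((P ×ˢ ((Tp p).image fun T => cell S t (par T))).filter fun q =>
      |(pos p).1 - (pos q.1).1| * (S : ℝ) ^ l ≤ 1 ∧
      |(pos p).2 - (pos q.1).2 - (q.2.1 : ℝ) / (S : ℝ) ^ t * ((pos p).1 - (pos q.1).1)|
        * (S : ℝ) ^ r ≤ 20).card : ℝ)
      ≤ scalePow S ((K : ℝ) - r + e + μ 0 - μ t + 6) := by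
  set Z := (P ×ˢ ((Tp p).image fun T => cell S t (par T))).filter fun q =>
      |(pos p).1 - (pos q.1).1| * (S : ℝ) ^ l ≤ 1 ∧
      |(pos p).2 - (pos q.1).2 - (q.2.1 : ℝ) / (S : ℝ) ^ t * ((pos p).1 - (pos q.1).1)|
        * (S : ℝ) ^ r ≤ 20 with hZ
  set Zi : ℕ → Finset (ι × (ℤ × ℤ)) := fun i => Z.filter fun q =>
    |(pos p).1 - (pos q.1).1| * (S : ℝ) ^ i ≤ 1 ∧
    (i < r → 1 < |(pos p).1 - (pos q.1).1| * (S : ℝ) ^ (i + 1)) with hZi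
  have hcover : Z ⊆ (Finset.Icc l r).biUnion Zi := by
    intro q hq
    have hq2 := (Finset.mem_filter.1 hq).2
    rw [Finset.mem_biUnion]
    by_cases hqr : |(pos p).1 - (pos q.1).1| * (S : ℝ) ^ r ≤ 1
    · refine ⟨r, Finset.mem_Icc.2 ⟨hlr, le_rfl⟩, Finset.mem_filter.2 ⟨hq, hqr, ?_⟩⟩
      exact fun hlt => absurd hlt (lt_irrefl _)
    · obtain ⟨i, h1, h2, h3, h4⟩ := exists_step_of_not
        (p := fun i => |(pos p).1 - (pos q.1).1| * (S : ℝ) ^ i ≤ 1) hlr hq2.1 hqr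
      exact ⟨i, Finset.mem_Icc.2 ⟨h1, h2.le⟩, Finset.mem_filter.2 ⟨hq, h3, fun _ => not_le.1 h4⟩⟩
  have hbound : ∀ i ∈ Finset.Icc l r,
      ((Zi i).card : ℝ) ≤ 176 * scalePow S ((K : ℝ) - r + e + μ 0 - μ t + 5) := by
    intro i hi
    rw [Finset.mem_Icc] at hi
    have hpi : (0 : ℝ) < (S : ℝ) ^ i := pow_pos h.realS_pos i
    have hpr : (0 : ℝ) < (S : ℝ) ^ r := pow_pos h.realS_pos r
    have hpt : (0 : ℝ) < (S : ℝ) ^ t := pow_pos h.realS_pos t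
    have hir : (S : ℝ) ^ i ≤ (S : ℝ) ^ r := pow_le_pow_right₀ h.one_le_realS hi.2
    have hslope : ∀ q ∈ Z, |(q.2.1 : ℝ) / (S : ℝ) ^ t| ≤ 1 := by
      intro q hq
      have hq1 := (Finset.mem_product.1 (Finset.mem_filter.1 hq).1).2
      obtain ⟨T, hT, hTe⟩ := Finset.mem_image.1 hq1
      have := h.abs_cell_fst_le hp hT t
      rw [hTe] at this
      rw [abs_div, abs_of_pos hpt, div_le_one hpt]
      exact_mod_cast this
    have hcard := card_le_card_mul_of_fiber (A := Zi i)
      (B := P.filter fun p' => |(pos p).1 - (pos p').1| * (S : ℝ) ^ i ≤ 1 ∧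
        |(pos p).2 - (pos p').2| * (S : ℝ) ^ i ≤ 21)
      (fun q => q.1) (C := scalePow S (μ (r - i) + 4 - μ t)) ?_ ?_
    · refine hcard.trans ?_
      have := hOK i hi.1 hi.2
      calc _ ≤ 176 * scalePow S (γ i + 1) * scalePow S (μ (r - i) + 4 - μ t) :=
            mul_le_mul_of_nonneg_right (h.card_box_le p (hi.2.trans hr))
              (scalePow_pos h.one_le _).le
        _ = 176 * (scalePow S (γ i + 1) * scalePow S (μ (r - i) + 4 - μ t)) := by ring
        _ ≤ _ := by
            gcongr
            exact scalePow_mul_le h.one_le (by linarith)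
    · intro q hq
      have hq' := Finset.mem_filter.1 hq
      have hqZ := Finset.mem_filter.1 hq'.1
      rw [Finset.mem_filter]
      refine ⟨(Finset.mem_product.1 hqZ.1).1, hq'.2.1, ?_⟩
      set dx := (pos p).1 - (pos q.1).1 with hdx
      set dy := (pos p).2 - (pos q.1).2 with hdy
      set α := (q.2.1 : ℝ) / (S : ℝ) ^ t with hα
      have hs := hslope q hq'.1
      have h1 : |dy - α * dx| * (S : ℝ) ^ i ≤ 20 :=
        (mul_le_mul_of_nonneg_left hir (abs_nonneg _)).trans hqZ.2.2
      have h2 : |dy| ≤ |dy - α * dx| + |α * dx| := by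
        have := abs_add_le (dy - α * dx) (α * dx)
        rwa [sub_add_cancel] at this
      have h3 : |α * dx| ≤ |dx| := by
        rw [abs_mul]; exact mul_le_of_le_one_left (abs_nonneg _) hs
      have h4 : |dx| * (S : ℝ) ^ i ≤ 1 := hq'.2.1
      nlinarith
    · intro p' hp'
      have hp'P := (Finset.mem_filter.1 hp').1
      set dx := (pos p).1 - (pos p').1 with hdx
      set dy := (pos p).2 - (pos p').2 with hdy
      refine le_trans ?_ (h.card_cells_window_le hp (k := r - i) (t := t) (by omega)
        (htr.trans hr) (if i < r then dy / dx else 0))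
      refine Nat.cast_le.2 (Finset.card_le_card_of_injOn (fun q => q.2) ?_ ?_)
      · intro q hq
        have hqf := Finset.mem_filter.1 hq
        have hq' := Finset.mem_filter.1 hqf.1
        have hqZ := Finset.mem_filter.1 hq'.1
        have hqe : q.1 = p' := hqf.2
        have hc := hqZ.2.2
        have hd := hq'.2.2
        rw [hqe] at hc hd
        rw [Finset.mem_coe, Finset.mem_filter]
        refine ⟨(Finset.mem_product.1 hqZ.1).2, ?_⟩
        have hs := hslope q hq'.1
        set α := (q.2.1 : ℝ) / (S : ℝ) ^ t with hα
        have hS1 := h.one_le_realS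
        split_ifs with hlt
        · have hd' := hd hlt
          have hdx0 : 0 < |dx| := by
            by_contra hcon
            have : |dx| = 0 := le_antisymm (not_lt.1 hcon) (abs_nonneg _)
            rw [← hdx, this, zero_mul] at hd'
            linarith
          have hdxne : dx ≠ 0 := abs_pos.1 hdx0
          have e1 : |α - dy / dx| * |dx| = |dy - α * dx| := by
            rw [← abs_mul, sub_mul, div_mul_cancel₀ _ hdxne, abs_sub_comm]
          have e2 : (S : ℝ) ^ r = (S : ℝ) ^ (r - i) * (S : ℝ) ^ i := by
            rw [← pow_add]; congr 1; omega
          have h5 : |α - dy / dx| * (S : ℝ) ^ (r - i) * (|dx| * (S : ℝ) ^ i) ≤ 20 := by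
            calc _ = |α - dy / dx| * |dx| * ((S : ℝ) ^ (r - i) * (S : ℝ) ^ i) := by ring
              _ ≤ 20 := by rw [e1, ← e2]; exact hc
          have h6 : (1 : ℝ) ≤ S * (|dx| * (S : ℝ) ^ i) := by
            rw [pow_succ] at hd'
            nlinarith
          have h7 : 0 ≤ |α - dy / dx| * (S : ℝ) ^ (r - i) := by positivity
          calc |α - dy / dx| * (S : ℝ) ^ (r - i)
              ≤ |α - dy / dx| * (S : ℝ) ^ (r - i) * (S * (|dx| * (S : ℝ) ^ i)) :=
                le_mul_of_one_le_right h7 h6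
            _ = S * (|α - dy / dx| * (S : ℝ) ^ (r - i) * (|dx| * (S : ℝ) ^ i)) := by ring
            _ ≤ S * 20 := by gcongr
            _ = 20 * S := by ring
        · have : r - i = 0 := by omega
          rw [this, pow_zero, mul_one, sub_zero]
          linarith
      · intro q hq q' hq' heq
        have e1 : q.1 = p' := (Finset.mem_filter.1 hq).2
        have e2 : q'.1 = p' := (Finset.mem_filter.1 hq').2
        exact Prod.ext (e1.trans e2.symm) heq
  have hcard : (Z.card : ℝ) ≤ ∑ i ∈ Finset.Icc l r, ((Zi i).card : ℝ) := by
    exact_mod_cast (Finset.card_le_card hcover).trans Finset.card_biUnion_le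
  refine hcard.trans ((Finset.sum_le_sum hbound).trans ?_)
  rw [Finset.sum_const, nsmul_eq_mul, ← mul_assoc]
  refine mul_scalePow_le h.one_le ?_ (by linarith)
  have hc : ((Finset.Icc l r).card : ℝ) ≤ K + 2 := by
    rw [Nat.card_Icc]
    have : r + 1 - l ≤ K + 2 := by omega
    exact_mod_cast this
  have hk := h.const_mul_le (C := 176) (by norm_num)
  have h1 : (1 : ℝ) ≤ (K : ℝ) + 2 := by linarith [Nat.cast_nonneg (α := ℝ) K]
  calc ((Finset.Icc l r).card : ℝ) * 176 ≤ (K + 2) * 176 := by gcongr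
    _ ≤ 176 * ((K : ℝ) + 2) ^ 3 := by
        have : (K : ℝ) + 2 ≤ ((K : ℝ) + 2) ^ 3 := le_self_pow₀ h1 (by norm_num)
        linarith
    _ ≤ S := by exact_mod_cast hk

end Basic

end UniformConfiguration

/-! ### Second moments of the numbers of points along lines -/

open Classical in
/-- The points one of whose lines has its parameters in the square `g` of side `S⁻ᵗ`. -/
noncomputable def localPoints {ι τ : Type*} (S t : ℕ) (P : Finset ι) (Tp : ι → Finset τ)
    (par : τ → ℝ × ℝ) (g : ℤ × ℤ) : Finset ι :=
  P.filter fun p => ∃ T ∈ Tp p, cell S t (par T) = g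

open Classical in
/-- The number of points whose family of lines contains `T`. -/
noncomputable def multiplicity {ι τ : Type*} (P : Finset ι) (Tp : ι → Finset τ) (T : τ) : ℕ :=
  (P.filter fun p => T ∈ Tp p).card

/-- The number of points near the line `g` of scale `S⁻ʳ` that have a line in the same square of
side `S⁻ᵗ` as `g`. -/
noncomputable def localCount {ι τ : Type*} (S t r : ℕ) (P : Finset ι) (Tp : ι → Finset τ)
    (pos : ι → ℝ × ℝ) (par : τ → ℝ × ℝ) (g : ℤ × ℤ) : ℕ :=
  lineCount S r (localPoints S t P Tp par (ancestor S (r - t) g)) pos g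

namespace UniformConfiguration

variable {ι τ : Type*} {S K D : ℕ} {s w κ : ℝ} {μ γ : ℕ → ℝ}
    {P : Finset ι} {Tp : ι → Finset τ} {pos : ι → ℝ × ℝ} {par : τ → ℝ × ℝ}

section Exponents

variable (h : UniformConfiguration S K D s w κ μ γ P Tp pos par)

include h

lemma mu_le_of_le {m n : ℕ} (hmn : m ≤ n) (hn : n ≤ K) : μ n ≤ μ m + 1 := by
  obtain ⟨p, hp, T, hT⟩ := h.exists_mem h.points_nonempty
  refine le_of_scalePow_le h.two_le ((h.tubes_lower p hp T hT n hn).trans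
    (le_trans ?_ (h.tubes_upper p hp T hT m (hmn.trans hn))))
  refine Nat.cast_le.2 (Finset.card_le_card ?_)
  exact Finset.monotone_filter_right _ fun T' _ hT' => cell_eq_of_le h.one_le hmn hT'

/-- The lines through a point form a one-parameter family, so that at most about
`S ^ (n - m)` of the descendants of side `S⁻ⁿ` of a square of side `S⁻ᵐ` contain one of them. -/
lemma mu_le_add_sub {m n : ℕ} (hmn : m ≤ n) (hn : n ≤ K) : μ m ≤ μ n + ((n : ℝ) - m) + 4 := by
  classical
  obtain ⟨p, hp, T, hT⟩ := h.exists_mem h.points_nonempty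
  refine le_of_scalePow_le h.two_le ((h.tubes_lower p hp T hT m (hmn.trans hn)).trans ?_)
  obtain ⟨k, rfl⟩ := Nat.exists_eq_add_of_le hmn
  set g := cell S m (par T) with hg
  have hSk : (0 : ℤ) < (S : ℤ) ^ k := by exact_mod_cast pow_pos h.one_le k
  have h1 := card_le_card_mul_of_fiber
    (A := (Tp p).filter fun T' => cell S m (par T') = g)
    (B := Finset.Ico (g.1 * (S : ℤ) ^ k) (g.1 * (S : ℤ) ^ k + (S : ℤ) ^ k))
    (fun T' => (cell S (m + k) (par T')).1) (C := scalePow S (μ (m + k) + 4)) ?_ ?_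
  · refine h1.trans ?_
    have e : ((Finset.Ico (g.1 * (S : ℤ) ^ k) (g.1 * (S : ℤ) ^ k + (S : ℤ) ^ k)).card : ℝ)
        = scalePow S k := by
      rw [Int.card_Ico, add_sub_cancel_left, scalePow_natCast]
      have : ((S : ℤ) ^ k).toNat = S ^ k := by
        rw [← Nat.cast_pow, Int.toNat_natCast]
      rw [this]; push_cast; rfl
    rw [e]
    refine scalePow_mul_le h.one_le ?_
    push_cast
    linarith
  · intro T' hT'
    have := (Finset.mem_filter.1 hT').2
    rw [← ancestor_cell h.one_le k m] at this
    have h2 : (cell S (m + k) (par T')).1 / (S : ℤ) ^ k = g.1 := congrArg Prod.fst this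
    rw [Finset.mem_Ico]
    have q1 := Int.ediv_mul_le (cell S (m + k) (par T')).1 hSk.ne'
    have q2 := Int.lt_ediv_add_one_mul_self (cell S (m + k) (par T')).1 hSk
    rw [h2] at q1 q2
    constructor <;> linarith
  · intro b _
    have hpk : (0 : ℝ) < (S : ℝ) ^ (m + k) := pow_pos h.realS_pos _
    refine le_trans ?_ (h.card_slope_window_le hp hn ((b : ℝ) / (S : ℝ) ^ (m + k)))
    refine Nat.cast_le.2 (Finset.card_le_card ?_)
    intro T' hT'
    rw [Finset.mem_filter, Finset.mem_filter] at hT'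
    rw [Finset.mem_filter]
    refine ⟨hT'.1.1, ?_⟩
    have hb : ⌊(par T').1 * (S : ℝ) ^ (m + k)⌋ = b := hT'.2
    have a1 := Int.floor_le ((par T').1 * (S : ℝ) ^ (m + k))
    have a2 := Int.lt_floor_add_one ((par T').1 * (S : ℝ) ^ (m + k))
    rw [hb] at a1 a2
    have e : |(par T').1 - b / (S : ℝ) ^ (m + k)| * (S : ℝ) ^ (m + k)
        = |(par T').1 * (S : ℝ) ^ (m + k) - b| := by
      conv_lhs => rw [← abs_of_pos hpk]
      rw [← abs_mul, sub_mul, abs_of_pos hpk, div_mul_cancel₀ _ hpk.ne']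
    rw [e]
    have := h.one_le_realS
    rw [abs_le]
    constructor <;> linarith

lemma gamma_le_succ {n : ℕ} (hn : n + 1 ≤ K) : γ n ≤ γ (n + 1) + 3 := by
  classical
  obtain ⟨p, hp⟩ := h.points_nonempty
  refine le_of_scalePow_le h.two_le ((h.points_lower p hp n (by omega)).trans ?_)
  set g := cell S n (pos p) with hg
  have hSk : (0 : ℤ) < (S : ℤ) := by exact_mod_cast h.one_le
  have h1 := card_le_card_mul_of_fiber
    (A := P.filter fun p' => cell S n (pos p') = g)
    (B := Finset.Ico (g.1 * (S : ℤ)) (g.1 * S + S) ×ˢ Finset.Ico (g.2 * (S : ℤ)) (g.2 * S + S))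
    (fun p' => cell S (n + 1) (pos p')) (C := scalePow S (γ (n + 1) + 1)) ?_ ?_
  · refine h1.trans ?_
    rw [Finset.card_product, Int.card_Ico, Int.card_Ico, add_sub_cancel_left, add_sub_cancel_left]
    simp only [Int.toNat_natCast]
    push_cast
    rw [← scalePow_one, ← scalePow_add h.one_le]
    exact scalePow_mul_le h.one_le (by linarith)
  · intro p' hp'
    have := (Finset.mem_filter.1 hp').2
    rw [← ancestor_cell h.one_le 1 n] at this
    have h2 : (cell S (n + 1) (pos p')).1 / (S : ℤ) ^ 1 = g.1 := congrArg Prod.fst this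
    have h3 : (cell S (n + 1) (pos p')).2 / (S : ℤ) ^ 1 = g.2 := congrArg Prod.snd this
    rw [pow_one] at h2 h3
    rw [Finset.mem_product, Finset.mem_Ico, Finset.mem_Ico]
    have q1 := Int.ediv_mul_le (cell S (n + 1) (pos p')).1 hSk.ne'
    have q2 := Int.lt_ediv_add_one_mul_self (cell S (n + 1) (pos p')).1 hSk
    have q3 := Int.ediv_mul_le (cell S (n + 1) (pos p')).2 hSk.ne'
    have q4 := Int.lt_ediv_add_one_mul_self (cell S (n + 1) (pos p')).2 hSk
    rw [h2] at q1 q2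
    rw [h3] at q3 q4
    refine ⟨⟨?_, ?_⟩, ?_, ?_⟩ <;> linarith
  · intro b _
    refine le_trans ?_ (h.card_points_cell_le hn b)
    exact_mod_cast Finset.card_le_card
      (Finset.filter_subset_filter _ (Finset.filter_subset _ _))

lemma le_card_tubes {p : ι} (hp : p ∈ P) : scalePow S (μ 0) ≤ ((Tp p).card : ℝ) := by
  classical
  obtain ⟨T, hT⟩ := h.nonempty p hp
  exact (h.tubes_lower p hp T hT 0 (Nat.zero_le _)).trans
    (Nat.cast_le.2 (Finset.card_le_card (Finset.filter_subset _ _)))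

lemma card_cells_le {p : ι} (hp : p ∈ P) {t : ℕ} (ht : t ≤ K) :
    ((((Tp p).image fun T => cell S t (par T))).card : ℝ) ≤ scalePow S (μ 0 + 4 - μ t) := by
  classical
  refine le_trans ?_ (h.card_cells_window_le hp (Nat.zero_le t) ht 0)
  refine Nat.cast_le.2 (Finset.card_le_card fun g hg => ?_)
  rw [Finset.mem_filter]
  refine ⟨hg, ?_⟩
  obtain ⟨T, hT, hTe⟩ := Finset.mem_image.1 hg
  have hpt : (0 : ℝ) < (S : ℝ) ^ t := pow_pos h.realS_pos t
  have := h.abs_cell_fst_le hp hT t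
  rw [hTe] at this
  have h2 : |(g.1 : ℝ) / (S : ℝ) ^ t| ≤ 1 := by
    rw [abs_div, abs_of_pos hpt, div_le_one hpt]
    exact_mod_cast this
  rw [pow_zero, mul_one, sub_zero]
  linarith [h.one_le_realS]

/-- At the scales where the points are `s`-dimensional, lines and points are in balance. -/
lemma gamma_add_mu_le {i r : ℕ} (hD : D ≤ i) (hir : i ≤ r) (hr : r ≤ K) :
    γ i + μ (r - i) ≤ (K : ℝ) - r + 2 * w + μ 0 := by
  have h1 := h.points_fine i (hir.trans hr) hD
  have h2 := h.tubes_dim (r - i) (by omega)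
  rw [Nat.cast_sub hir] at h2
  have h3 : (r : ℝ) ≤ K := by exact_mod_cast hr
  nlinarith [h.s_le_one]

end Exponents

section Energy

variable (h : UniformConfiguration S K D s w κ μ γ P Tp pos par)

include h

open Classical in
/-- A family of relations between pairs of points, indexed by directions of lines at scale `S⁻ᵗ`,
in the situation of `card_pairs_le`. -/
lemma sum_card_pairs_le {l r t : ℕ} (hlr : l ≤ r) (hr : r ≤ K)
    (hrt : r ≤ t + l) (htr : t ≤ r) {e : ℝ}
    (hOK : ∀ i, l ≤ i → i ≤ r → γ i + μ (r - i) ≤ (K : ℝ) - r + e + μ 0)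
    (𝒢 : Finset (ℤ × ℤ)) (R : ℤ × ℤ → ι → ι → Prop)
    (hR : ∀ g, ∀ p ∈ P, ∀ p' ∈ P, R g p p' → (∃ T ∈ Tp p, cell S t (par T) = g) ∧
      |(pos p).1 - (pos p').1| * (S : ℝ) ^ l ≤ 1 ∧
      |(pos p).2 - (pos p').2 - (g.1 : ℝ) / (S : ℝ) ^ t * ((pos p).1 - (pos p').1)|
        * (S : ℝ) ^ r ≤ 20) :
    ∑ g ∈ 𝒢, (((P ×ˢ P).filter fun q => R g q.1 q.2).card : ℝ)
      ≤ scalePow S (κ + ((K : ℝ) - r + e + μ 0 - μ t + 6)) := by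
  have e1 : ∑ g ∈ 𝒢, ((P ×ˢ P).filter fun q => R g q.1 q.2).card
      = ∑ p ∈ P, ((P ×ˢ 𝒢).filter fun q => R q.2 p q.1).card := by
    simp only [Finset.card_filter, Finset.sum_product]
    rw [Finset.sum_comm]
    refine Finset.sum_congr rfl fun p _ => ?_
    rw [Finset.sum_comm]
  have e2 : ∀ p ∈ P, (((P ×ˢ 𝒢).filter fun q => R q.2 p q.1).card : ℝ)
      ≤ scalePow S ((K : ℝ) - r + e + μ 0 - μ t + 6) := by
    intro p hp
    refine le_trans ?_ (h.card_pairs_le hp hlr hr hrt htr hOK)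
    refine Nat.cast_le.2 (Finset.card_le_card fun q hq => ?_)
    rw [Finset.mem_filter, Finset.mem_product] at hq
    have := hR q.2 p hp q.1 hq.1.1 hq.2
    rw [Finset.mem_filter, Finset.mem_product, Finset.mem_image]
    exact ⟨⟨hq.1.1, this.1⟩, this.2⟩
  calc ∑ g ∈ 𝒢, (((P ×ˢ P).filter fun q => R g q.1 q.2).card : ℝ)
      = ∑ p ∈ P, (((P ×ˢ 𝒢).filter fun q => R q.2 p q.1).card : ℝ) := by exact_mod_cast e1
    _ ≤ ∑ _p ∈ P, scalePow S ((K : ℝ) - r + e + μ 0 - μ t + 6) := Finset.sum_le_sum e2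
    _ = _ := by rw [Finset.sum_const, nsmul_eq_mul, h.card_eq, scalePow_add h.one_le κ]

/-- Two points with a line in the same square of side `S⁻ʳ`. -/
lemma abs_diff_of_mem_localPoints {r : ℕ} (hr : r ≤ K) {g : ℤ × ℤ} {p p' : ι}
    (hp : p ∈ localPoints S r P Tp par g) (hp' : p' ∈ localPoints S r P Tp par g) :
    |(pos p).2 - (pos p').2 - (g.1 : ℝ) / (S : ℝ) ^ r * ((pos p).1 - (pos p').1)|
        * (S : ℝ) ^ r ≤ 20 := by
  classical
  have hpr : (0 : ℝ) < (S : ℝ) ^ r := pow_pos h.realS_pos r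
  obtain ⟨hpP, T, hT, rfl⟩ := Finset.mem_filter.1 hp
  obtain ⟨hpP', T', hT', hTT⟩ := Finset.mem_filter.1 hp'
  have h1 := h.abs_sub_cell_le hpP hT hr
  have h2 := h.abs_sub_cell_le hpP' hT' hr
  rw [hTT] at h2
  set g := cell S r (par T) with hg
  have e : ((pos p).2 - (pos p').2 - (g.1 : ℝ) / (S : ℝ) ^ r * ((pos p).1 - (pos p').1))
      * (S : ℝ) ^ r = ((pos p).2 * (S : ℝ) ^ r - g.1 * (pos p).1 - g.2)
        - ((pos p').2 * (S : ℝ) ^ r - g.1 * (pos p').1 - g.2) := by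
    field_simp; ring
  have e0 : ∀ u : ℝ, |u| * (S : ℝ) ^ r = |u * (S : ℝ) ^ r| := fun u => by
    rw [abs_mul, abs_of_pos hpr]
  rw [e0, e]
  rw [abs_le] at h1 h2 ⊢
  constructor <;> linarith

lemma abs_fst_sub_le {p p' : ι} (hp : p ∈ P) (hp' : p' ∈ P) : |(pos p).1 - (pos p').1| ≤ 1 := by
  have h1 := (h.pos_mem p hp).1
  have h2 := (h.pos_mem p' hp').1
  rw [abs_le]; constructor <;> linarith

/-- The `L²` norm of the numbers of points with a line in a given square. -/
lemma sum_sq_card_localPoints_le {r : ℕ} (hr : r ≤ K) {e : ℝ}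
    (hOK : ∀ i ≤ r, γ i + μ (r - i) ≤ (K : ℝ) - r + e + μ 0) (𝒢 : Finset (ℤ × ℤ)) :
    ∑ g ∈ 𝒢, ((localPoints S r P Tp par g).card : ℝ) ^ 2
      ≤ scalePow S (κ + ((K : ℝ) - r + e + μ 0 - μ r + 6)) := by
  classical
  refine le_trans (le_of_eq ?_) (h.sum_card_pairs_le (l := 0) (t := r) (Nat.zero_le r) hr (by omega)
    le_rfl (fun i _ hi => hOK i hi) 𝒢
    (fun g p p' => p ∈ localPoints S r P Tp par g ∧ p' ∈ localPoints S r P Tp par g) ?_)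
  · refine Finset.sum_congr rfl fun g _ => ?_
    rw [sq, ← Nat.cast_mul, ← Finset.card_product]
    congr 2
    ext q
    simp only [Finset.mem_product, Finset.mem_filter, localPoints]
    tauto
  · rintro g p hp p' hp' ⟨h1, h2⟩
    refine ⟨(Finset.mem_filter.1 h1).2, ?_, h.abs_diff_of_mem_localPoints hr h1 h2⟩
    rw [pow_zero, mul_one]
    exact h.abs_fst_sub_le hp hp'

/-- The number of vertical strips of width `S⁻ᶜ` that contain a point with a line in `g`. -/
lemma card_strips_mul_le {c r : ℕ} (hcr : c ≤ r) (hr : r ≤ K) (g : ℤ × ℤ) :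
    ((((localPoints S r P Tp par g).image fun p => ⌊(pos p).1 * (S : ℝ) ^ c⌋).card : ℕ) : ℝ)
      * scalePow S (γ c) ≤ lineCount S c P pos (ancestor S (r - c) g) := by
  classical
  unfold lineCount
  apply card_mul_le_card_of_fiber fun p => ⌊(pos p).1 * (S : ℝ) ^ c⌋
  intro m hm
  obtain ⟨p, hp, rfl⟩ := Finset.mem_image.1 hm
  obtain ⟨hpP, T, hT, rfl⟩ := Finset.mem_filter.1 hp
  refine (h.points_lower p hpP c (hcr.trans hr)).trans (Nat.cast_le.2 (Finset.card_le_card ?_))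
  intro p' hp'
  obtain ⟨hp'P, hc⟩ := Finset.mem_filter.1 hp'
  have hc1 : ⌊(pos p').1 * (S : ℝ) ^ c⌋ = ⌊(pos p).1 * (S : ℝ) ^ c⌋ := congrArg Prod.fst hc
  have hc2 : ⌊(pos p').2 * (S : ℝ) ^ c⌋ = ⌊(pos p).2 * (S : ℝ) ^ c⌋ := congrArg Prod.snd hc
  rw [Finset.mem_filter, Finset.mem_filter]
  refine ⟨⟨hp'P, ?_⟩, hc1⟩
  rw [ancestor_cell_of_le h.one_le hcr]
  have h1 := h.abs_sub_cell_le hpP hT (hcr.trans hr)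
  have hs := h.abs_cell_fst_le hpP hT c
  set g := cell S c (par T) with hg
  have hs' : |(g.1 : ℝ)| ≤ (S : ℝ) ^ c := by exact_mod_cast hs
  have hpc : (0 : ℝ) < (S : ℝ) ^ c := pow_pos h.realS_pos c
  have x1 : |((pos p').1 - (pos p).1) * (S : ℝ) ^ c| ≤ 1 := by
    rw [sub_mul]
    exact (Int.abs_sub_lt_one_of_floor_eq_floor hc1).le
  have y1 : |((pos p').2 - (pos p).2) * (S : ℝ) ^ c| ≤ 1 := by
    rw [sub_mul]
    exact (Int.abs_sub_lt_one_of_floor_eq_floor hc2).le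
  have x2 : |(g.1 : ℝ) * ((pos p').1 - (pos p).1)| ≤ 1 := by
    rw [abs_mul] at x1 ⊢
    rw [abs_of_pos hpc] at x1
    rw [mul_comm] at x1
    exact (mul_le_mul_of_nonneg_right hs' (abs_nonneg _)).trans x1
  unfold Near
  rw [abs_le] at h1 y1 x2 ⊢
  constructor <;> nlinarith

/-- The `L²` norm of the numbers of points with a line in a given square, when the points near
this line are known to lie in few vertical strips of width `S⁻ᶜ`. -/
lemma sum_sq_card_localPoints_le_of_strips {c r : ℕ} (hcr : c ≤ r) (hr : r ≤ K) {e v : ℝ}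
    (hOK : ∀ i, c ≤ i → i ≤ r → γ i + μ (r - i) ≤ (K : ℝ) - r + e + μ 0) (𝒢 : Finset (ℤ × ℤ))
    (h𝒢 : ∀ g ∈ 𝒢, (lineCount S c P pos (ancestor S (r - c) g) : ℝ) ≤ scalePow S v) :
    ∑ g ∈ 𝒢, ((localPoints S r P Tp par g).card : ℝ) ^ 2
      ≤ scalePow S (v - γ c + (κ + ((K : ℝ) - r + e + μ 0 - μ r + 6))) := by
  classical
  set strip : ι → ℤ := fun p => ⌊(pos p).1 * (S : ℝ) ^ c⌋ with hstrip
  have hsum := h.sum_card_pairs_le (l := c) (t := r) hcr hr (by omega) le_rfl hOK 𝒢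
    (fun g p p' => p ∈ localPoints S r P Tp par g ∧ p' ∈ localPoints S r P Tp par g ∧
      strip p = strip p') ?_
  · have hpt : ∀ g ∈ 𝒢, ((localPoints S r P Tp par g).card : ℝ) ^ 2 ≤ scalePow S (v - γ c) *
        ((P ×ˢ P).filter fun q => q.1 ∈ localPoints S r P Tp par g ∧
          q.2 ∈ localPoints S r P Tp par g ∧ strip q.1 = strip q.2).card := by
      intro g hg
      set L := localPoints S r P Tp par g with hL
      have hN : ((L.image strip).card : ℝ) ≤ scalePow S (v - γ c) := by
        rw [scalePow_sub h.one_le, le_div_iff₀ (scalePow_pos h.one_le _)]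
        exact (h.card_strips_mul_le hcr hr g).trans (h𝒢 g hg)
      have e1 : (L.card : ℝ) = ∑ m ∈ L.image strip, ((L.filter fun p => strip p = m).card : ℝ) := by
        exact_mod_cast Finset.card_eq_sum_card_fiberwise
          fun p hp => Finset.mem_image_of_mem strip hp
      have e2 : ∑ m ∈ L.image strip, ((L.filter fun p => strip p = m).card : ℝ) ^ 2
          = ((P ×ˢ P).filter fun q => q.1 ∈ L ∧ q.2 ∈ L ∧ strip q.1 = strip q.2).card := by
        have h1 := card_filter_prod_eq_sum L strip strip (L.image strip)
          fun p hp => Finset.mem_image_of_mem strip hp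
        have h2 : ((L ×ˢ L).filter fun q => strip q.2 = strip q.1).card
            = ((P ×ˢ P).filter fun q => q.1 ∈ L ∧ q.2 ∈ L ∧ strip q.1 = strip q.2).card := by
          congr 1
          ext q
          simp only [Finset.mem_product, Finset.mem_filter, hL, localPoints, eq_comm]
          tauto
        rw [← h2]
        have h3 : ∑ m ∈ L.image strip, ((L.filter fun p => strip p = m).card : ℝ) ^ 2
          = ((∑ m ∈ L.image strip, (L.filter fun p => strip p = m).card
            * (L.filter fun p => strip p = m).card : ℕ) : ℝ) := by
          push_cast
          exact Finset.sum_congr rfl fun m _ => sq _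
        rw [h3, Nat.cast_inj]
        convert h1.symm
      rw [e1, ← e2]
      exact sq_sum_le_card_mul_sum_sq.trans
        (mul_le_mul_of_nonneg_right hN (Finset.sum_nonneg fun _ _ => sq_nonneg _))
    refine (Finset.sum_le_sum hpt).trans ?_
    rw [← Finset.mul_sum, scalePow_add h.one_le]
    refine mul_le_mul_of_nonneg_left (le_trans (le_of_eq ?_) hsum) (scalePow_pos h.one_le _).le
    refine Finset.sum_congr rfl fun g _ => ?_
    congr!
  · rintro g p hp p' hp' ⟨h1, h2, h3⟩
    refine ⟨(Finset.mem_filter.1 h1).2, ?_, h.abs_diff_of_mem_localPoints hr h1 h2⟩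
    have hpc : (0 : ℝ) < (S : ℝ) ^ c := pow_pos h.realS_pos c
    have := (Int.abs_sub_lt_one_of_floor_eq_floor h3).le
    rwa [← sub_mul, abs_mul, abs_of_pos hpc] at this

lemma sum_card_localPoints_le {r : ℕ} (hr : r ≤ K) (𝒢 : Finset (ℤ × ℤ)) :
    ∑ g ∈ 𝒢, ((localPoints S r P Tp par g).card : ℝ) ≤ scalePow S (κ + (μ 0 + 4 - μ r)) := by
  classical
  have e1 : ∑ g ∈ 𝒢, (localPoints S r P Tp par g).card
      = ∑ p ∈ P, (𝒢.filter fun g => ∃ T ∈ Tp p, cell S r (par T) = g).card := by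
    simp only [localPoints, Finset.card_filter]
    rw [Finset.sum_comm]
  calc ∑ g ∈ 𝒢, ((localPoints S r P Tp par g).card : ℝ)
      = ∑ p ∈ P, ((𝒢.filter fun g => ∃ T ∈ Tp p, cell S r (par T) = g).card : ℝ) := by
        exact_mod_cast e1
    _ ≤ ∑ _p ∈ P, scalePow S (μ 0 + 4 - μ r) := by
        refine Finset.sum_le_sum fun p hp => le_trans ?_ (h.card_cells_le hp hr)
        refine Nat.cast_le.2 (Finset.card_le_card fun g hg => ?_)
        exact Finset.mem_image.2 (Finset.mem_filter.1 hg).2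
    _ = _ := by rw [Finset.sum_const, nsmul_eq_mul, h.card_eq, scalePow_add h.one_le κ]

open Classical in
/-- The incidences with the lines whose parameters lie in the square `g` of side `S⁻ʳ`. -/
lemma sum_multiplicity_fiber_le {r : ℕ} (hr : r ≤ K) (C : Finset τ) (g : ℤ × ℤ) :
    ∑ T ∈ C.filter (fun T => cell S r (par T) = g), (multiplicity P Tp T : ℝ)
      ≤ scalePow S (μ r + 1) * (localPoints S r P Tp par g).card := by
  set fib : Finset τ := C.filter fun T => cell S r (par T) = g with hfib
  have e3 : ∑ T ∈ fib, multiplicity P Tp T = ∑ p ∈ P, (fib.filter fun T => T ∈ Tp p).card := by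
    simp only [multiplicity, Finset.card_filter]
    rw [Finset.sum_comm]
  have e4 : ∑ p ∈ P, (fib.filter fun T => T ∈ Tp p).card
      = ∑ p ∈ localPoints S r P Tp par g, (fib.filter fun T => T ∈ Tp p).card := by
    symm
    refine Finset.sum_subset (Finset.filter_subset _ _) fun p hp hpL => ?_
    rw [Finset.card_eq_zero, Finset.filter_eq_empty_iff]
    intro T hT hTp
    exact hpL (Finset.mem_filter.2 ⟨hp, T, hTp, (Finset.mem_filter.1 hT).2⟩)
  calc ∑ T ∈ fib, (multiplicity P Tp T : ℝ)
      = ∑ p ∈ localPoints S r P Tp par g, ((fib.filter fun T => T ∈ Tp p).card : ℝ) := by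
        exact_mod_cast e3.trans e4
    _ ≤ (localPoints S r P Tp par g).card • scalePow S (μ r + 1) := by
        refine Finset.sum_le_card_nsmul _ _ _ fun p hp => ?_
        refine le_trans ?_ (h.card_tubes_cell_le (Finset.mem_filter.1 hp).1 hr g)
        refine Nat.cast_le.2 (Finset.card_le_card fun T hT => ?_)
        obtain ⟨hT1, hT2⟩ := Finset.mem_filter.1 hT
        exact Finset.mem_filter.2 ⟨hT2, (Finset.mem_filter.1 hT1).2⟩
    _ = _ := by rw [nsmul_eq_mul, mul_comm]

/-- Cauchy–Schwarz for the number of incidences with a family of tubes, grouped by the squares of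
side `S⁻ʳ` that contain their parameters. -/
lemma sq_sum_multiplicity_le {r : ℕ} (hr : r ≤ K) (C : Finset τ) (B : ℤ × ℤ → ℝ)
    (hB : ∀ g, 0 ≤ B g)
    (hC : ∀ T ∈ C, (multiplicity P Tp T : ℝ) ≤ B (cell S r (par T))) :
    (∑ T ∈ C, (multiplicity P Tp T : ℝ)) ^ 2 ≤ C.card * (scalePow S (μ r + 1) *
      ∑ g ∈ C.image (fun T => cell S r (par T)),
        B g * (localPoints S r P Tp par g).card) := by
  classical
  set 𝒢 := C.image fun T => cell S r (par T) with h𝒢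
  set fib : ℤ × ℤ → Finset τ := fun g => C.filter fun T => cell S r (par T) = g with hfib
  have hmaps : ∀ T ∈ C, cell S r (par T) ∈ 𝒢 := fun T hT => Finset.mem_image_of_mem _ hT
  have e1 : ∑ T ∈ C, (multiplicity P Tp T : ℝ) = ∑ g ∈ 𝒢, ∑ T ∈ fib g, (multiplicity P Tp T : ℝ) :=
    (Finset.sum_fiberwise_of_maps_to hmaps _).symm
  have e2 : (C.card : ℝ) = ∑ g ∈ 𝒢, ((fib g).card : ℝ) := by
    exact_mod_cast Finset.card_eq_sum_card_fiberwise hmaps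
  have b1 : ∀ g, ∑ T ∈ fib g, (multiplicity P Tp T : ℝ) ≤ (fib g).card * B g := by
    intro g
    rw [← nsmul_eq_mul]
    refine Finset.sum_le_card_nsmul _ _ _ fun T hT => ?_
    obtain ⟨hT1, hT2⟩ := Finset.mem_filter.1 hT
    have := hC T hT1
    rwa [hT2] at this
  have b2 : ∀ g, ∑ T ∈ fib g, (multiplicity P Tp T : ℝ)
      ≤ scalePow S (μ r + 1) * (localPoints S r P Tp par g).card :=
    fun g => h.sum_multiplicity_fiber_le hr C g
  rw [e1, e2, Finset.mul_sum]
  refine Finset.sum_sq_le_sum_mul_sum_of_sq_le_mul _ (fun g _ => Nat.cast_nonneg _)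
    (fun g _ => mul_nonneg (scalePow_pos h.one_le _).le (mul_nonneg (hB g) (Nat.cast_nonneg _)))
    fun g _ => ?_
  have h0 : (0 : ℝ) ≤ ∑ T ∈ fib g, (multiplicity P Tp T : ℝ) :=
    Finset.sum_nonneg fun _ _ => Nat.cast_nonneg _
  calc (∑ T ∈ fib g, (multiplicity P Tp T : ℝ)) ^ 2
      = (∑ T ∈ fib g, (multiplicity P Tp T : ℝ)) * ∑ T ∈ fib g, (multiplicity P Tp T : ℝ) := sq _
    _ ≤ ((fib g).card * B g) * (scalePow S (μ r + 1) * (localPoints S r P Tp par g).card) :=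
        mul_le_mul (b1 g) (b2 g) h0 (mul_nonneg (Nat.cast_nonneg _) (hB g))
    _ = _ := by ring

end Energy

end UniformConfiguration

/-! ### The high-low estimate in the squares of the parameter plane -/

lemma ancestor_zero (S : ℕ) (g : ℤ × ℤ) : ancestor S 0 g = g := by
  simp [ancestor]

lemma ancestor_succ (S k : ℕ) (g : ℤ × ℤ) :
    ancestor S k (ancestor S 1 g) = ancestor S (k + 1) g := by
  simp only [ancestor, pow_one]
  rw [pow_succ', Int.ediv_ediv_of_nonneg (Int.natCast_nonneg S),
    Int.ediv_ediv_of_nonneg (Int.natCast_nonneg S)]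

/-- The rescaling that maps the lines with parameters in the square `G` of side `S⁻ᵗ` to all lines
with parameters in the unit square. -/
noncomputable def rescale (S t : ℕ) (G : ℤ × ℤ) (z : ℝ × ℝ) : ℝ × ℝ :=
  (z.1, z.2 * (S : ℝ) ^ t - G.1 * z.1 - G.2)

lemma near_rescale_iff (S t k : ℕ) (G g : ℤ × ℤ) (z : ℝ × ℝ) :
    Near S k (rescale S t G z) (g.1 - G.1 * (S : ℤ) ^ k, g.2 - G.2 * (S : ℤ) ^ k)
      ↔ Near S (t + k) z g := by
  unfold Near rescale
  have : (z.2 * (S : ℝ) ^ t - G.1 * z.1 - G.2) * (S : ℝ) ^ k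
      - ((g.1 - G.1 * (S : ℤ) ^ k : ℤ) : ℝ) * z.1 - ((g.2 - G.2 * (S : ℤ) ^ k : ℤ) : ℝ)
      = z.2 * (S : ℝ) ^ (t + k) - g.1 * z.1 - g.2 := by
    push_cast
    rw [pow_add]
    ring
  simp only [this]

lemma lineCount_rescale {ι : Type*} (S t k : ℕ) (G g : ℤ × ℤ) (F : Finset ι) (pos : ι → ℝ × ℝ) :
    lineCount S k F (fun p => rescale S t G (pos p))
        (g.1 - G.1 * (S : ℤ) ^ k, g.2 - G.2 * (S : ℤ) ^ k)
      = lineCount S (t + k) F pos g := by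
  unfold lineCount
  congr 1
  ext p
  simp only [Finset.mem_filter, near_rescale_iff]

lemma lineCount_le_card {ι : Type*} (S n : ℕ) (F : Finset ι) (z : ι → ℝ × ℝ) (g : ℤ × ℤ) :
    lineCount S n F z g ≤ F.card := by
  classical
  exact Finset.card_le_card (Finset.filter_subset _ _)

lemma lineCount_mono {ι : Type*} (S n : ℕ) {F F' : Finset ι} (hF : F ⊆ F') (z : ι → ℝ × ℝ)
    (g : ℤ × ℤ) : lineCount S n F z g ≤ lineCount S n F' z g := by
  classical
  exact Finset.card_le_card (Finset.filter_subset_filter _ hF)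

namespace UniformConfiguration

variable {ι τ : Type*} {S K D : ℕ} {s w κ : ℝ} {μ γ : ℕ → ℝ}
    {P : Finset ι} {Tp : ι → Finset τ} {pos : ι → ℝ × ℝ} {par : τ → ℝ × ℝ}

section HighLow

variable (h : UniformConfiguration S K D s w κ μ γ P Tp pos par)

include h

lemma highLow_const_le {l : ℕ} (hl : l < K) :
    20000000000 * ((l : ℝ) + 2) * (S : ℝ) ^ 3 * (S : ℝ) ^ (l + 1) ≤ scalePow S (4 + (l + 1)) := by
  have e : scalePow S (4 + ((l : ℝ) + 1)) = (S : ℝ) * (S : ℝ) ^ 3 * (S : ℝ) ^ (l + 1) := by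
    have := scalePow_natCast (S := S) (4 + (l + 1))
    push_cast at this
    rw [this]; ring
  rw [e]
  have hk := h.const_mul_le (C := 20000000000) (by norm_num)
  push_cast at hk
  have h1 : (1 : ℝ) ≤ (K : ℝ) + 2 := by linarith [Nat.cast_nonneg (α := ℝ) K]
  have h2 : (K : ℝ) + 2 ≤ ((K : ℝ) + 2) ^ 3 := le_self_pow₀ h1 (by norm_num)
  have h3 : (l : ℝ) ≤ K := by exact_mod_cast hl.le
  have h4 : 20000000000 * ((l : ℝ) + 2) ≤ S := by nlinarith
  gcongr

lemma card_localPoints_le_lineCount {r : ℕ} (hr : r ≤ K) (g : ℤ × ℤ) :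
    (localPoints S r P Tp par g).card ≤ lineCount S r P pos g := by
  classical
  refine Finset.card_le_card fun p hp => ?_
  obtain ⟨hpP, T, hT, rfl⟩ := Finset.mem_filter.1 hp
  exact Finset.mem_filter.2 ⟨hpP, h.near_cell hpP hT hr⟩

/-- The high-low estimate inside the squares of side `S⁻ᵗ` of the parameter plane, summed over
these squares. -/
lemma sum_sq_localCount_le {t r : ℕ} (htr : t ≤ r) (hr : r ≤ K) {e : ℝ}
    (hOK : ∀ i, r - t ≤ i → i ≤ r → γ i + μ (r - i) ≤ (K : ℝ) - r + e + μ 0)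
    (𝒢 : Finset (ℤ × ℤ))
    (h𝒢 : ∀ g ∈ 𝒢, t < r → 16 * localCount S t (r - 1) P Tp pos par (ancestor S 1 g)
      ≤ S * localCount S t r P Tp pos par g) :
    ∑ g ∈ 𝒢, (localCount S t r P Tp pos par g : ℝ) ^ 2
      ≤ scalePow S (4 + ((r : ℝ) - t) + (κ + ((K : ℝ) - r + e + μ 0 - μ t + 6))) := by
  classical
  rcases htr.eq_or_lt with rfl | hlt
  · -- For `t = r` all points that are counted have a line in `g`, and pairs are counted directly.
    have h1 := h.sum_sq_card_localPoints_le hr (e := e) (fun i hi => hOK i (by omega) hi) 𝒢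
    refine le_trans (Finset.sum_le_sum fun g _ => ?_) (h1.trans (scalePow_mono h.one_le ?_))
    · have : localCount S t t P Tp pos par g ≤ (localPoints S t P Tp par g).card := by
        unfold localCount
        rw [Nat.sub_self, ancestor_zero]
        exact lineCount_le_card _ _ _ _ _
      gcongr
    · linarith
  · obtain ⟨l, rfl⟩ : ∃ l, r = t + (l + 1) := ⟨r - t - 1, by omega⟩
    have hk : t + (l + 1) - t = l + 1 := by omega
    have hSk : (0 : ℤ) < (S : ℤ) ^ (l + 1) := by exact_mod_cast pow_pos h.one_le _
    have hSZ : (S : ℤ) ≠ 0 := by have := h.one_le; omega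
    rw [hk] at hOK
    set F : ℤ × ℤ → Finset ι := fun G => localPoints S t P Tp par G with hF
    set φ : ℤ × ℤ → ℤ × ℤ → ℤ × ℤ := fun G g =>
      (g.1 - G.1 * (S : ℤ) ^ (l + 1), g.2 - G.2 * (S : ℤ) ^ (l + 1)) with hφ
    have hloc : ∀ G g, ancestor S (l + 1) g = G → localCount S t (t + (l + 1)) P Tp pos par g
        = lineCount S (l + 1) (F G) (fun p => rescale S t G (pos p)) (φ G g) := by
      rintro G g rfl
      unfold localCount
      rw [hk, ← lineCount_rescale S t (l + 1) (ancestor S (l + 1) g) g]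
    have hloc1 : ∀ G g, ancestor S (l + 1) g = G →
        localCount S t (t + (l + 1) - 1) P Tp pos par (ancestor S 1 g)
        = lineCount S l (F G) (fun p => rescale S t G (pos p)) (ancestor S 1 (φ G g)) := by
      rintro G g rfl
      unfold localCount
      have hk1 : t + (l + 1) - 1 - t = l := by omega
      have hk2 : t + (l + 1) - 1 = t + l := by omega
      rw [hk1, hk2, ancestor_succ,
        ← lineCount_rescale S t l (ancestor S (l + 1) g) (ancestor S 1 g)]
      congr 1
      simp only [hφ, ancestor, pow_one]
      have : ∀ a b : ℤ, (a - b * (S : ℤ) ^ (l + 1)) / S = a / S - b * (S : ℤ) ^ l := by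
        intro a b
        rw [pow_succ, ← mul_assoc, Int.sub_mul_ediv_right _ _ hSZ]
      rw [this, this]
    have hfib : ∀ G, ∑ g ∈ 𝒢.filter (fun g => ancestor S (l + 1) g = G),
        (localCount S t (t + (l + 1)) P Tp pos par g : ℝ) ^ 2
        ≤ scalePow S (4 + ((l : ℝ) + 1)) *
          cellEnergy S (l + 1) (F G) (fun p => rescale S t G (pos p)) := by
      intro G
      set fib := 𝒢.filter (fun g => ancestor S (l + 1) g = G) with hfibd
      have hinj : Set.InjOn (φ G) fib := by
        intro a _ b _ hab
        have h1 := congrArg Prod.fst hab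
        have h2 := congrArg Prod.snd hab
        simp only [hφ] at h1 h2
        exact Prod.ext (by linarith) (by linarith)
      have hHL := sum_sq_lineCount_le (F G) (fun p => rescale S t G (pos p)) (S := S) (l := l)
        h.one_le ?_ (fib.image (φ G)) ?_ ?_
      · rw [Finset.sum_image hinj] at hHL
        calc _ = ∑ g ∈ fib, (lineCount S (l + 1) (F G) (fun p => rescale S t G (pos p))
              (φ G g) : ℝ) ^ 2 := by
              refine Finset.sum_congr rfl fun g hg => ?_
              rw [hloc G g (Finset.mem_filter.1 hg).2]
          _ ≤ _ := hHL
          _ ≤ _ := mul_le_mul_of_nonneg_right (h.highLow_const_le (by omega)) (Nat.cast_nonneg _)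
      · intro p hp
        exact (h.pos_mem p (Finset.mem_filter.1 hp).1).1
      · intro g0 hg0
        obtain ⟨g, hg, rfl⟩ := Finset.mem_image.1 hg0
        have hg2 : g.1 / (S : ℤ) ^ (l + 1) = G.1 := congrArg Prod.fst (Finset.mem_filter.1 hg).2
        have q1 := Int.ediv_mul_le g.1 hSk.ne'
        have q2 := Int.lt_ediv_add_one_mul_self g.1 hSk
        rw [hg2] at q1 q2
        simp only [hφ]
        rw [abs_le]
        constructor <;> linarith
      · intro g0 hg0
        obtain ⟨g, hg, rfl⟩ := Finset.mem_image.1 hg0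
        obtain ⟨hg1, hg2⟩ := Finset.mem_filter.1 hg
        have := h𝒢 g hg1 hlt
        rwa [hloc G g hg2, hloc1 G g hg2] at this
    set R : ℤ × ℤ → ι → ι → Prop := fun G p p' => p ∈ F G ∧ p' ∈ F G ∧
      cell S (l + 1) (rescale S t G (pos p)) = cell S (l + 1) (rescale S t G (pos p')) with hR
    have hen : ∀ G, cellEnergy S (l + 1) (F G) (fun p => rescale S t G (pos p))
        = ((P ×ˢ P).filter fun q => R G q.1 q.2).card := by
      intro G
      unfold cellEnergy
      congr 1
      ext q
      simp only [Finset.mem_product, Finset.mem_filter, hR, hF, localPoints]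
      tauto
    set 𝒜 := 𝒢.image (ancestor S (l + 1)) with h𝒜
    have hsum := h.sum_card_pairs_le (l := l + 1) (t := t) (r := t + (l + 1)) (by omega) hr
      (by omega) htr hOK 𝒜 R ?_
    · calc ∑ g ∈ 𝒢, (localCount S t (t + (l + 1)) P Tp pos par g : ℝ) ^ 2
          = ∑ G ∈ 𝒜, ∑ g ∈ 𝒢.filter (fun g => ancestor S (l + 1) g = G),
            (localCount S t (t + (l + 1)) P Tp pos par g : ℝ) ^ 2 :=
            (Finset.sum_fiberwise_of_maps_to
              (fun g hg => Finset.mem_image_of_mem _ hg) _).symm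
        _ ≤ ∑ G ∈ 𝒜, scalePow S (4 + ((l : ℝ) + 1)) *
            (((P ×ˢ P).filter fun q => R G q.1 q.2).card : ℝ) := by
            refine Finset.sum_le_sum fun G _ => ?_
            rw [← hen]
            exact hfib G
        _ = scalePow S (4 + ((l : ℝ) + 1)) *
            ∑ G ∈ 𝒜, (((P ×ˢ P).filter fun q => R G q.1 q.2).card : ℝ) := by
            rw [Finset.mul_sum]
        _ ≤ scalePow S (4 + ((l : ℝ) + 1)) * scalePow S
            (κ + ((K : ℝ) - ((t + (l + 1) : ℕ) : ℝ) + e + μ 0 - μ t + 6)) :=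
            mul_le_mul_of_nonneg_left (le_trans (le_of_eq (Finset.sum_congr rfl fun G _ => by
              congr!)) hsum) (scalePow_pos h.one_le _).le
        _ ≤ _ := scalePow_mul_le h.one_le (le_of_eq (by push_cast; ring))
    · rintro G p hp p' hp' ⟨h1, h2, h3⟩
      refine ⟨(Finset.mem_filter.1 h1).2, ?_, ?_⟩
      · have hpc : (0 : ℝ) < (S : ℝ) ^ (l + 1) := pow_pos h.realS_pos _
        have := (Int.abs_sub_lt_one_of_floor_eq_floor (congrArg Prod.fst h3)).le
        simp only [rescale] at this
        rwa [← sub_mul, abs_mul, abs_of_pos hpc] at this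
      · have hpc : (0 : ℝ) < (S : ℝ) ^ (t + (l + 1)) := pow_pos h.realS_pos _
        have hpt : (0 : ℝ) < (S : ℝ) ^ t := pow_pos h.realS_pos _
        have h4 := (Int.abs_sub_lt_one_of_floor_eq_floor (congrArg Prod.snd h3)).le
        simp only [rescale] at h4
        have e : ∀ u : ℝ, |u| * (S : ℝ) ^ (t + (l + 1)) = |u * (S : ℝ) ^ (t + (l + 1))| :=
          fun u => by rw [abs_mul, abs_of_pos hpc]
        rw [e]
        have e2 : ((pos p).2 - (pos p').2 - (G.1 : ℝ) / (S : ℝ) ^ t * ((pos p).1 - (pos p').1))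
            * (S : ℝ) ^ (t + (l + 1))
            = ((pos p).2 * (S : ℝ) ^ t - G.1 * (pos p).1 - G.2) * (S : ℝ) ^ (l + 1)
              - ((pos p').2 * (S : ℝ) ^ t - G.1 * (pos p').1 - G.2) * (S : ℝ) ^ (l + 1) := by
          rw [pow_add]; field_simp; ring
        rw [e2]
        linarith

/-- The energy of the points, from their branching numbers. -/
lemma cellEnergy_le {n : ℕ} (hn : n ≤ K) :
    (cellEnergy S n P pos : ℝ) ≤ scalePow S (κ + (γ n + 1)) := by
  classical
  have e1 : cellEnergy S n P pos
      = ∑ p ∈ P, (P.filter fun p' => cell S n (pos p) = cell S n (pos p')).card := by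
    simp only [cellEnergy, Finset.card_filter, Finset.sum_product]
  rw [e1, scalePow_add h.one_le, ← h.card_eq, ← nsmul_eq_mul]
  push_cast
  refine Finset.sum_le_card_nsmul _ _ _ fun p hp => ?_
  have := h.points_upper p hp n hn
  simpa only [eq_comm] using this

/-- The tubes that are too rich at a scale `l + 1` up to `D`, and not at the previous scale, carry
few incidences: the high-low estimate applies to them, and the dimensions `s` of the lines through
a point and `2 - s` of the points add up to `2`. -/
lemma sum_multiplicity_rich_le {l : ℕ} (hl : l + 1 ≤ D) {v : ℝ} (C : Finset τ)
    (hC : ∀ T ∈ C, ∃ p ∈ P, T ∈ Tp p)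
    (hC1 : ∀ T ∈ C, (lineCount S l P pos (cell S l (par T)) : ℝ)
      ≤ 16 ^ l * scalePow S (v - l + κ))
    (hC2 : ∀ T ∈ C, 16 ^ (l + 1) * scalePow S (v - (l + 1) + κ)
      < (lineCount S (l + 1) P pos (cell S (l + 1) (par T)) : ℝ)) :
    ∑ T ∈ C, (multiplicity P Tp T : ℝ) ≤ scalePow S (κ + μ 0 + 2 * w + 6 - v) := by
  classical
  have hlK : l + 1 ≤ K := hl.trans h.D_le
  set Γ := C.image fun T => cell S (l + 1) (par T) with hΓ
  have hHL := sum_sq_lineCount_le P pos (S := S) (l := l) h.one_le (fun p hp => (h.pos_mem p hp).1)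
    Γ ?_ ?_
  · have hE := h.cellEnergy_le hlK
    have hmaps : ∀ T ∈ C, cell S (l + 1) (par T) ∈ Γ := fun T hT => Finset.mem_image_of_mem _ hT
    set thr := scalePow S (v - (l + 1) + κ) with hthr
    have hthr0 : 0 < thr := scalePow_pos h.one_le _
    have hn : ∀ g ∈ Γ, (lineCount S (l + 1) P pos g : ℝ) * thr
        ≤ (lineCount S (l + 1) P pos g : ℝ) ^ 2 := by
      intro g hg
      obtain ⟨T, hT, rfl⟩ := Finset.mem_image.1 hg
      have h1 := hC2 T hT
      have h2 : thr ≤ 16 ^ (l + 1) * thr :=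
        le_mul_of_one_le_left hthr0.le (one_le_pow₀ (by norm_num))
      rw [sq]
      exact mul_le_mul_of_nonneg_left (h2.trans h1.le) (Nat.cast_nonneg _)
    have hsum : (∑ g ∈ Γ, (lineCount S (l + 1) P pos g : ℝ)) * thr
        ≤ scalePow S (4 + ((l : ℝ) + 1) + (κ + (γ (l + 1) + 1))) := by
      rw [Finset.sum_mul]
      refine (Finset.sum_le_sum hn).trans (hHL.trans ?_)
      rw [scalePow_add h.one_le (4 + ((l : ℝ) + 1))]
      exact mul_le_mul (h.highLow_const_le (by omega)) hE (Nat.cast_nonneg _)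
        (scalePow_pos h.one_le _).le
    have hsum2 : ∑ g ∈ Γ, (lineCount S (l + 1) P pos g : ℝ)
        ≤ scalePow S (4 + ((l : ℝ) + 1) + (κ + (γ (l + 1) + 1)) - (v - (l + 1) + κ)) := by
      rw [scalePow_sub h.one_le, le_div_iff₀ hthr0]
      exact hsum
    have hd1 := h.tubes_dim (l + 1) hlK
    have hd2 := h.points_coarse (l + 1) hl
    push_cast at hd1 hd2
    calc ∑ T ∈ C, (multiplicity P Tp T : ℝ)
        = ∑ g ∈ Γ, ∑ T ∈ C.filter (fun T => cell S (l + 1) (par T) = g),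
            (multiplicity P Tp T : ℝ) := (Finset.sum_fiberwise_of_maps_to hmaps _).symm
      _ ≤ ∑ g ∈ Γ, scalePow S (μ (l + 1) + 1) * (lineCount S (l + 1) P pos g : ℝ) := by
          refine Finset.sum_le_sum fun g _ => (h.sum_multiplicity_fiber_le hlK C g).trans ?_
          refine mul_le_mul_of_nonneg_left ?_ (scalePow_pos h.one_le _).le
          exact_mod_cast h.card_localPoints_le_lineCount hlK g
      _ = scalePow S (μ (l + 1) + 1) * ∑ g ∈ Γ, (lineCount S (l + 1) P pos g : ℝ) := by
          rw [Finset.mul_sum]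
      _ ≤ scalePow S (μ (l + 1) + 1) *
          scalePow S (4 + ((l : ℝ) + 1) + (κ + (γ (l + 1) + 1)) - (v - (l + 1) + κ)) :=
          mul_le_mul_of_nonneg_left hsum2 (scalePow_pos h.one_le _).le
      _ ≤ _ := scalePow_mul_le h.one_le (by nlinarith)
  · intro g hg
    obtain ⟨T, hT, rfl⟩ := Finset.mem_image.1 hg
    obtain ⟨p, hp, hTp⟩ := hC T hT
    exact h.abs_cell_fst_le hp hTp _
  · intro g hg
    obtain ⟨T, hT, rfl⟩ := Finset.mem_image.1 hg
    rw [ancestor_cell h.one_le]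
    have h1 := hC1 T hT
    have h2 := (hC2 T hT).le
    have e : scalePow S (v - l + κ) = S * scalePow S (v - (l + 1) + κ) := by
      conv_rhs => rw [← scalePow_one (S := S)]
      rw [← scalePow_add h.one_le]
      congr 1
      ring
    have h3 : (16 : ℝ) * lineCount S l P pos (cell S l (par T))
        ≤ S * lineCount S (l + 1) P pos (cell S (l + 1) (par T)) := by
      calc (16 : ℝ) * lineCount S l P pos (cell S l (par T))
          ≤ 16 * (16 ^ l * scalePow S (v - l + κ)) := by gcongr
        _ = S * (16 ^ (l + 1) * scalePow S (v - (l + 1) + κ)) := by rw [e]; ring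
        _ ≤ _ := by gcongr
    exact_mod_cast h3

end HighLow

end UniformConfiguration

/-! ### Critical scales and the incidence bound for uniform configurations -/

namespace UniformConfiguration

variable {ι τ : Type*} {S K D : ℕ} {s w κ : ℝ} {μ γ : ℕ → ℝ}
    {P : Finset ι} {Tp : ι → Finset τ} {pos : ι → ℝ × ℝ} {par : τ → ℝ × ℝ}

section Critical

variable (h : UniformConfiguration S K D s w κ μ γ P Tp pos par)

include h

lemma multiplicity_le_localCount {t r : ℕ} (htr : t ≤ r) (hr : r ≤ K) (T : τ) :
    multiplicity P Tp T ≤ localCount S t r P Tp pos par (cell S r (par T)) := by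
  classical
  unfold localCount
  rw [ancestor_cell_of_le h.one_le htr]
  refine Finset.card_le_card fun p hp => ?_
  obtain ⟨hpP, hT⟩ := Finset.mem_filter.1 hp
  exact Finset.mem_filter.2 ⟨Finset.mem_filter.2 ⟨hpP, T, hT, rfl⟩, h.near_cell hpP hT hr⟩

lemma localCount_le_of_le {t t' r : ℕ} (htt : t ≤ t') (htr : t' ≤ r) (T : τ) :
    localCount S t' r P Tp pos par (cell S r (par T))
      ≤ localCount S t r P Tp pos par (cell S r (par T)) := by
  classical
  unfold localCount
  rw [ancestor_cell_of_le h.one_le htr, ancestor_cell_of_le h.one_le (htt.trans htr)]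
  refine lineCount_mono _ _ (fun p hp => ?_) _ _
  obtain ⟨hpP, T', hT', he⟩ := Finset.mem_filter.1 hp
  exact Finset.mem_filter.2 ⟨hpP, T', hT', cell_eq_of_le h.one_le htt he⟩

/-- The critical scales of a tube `T`: `ρ t` is the smallest `r ≥ t` such that the number of points
near `T` at scale `S⁻ʳ`, with a line close to `T` at scale `S⁻ᵗ`, is about `S^(K - r)` times the
number of points on `T`. By minimality the high-low estimate applies at the critical scale. -/
lemma exists_critical (T : τ) : ∃ ρ : ℕ → ℕ, (∀ t < K, ρ t ≤ ρ (t + 1)) ∧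
    ∀ t ≤ K, t ≤ ρ t ∧ ρ t ≤ K ∧
      multiplicity P Tp T * S ^ (K - ρ t)
        ≤ 16 ^ (K - ρ t) * localCount S t (ρ t) P Tp pos par (cell S (ρ t) (par T)) ∧
      (t < ρ t → 16 * localCount S t (ρ t - 1) P Tp pos par (ancestor S 1 (cell S (ρ t) (par T)))
        ≤ S * localCount S t (ρ t) P Tp pos par (cell S (ρ t) (par T))) := by
  set Q : ℕ → Set ℕ := fun t => {r | t ≤ r ∧ r ≤ K ∧ multiplicity P Tp T * S ^ (K - r)
        ≤ 16 ^ (K - r) * localCount S t r P Tp pos par (cell S r (par T))} with hQ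
  have hQK : ∀ t ≤ K, K ∈ Q t := by
    intro t ht
    refine ⟨ht, le_rfl, ?_⟩
    rw [Nat.sub_self, pow_zero, pow_zero, mul_one, one_mul]
    exact h.multiplicity_le_localCount ht le_rfl T
  have hmem : ∀ t ≤ K, sInf (Q t) ∈ Q t := fun t ht => Nat.sInf_mem ⟨K, hQK t ht⟩
  refine ⟨fun t => sInf (Q t), fun t ht => ?_, fun t ht => ?_⟩
  · obtain ⟨h1, h2, h3⟩ := hmem (t + 1) ht
    refine Nat.sInf_le ⟨(Nat.le_succ t).trans h1, h2, h3.trans ?_⟩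
    exact Nat.mul_le_mul_left _ (h.localCount_le_of_le (Nat.le_succ t) h1 T)
  · obtain ⟨h1, h2, h3⟩ := hmem t ht
    refine ⟨h1, h2, h3, ?_⟩
    beta_reduce
    intro hlt
    have hnots : ∀ j < sInf (Q t), j ∉ Q t := fun j hj => Nat.notMem_of_lt_sInf hj
    generalize sInf (Q t) = r at h1 h2 h3 hlt hnots ⊢
    obtain ⟨j, hj⟩ : ∃ j, r = j + 1 := ⟨r - 1, by omega⟩
    subst hj
    have hnot : j ∉ Q t := hnots j (by omega)
    have hnot' : 16 ^ (K - j) * localCount S t j P Tp pos par (cell S j (par T))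
        < multiplicity P Tp T * S ^ (K - j) := by
      by_contra hcon
      exact hnot ⟨by omega, by omega, not_lt.1 hcon⟩
    have hKj : K - j = (K - (j + 1)) + 1 := by omega
    rw [Nat.add_sub_cancel, ancestor_cell h.one_le]
    rw [hKj, pow_succ, pow_succ] at hnot'
    have h4 : 16 ^ (K - (j + 1)) * (16 * localCount S t j P Tp pos par (cell S j (par T)))
        ≤ 16 ^ (K - (j + 1)) *
          (S * localCount S t (j + 1) P Tp pos par (cell S (j + 1) (par T))) := by
      calc _ = 16 ^ (K - (j + 1)) * 16 * localCount S t j P Tp pos par (cell S j (par T)) := by ring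
        _ ≤ multiplicity P Tp T * (S ^ (K - (j + 1)) * S) := hnot'.le
        _ = (multiplicity P Tp T * S ^ (K - (j + 1))) * S := by ring
        _ ≤ (16 ^ (K - (j + 1)) * localCount S t (j + 1) P Tp pos par
              (cell S (j + 1) (par T))) * S := Nat.mul_le_mul_right _ h3
        _ = _ := by ring
    exact Nat.le_of_mul_le_mul_left h4 (by positivity)

/-- The `L²` norm of the numbers of points with a line in a given square of side `S⁻ʳ`, at the
transition between the scales `t + 1`, where points and lines are out of balance at some scale
`i`, and `t`, where they are not. The imbalance at `i` shows that the points are concentrated in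
squares of side `S⁻ⁱ`; as the line is not rich, these squares are few. -/
lemma exists_sum_sq_card_localPoints_le {t r r' : ℕ} {v : ℝ} (hrr : r ≤ r')
    (hr : r' ≤ K) (htK : t < K)
    (hA : ∃ i ≤ r', r' ≤ i + (t + 1) ∧ (K : ℝ) - r' + 2 * w + μ 0 < γ i + μ (r' - i))
    (𝒢 : Finset (ℤ × ℤ))
    (h𝒢 : ∀ g ∈ 𝒢, ∀ e ≤ D, e ≤ r →
      (lineCount S e P pos (ancestor S (r - e) g) : ℝ) ≤ scalePow S (v - e + κ)) :
    ∃ V : ℝ, V + r - t + μ 0 ≤ μ t + 7 ∧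
      ∑ g ∈ 𝒢, ((localPoints S r P Tp par g).card : ℝ) ^ 2
        ≤ scalePow S (V + 2 * κ + μ 0 - μ r + (v + 2 * w + 10)) := by
  classical
  have hw := h.w_nonneg
  set p : ℕ → Prop := fun i => (K : ℝ) - r' + 2 * w + μ 0 < γ i + μ (r' - i) with hp
  obtain ⟨i₀, hi1, hi2, hi3⟩ := hA
  -- `c₀` is the last scale at which points and lines are out of balance.
  set c₀ := Nat.findGreatest p r' with hc₀
  have hpc : p c₀ := Nat.findGreatest_spec hi1 hi3
  have hic : i₀ ≤ c₀ := Nat.le_findGreatest hi1 hi3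
  have hcr' : c₀ ≤ r' := Nat.findGreatest_le r'
  have hmax : ∀ i, c₀ < i → i ≤ r' → γ i + μ (r' - i) ≤ (K : ℝ) - r' + 2 * w + μ 0 :=
    fun i h1 h2 => not_lt.1 (Nat.findGreatest_is_greatest h1 h2)
  have hcD : c₀ < D := by
    by_contra hcon
    exact absurd (h.gamma_add_mu_le (not_lt.1 hcon) hcr' hr) (not_le.2 hpc)
  simp only [hp] at hpc
  have hmu : μ (r' - c₀) ≤ μ t + ((t : ℝ) + 1 - (r' - c₀)) + 4 := by
    by_cases hcase : r' - c₀ ≤ t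
    · have := h.mu_le_add_sub hcase htK.le
      rw [Nat.cast_sub hcr'] at this
      linarith
    · have e : r' - c₀ = t + 1 := by omega
      have e2 : (r' : ℝ) - c₀ = t + 1 := by rw [← Nat.cast_sub hcr', e]; push_cast; ring
      have := h.mu_le_of_le (m := t) (n := r' - c₀) (by omega) (by omega)
      rw [e2]
      linarith
  -- For `c₀ < r`, pairs are counted in vertical strips of width `S⁻⁽ᶜ⁺¹⁾`, where `c = c₀`;
  -- otherwise `r < D`, and the line has few points at scale `S⁻ʳ`.
  by_cases hcr : c₀ < r
  · refine ⟨(K : ℝ) - r - (c₀ + 1 : ℕ) - γ (c₀ + 1), ?_, ?_⟩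
    · have := h.gamma_le_succ (n := c₀) (by omega)
      push_cast
      linarith
    · refine (h.sum_sq_card_localPoints_le_of_strips (c := c₀ + 1) (e := 2 * w + 4)
        (v := v - (c₀ + 1 : ℕ) + κ) hcr (hrr.trans hr) (fun i h1 h2 => ?_) 𝒢
        (fun g hg => h𝒢 g hg _ hcD hcr)).trans (scalePow_mono h.one_le (by linarith))
      have h3 := hmax i h1 (h2.trans hrr)
      have h4 := h.mu_le_add_sub (m := r - i) (n := r' - i) (by omega) (by omega)
      rw [Nat.cast_sub h2, Nat.cast_sub (h2.trans hrr)] at h4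
      linarith
  · refine ⟨-r, ?_, ?_⟩
    · have := h.mu_le_add_sub (Nat.zero_le t) htK.le
      push_cast at this
      linarith
    · have hb : ∀ g ∈ 𝒢, ((localPoints S r P Tp par g).card : ℝ) ≤ scalePow S (v - r + κ) := by
        intro g hg
        have := h𝒢 g hg r (by omega) le_rfl
        rw [Nat.sub_self, ancestor_zero] at this
        exact le_trans (by exact_mod_cast h.card_localPoints_le_lineCount (hrr.trans hr) g) this
      calc ∑ g ∈ 𝒢, ((localPoints S r P Tp par g).card : ℝ) ^ 2
          ≤ ∑ g ∈ 𝒢, scalePow S (v - r + κ) * ((localPoints S r P Tp par g).card : ℝ) := by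
            refine Finset.sum_le_sum fun g hg => ?_
            rw [sq]
            exact mul_le_mul_of_nonneg_right (hb g hg) (Nat.cast_nonneg _)
        _ = scalePow S (v - r + κ) * ∑ g ∈ 𝒢, ((localPoints S r P Tp par g).card : ℝ) := by
            rw [Finset.mul_sum]
        _ ≤ scalePow S (v - r + κ) * scalePow S (κ + (μ 0 + 4 - μ r)) :=
            mul_le_mul_of_nonneg_left (h.sum_card_localPoints_le (hrr.trans hr) 𝒢)
              (scalePow_pos h.one_le _).le
        _ ≤ _ := scalePow_mul_le h.one_le (by linarith)

/-- The incidences with tubes whose critical scale for `t` is `r`, where `t` is a transition scale.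
The number of incidences is at most the sum over the squares `g` of side `S⁻ʳ` of a product `n R`,
where `R` counts the points with a line in `g`, and `n` those near `g` with a line in the same
square of side `S⁻ᵗ`. The second moment of `n` comes from the high-low estimate, that of `R` from
the transition. -/
lemma sq_sum_multiplicity_le_of_transition {t r r' : ℕ} {v : ℝ} (htr : t ≤ r) (hrr : r ≤ r')
    (hr : r' ≤ K) (htK : t < K)
    (hA : ∃ i ≤ r', r' ≤ i + (t + 1) ∧ (K : ℝ) - r' + 2 * w + μ 0 < γ i + μ (r' - i))
    (hOK : ∀ i, r - t ≤ i → i ≤ r → γ i + μ (r - i) ≤ (K : ℝ) - r + 2 * w + μ 0)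
    (C : Finset τ)
    (hrich : ∀ T ∈ C, ∀ e ≤ D,
      (lineCount S e P pos (cell S e (par T)) : ℝ) ≤ scalePow S (v - e + κ))
    (hcrit : ∀ T ∈ C, multiplicity P Tp T * S ^ (K - r)
        ≤ 16 ^ (K - r) * localCount S t r P Tp pos par (cell S r (par T)))
    (hhigh : ∀ T ∈ C, t < r →
      16 * localCount S t (r - 1) P Tp pos par (ancestor S 1 (cell S r (par T)))
        ≤ S * localCount S t r P Tp pos par (cell S r (par T))) :
    (∑ T ∈ C, (multiplicity P Tp T : ℝ)) ^ 2
      ≤ C.card * scalePow S ((3 * κ + μ 0 + v + 4 * w + 33) / 2) := by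
  classical
  have hrK := hrr.trans hr
  set 𝒢 := C.image fun T => cell S r (par T) with h𝒢
  obtain ⟨V, hV1, hV2⟩ := h.exists_sum_sq_card_localPoints_le hrr hr htK hA 𝒢 (v := v) (by
    intro g hg e he her
    obtain ⟨T, hT, rfl⟩ := Finset.mem_image.1 hg
    rw [ancestor_cell_of_le h.one_le her]
    exact hrich T hT e he)
  have hn2 := h.sum_sq_localCount_le htr hrK hOK 𝒢 (by
    intro g hg hlt
    obtain ⟨T, hT, rfl⟩ := Finset.mem_image.1 hg
    exact hhigh T hT hlt)
  set n : ℤ × ℤ → ℝ := fun g => localCount S t r P Tp pos par g with hn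
  set R : ℤ × ℤ → ℝ := fun g => (localPoints S r P Tp par g).card with hR
  have hCS := h.sq_sum_multiplicity_le hrK C
    (fun g => scalePow S (1 - ((K : ℝ) - r)) * n g)
    (fun g => mul_nonneg (scalePow_pos h.one_le _).le (Nat.cast_nonneg _)) (by
      intro T hT
      have h1 := hcrit T hT
      have h1' : (multiplicity P Tp T : ℝ) * (S : ℝ) ^ (K - r)
          ≤ 16 ^ (K - r) * n (cell S r (par T)) := by
        have := (Nat.cast_le (α := ℝ)).2 h1
        push_cast at this
        exact this
      have h2 : scalePow S ((K : ℝ) - r) = (S : ℝ) ^ (K - r) := by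
        rw [← Nat.cast_sub hrK, scalePow_natCast]
      rw [scalePow_sub h.one_le, scalePow_one, h2, div_mul_eq_mul_div,
        le_div_iff₀ (pow_pos h.realS_pos _)]
      refine h1'.trans (mul_le_mul_of_nonneg_right ?_ (Nat.cast_nonneg _))
      exact (pow_le_pow_right₀ (by norm_num) (Nat.sub_le K r)).trans h.const_pow_le)
  refine hCS.trans (mul_le_mul_of_nonneg_left ?_ (Nat.cast_nonneg _))
  have hnR : ∑ g ∈ 𝒢, n g * R g
      ≤ scalePow S ((3 * κ + μ 0 - μ r + K - r + v + 4 * w + 27) / 2) := by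
    refine abs_le_of_sq_le_sq' ?_ (scalePow_pos h.one_le _).le |>.2
    refine (Finset.sum_mul_sq_le_sq_mul_sq 𝒢 n R).trans ?_
    rw [sq (scalePow S _), ← scalePow_add h.one_le]
    refine (mul_le_mul hn2 hV2 (Finset.sum_nonneg fun _ _ => sq_nonneg _)
      (scalePow_pos h.one_le _).le).trans (scalePow_mul_le h.one_le ?_)
    linarith
  have hmr := h.tubes_triv r hrK
  calc scalePow S (μ r + 1) * ∑ g ∈ 𝒢, scalePow S (1 - ((K : ℝ) - r)) * n g * R g
      = (scalePow S (μ r + 1) * scalePow S (1 - ((K : ℝ) - r))) * ∑ g ∈ 𝒢, n g * R g := by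
        simp only [Finset.mul_sum, mul_assoc]
    _ ≤ scalePow S (μ r + 1 + (1 - ((K : ℝ) - r))) *
        scalePow S ((3 * κ + μ 0 - μ r + K - r + v + 4 * w + 27) / 2) := by
        rw [← scalePow_add h.one_le]
        exact mul_le_mul_of_nonneg_left hnR (scalePow_pos h.one_le _).le
    _ ≤ _ := scalePow_mul_le h.one_le (by linarith)

lemma le_sum_multiplicity {C : Finset τ} (hC : ∀ p ∈ P, Tp p ⊆ C) :
    scalePow S (κ + μ 0) ≤ ∑ T ∈ C, (multiplicity P Tp T : ℝ) := by
  classical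
  have e1 : ∑ T ∈ C, multiplicity P Tp T = ∑ p ∈ P, (C.filter fun T => T ∈ Tp p).card := by
    simp only [multiplicity, Finset.card_filter]
    rw [Finset.sum_comm]
  have e2 : ∑ T ∈ C, (multiplicity P Tp T : ℝ)
      = ∑ p ∈ P, ((C.filter fun T => T ∈ Tp p).card : ℝ) := by exact_mod_cast e1
  rw [e2, scalePow_add h.one_le, ← h.card_eq, ← nsmul_eq_mul]
  refine Finset.card_nsmul_le_sum _ _ _ fun p hp => (h.le_card_tubes hp).trans ?_
  refine Nat.cast_le.2 (Finset.card_le_card fun T hT => ?_)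
  exact Finset.mem_filter.2 ⟨hC p hp hT, hT⟩

open Classical in
/-- The tubes that are not rich at any scale up to `D` carry at least `S ^ (κ + μ 0 - 1)`
incidences, out of a total of about `S ^ (κ + μ 0)`. -/
lemma le_sum_multiplicity_poor :
    ∃ C ⊆ P.biUnion Tp, scalePow S (κ + μ 0 - 1) ≤ ∑ T ∈ C, (multiplicity P Tp T : ℝ) ∧
      ∀ T ∈ C, ∀ e ≤ D,
        (lineCount S e P pos (cell S e (par T)) : ℝ) ≤ 16 ^ e * scalePow S (2 * w + 9 - e + κ) := by
  set U := P.biUnion Tp with hU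
  set q : τ → ℕ → Prop := fun T e =>
    (lineCount S e P pos (cell S e (par T)) : ℝ) ≤ 16 ^ e * scalePow S (2 * w + 9 - e + κ) with hq
  set m : τ → ℝ := fun T => multiplicity P Tp T with hm
  have hm0 : ∀ T, 0 ≤ m T := fun T => Nat.cast_nonneg _
  have hw := h.w_nonneg
  refine ⟨U.filter fun T => ∀ e ≤ D, q T e, Finset.filter_subset _ _, ?_,
    fun T hT => (Finset.mem_filter.1 hT).2⟩
  have htot := h.le_sum_multiplicity (C := U) fun p hp => Finset.subset_biUnion_of_mem Tp hp
  rw [← Finset.sum_filter_add_sum_filter_not U fun T => ∀ e ≤ D, q T e] at htot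
  set Cl : ℕ → Finset τ := fun l => U.filter fun T => q T l ∧ ¬ q T (l + 1) with hCl
  have hbad : ∑ T ∈ U.filter (fun T => ¬ ∀ e ≤ D, q T e), m T
      ≤ ∑ l ∈ Finset.range D, ∑ T ∈ Cl l, m T := by
    have e1 : ∑ l ∈ Finset.range D, ∑ T ∈ Cl l, m T
        = ∑ T ∈ U, ∑ l ∈ Finset.range D, if q T l ∧ ¬ q T (l + 1) then m T else 0 := by
      rw [Finset.sum_comm]
      refine Finset.sum_congr rfl fun l _ => ?_
      rw [Finset.sum_filter]
    rw [e1]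
    refine le_trans (Finset.sum_le_sum fun T hT => ?_)
      (Finset.sum_le_sum_of_subset_of_nonneg (Finset.filter_subset _ _) fun T _ _ =>
        Finset.sum_nonneg fun l _ => by split_ifs; exacts [hm0 T, le_rfl])
    have hT2 := (Finset.mem_filter.1 hT).2
    push Not at hT2
    obtain ⟨e, heD, he⟩ := hT2
    have h0 : q T 0 := by
      simp only [hq]
      rw [pow_zero, one_mul]
      refine (Nat.cast_le.2 (lineCount_le_card S 0 P pos _)).trans ?_
      rw [h.card_eq]
      refine scalePow_mono h.one_le ?_
      push_cast
      linarith
    obtain ⟨l, _, hl2, hl3, hl4⟩ := exists_step_of_not (p := q T) (Nat.zero_le e) h0 he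
    refine le_trans (le_of_eq ?_) (Finset.single_le_sum
      (f := fun l => if q T l ∧ ¬ q T (l + 1) then m T else 0)
      (fun l _ => by split_ifs; exacts [hm0 T, le_rfl])
      (Finset.mem_range.2 (hl2.trans_le heD)))
    rw [if_pos ⟨hl3, hl4⟩]
  have hCl2 : ∀ l ∈ Finset.range D, ∑ T ∈ Cl l, m T ≤ scalePow S (κ + μ 0 - 3) := by
    intro l hl
    refine (h.sum_multiplicity_rich_le (Finset.mem_range.1 hl) (v := 2 * w + 9) (Cl l)
      (fun T hT => ?_) (fun T hT => (Finset.mem_filter.1 hT).2.1) (fun T hT => ?_)).trans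
      (scalePow_mono h.one_le (by linarith))
    · obtain ⟨p, hp, hTp⟩ := Finset.mem_biUnion.1 (Finset.mem_filter.1 hT).1
      exact ⟨p, hp, hTp⟩
    · have := (Finset.mem_filter.1 hT).2.2
      simp only [hq, not_le] at this
      push_cast at this
      exact this
  have hbad2 : ∑ T ∈ U.filter (fun T => ¬ ∀ e ≤ D, q T e), m T ≤ scalePow S (κ + μ 0 - 2) := by
    refine hbad.trans ((Finset.sum_le_sum hCl2).trans ?_)
    rw [Finset.sum_const, nsmul_eq_mul, Finset.card_range]
    refine mul_scalePow_le h.one_le ?_ (by linarith)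
    have hk := h.const_mul_le (C := 1) (by norm_num)
    have h1 : (1 : ℝ) ≤ (K : ℝ) + 2 := by linarith [Nat.cast_nonneg (α := ℝ) K]
    have h2 : (K : ℝ) + 2 ≤ ((K : ℝ) + 2) ^ 3 := le_self_pow₀ h1 (by norm_num)
    have h3 : (D : ℝ) ≤ K := by exact_mod_cast h.D_le
    push_cast at hk
    linarith
  have h5 : 2 * scalePow S (κ + μ 0 - 1) ≤ scalePow S (κ + μ 0) :=
    mul_scalePow_le h.one_le (by exact_mod_cast h.two_le) (by linarith)
  have h6 : scalePow S (κ + μ 0 - 2) ≤ scalePow S (κ + μ 0 - 1) :=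
    scalePow_mono h.one_le (by linarith)
  linarith

open Classical in
/-- **Incidence bound for uniform configurations.** -/
theorem card_tubes_ge :
    scalePow S (κ + μ 0 - (3 * w + 27)) ≤ ((P.biUnion Tp).card : ℝ) ∨
    scalePow S (κ / 2 + 3 / 2 * μ 0 - (3 * w + 27)) ≤ ((P.biUnion Tp).card : ℝ) ∨
    scalePow S (K + μ 0 - (3 * w + 27)) ≤ ((P.biUnion Tp).card : ℝ) := by
  have hw := h.w_nonneg
  set U := P.biUnion Tp with hU
  set out : ℕ → ℕ → Prop := fun r i => (K : ℝ) - r + 2 * w + μ 0 < γ i + μ (r - i) with hout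
  -- `A t r`: points and lines are out of balance at some scale between `r - t` and `r`.
  set A : ℕ → ℕ → Prop := fun t r => ∃ i ≤ r, r ≤ i + t ∧ out r i with hAdef
  have hsub : ∀ C ⊆ U, (C.card : ℝ) ≤ U.card := fun C hC =>
    Nat.cast_le.2 (Finset.card_le_card hC)
  have hlow : ∀ {C : Finset τ} {x y : ℝ}, C ⊆ U →
      scalePow S x ≤ (∑ T ∈ C, (multiplicity P Tp T : ℝ)) →
      (∑ T ∈ C, (multiplicity P Tp T : ℝ)) ^ 2 ≤ C.card * scalePow S y →
      scalePow S (2 * x - y) ≤ U.card := by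
    intro C x y hCU h1 h2
    rw [scalePow_sub h.one_le, div_le_iff₀ (scalePow_pos h.one_le _)]
    have e : scalePow S (2 * x) = scalePow S x ^ 2 := by
      rw [sq, ← scalePow_add h.one_le]; congr 1; ring
    rw [e]
    refine (pow_le_pow_left₀ (scalePow_pos h.one_le _).le h1 2).trans (h2.trans ?_)
    exact mul_le_mul_of_nonneg_right (hsub C hCU) (scalePow_pos h.one_le _).le
  -- If everything is in balance at the finest scale, there are few pairs of points on a common
  -- tube, and the first bound follows from the Cauchy–Schwarz inequality.
  by_cases hAK : A K K
  swap
  · left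
    have hOK : ∀ i ≤ K, γ i + μ (K - i) ≤ (K : ℝ) - K + 2 * w + μ 0 := by
      intro i hi
      by_contra hcon
      exact hAK ⟨i, hi, by omega, not_le.1 hcon⟩
    have h1 := h.sq_sum_multiplicity_le le_rfl U (fun g => (localPoints S K P Tp par g).card)
      (fun g => Nat.cast_nonneg _) (by
        intro T _
        refine Nat.cast_le.2 (Finset.card_le_card fun p hp => ?_)
        obtain ⟨hpP, hT⟩ := Finset.mem_filter.1 hp
        exact Finset.mem_filter.2 ⟨hpP, T, hT, rfl⟩)
    have h2 := h.sum_sq_card_localPoints_le le_rfl hOK (U.image fun T => cell S K (par T))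
    simp only [← sq] at h1
    have h3 := h.le_sum_multiplicity (C := U) fun p hp => Finset.subset_biUnion_of_mem Tp hp
    refine le_trans (scalePow_mono h.one_le ?_) (hlow (y := κ + μ 0 + 2 * w + 7) le_rfl h3
      (h1.trans (mul_le_mul_of_nonneg_left ?_ (Nat.cast_nonneg _))))
    · linarith
    · refine (mul_le_mul_of_nonneg_left h2 (scalePow_pos h.one_le _).le).trans
        (scalePow_mul_le h.one_le (by linarith))
  obtain ⟨C, hCU, hCsum, hCpoor⟩ := h.le_sum_multiplicity_poor
  choose ρ hρmono hρ using fun T => h.exists_critical T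
  -- The label of a tube: a transition scale `t` with its critical scale, or `(K, K)` if the critical
  -- scale for `t = 0` is smaller than `D`.
  have hlabel : ∀ T, ∃ x ∈ Finset.range (K + 1) ×ˢ Finset.range (K + 1),
      (x = (K, K) ∧ ρ T 0 < D) ∨ (x.1 < K ∧ ρ T x.1 = x.2 ∧ x.1 ≤ x.2 ∧ ¬ A x.1 x.2 ∧
        ∃ r', x.2 ≤ r' ∧ r' ≤ K ∧ A (x.1 + 1) r') := by
    intro T
    by_cases h0 : A 0 (ρ T 0)
    · refine ⟨(K, K), by simp, Or.inl ⟨rfl, ?_⟩⟩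
      obtain ⟨i, hi1, hi2, hi3⟩ := h0
      have hi : i = ρ T 0 := by omega
      by_contra hcon
      exact absurd (h.gamma_add_mu_le (by omega) hi1 (hρ T 0 (Nat.zero_le _)).2.1) (not_le.2 hi3)
    · have hKK : ¬ ¬ A K (ρ T K) := by
        have : ρ T K = K := le_antisymm (hρ T K le_rfl).2.1 (hρ T K le_rfl).1
        rw [this, not_not]
        exact hAK
      obtain ⟨t, _, h2, h3, h4⟩ := exists_step_of_not (p := fun t => ¬ A t (ρ T t))
        (Nat.zero_le K) h0 hKK
      have h5 := hρ T t h2.le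
      refine ⟨(t, ρ T t), ?_, Or.inr ⟨h2, rfl, h5.1, h3, ρ T (t + 1), hρmono T t h2,
        (hρ T (t + 1) h2).2.1, not_not.1 h4⟩⟩
      rw [Finset.mem_product, Finset.mem_range, Finset.mem_range]
      exact ⟨by omega, by have := h5.2.1; omega⟩
  choose f hfL hf using hlabel
  obtain ⟨x, hxL, hx⟩ : ∃ x ∈ Finset.range (K + 1) ×ˢ Finset.range (K + 1),
      scalePow S (κ + μ 0 - 2)
        ≤ ∑ T ∈ C.filter (fun T => f T = x), (multiplicity P Tp T : ℝ) := by
    by_contra hcon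
    push Not at hcon
    have h1 : ∑ T ∈ C, (multiplicity P Tp T : ℝ)
        ≤ ((K : ℝ) + 1) ^ 2 * scalePow S (κ + μ 0 - 2) := by
      rw [← Finset.sum_fiberwise_of_maps_to (fun T _ => hfL T)]
      refine (Finset.sum_le_card_nsmul _ _ _ fun x hx => (hcon x hx).le).trans (le_of_eq ?_)
      rw [Finset.card_product, Finset.card_range, nsmul_eq_mul]
      push_cast
      ring
    have h2 : 2 * ((K : ℝ) + 1) ^ 2 * scalePow S (κ + μ 0 - 2) ≤ scalePow S (κ + μ 0 - 1) := by
      refine mul_scalePow_le h.one_le ?_ (by linarith)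
      have hk := h.const_mul_le (C := 2) (by norm_num)
      push_cast at hk
      have h0 : (0 : ℝ) ≤ K := Nat.cast_nonneg K
      nlinarith [mul_nonneg h0 h0, mul_nonneg (mul_nonneg h0 h0) h0]
    have h3 : 0 < ((K : ℝ) + 1) ^ 2 * scalePow S (κ + μ 0 - 2) :=
      mul_pos (by positivity) (scalePow_pos h.one_le _)
    linarith
  set C' := C.filter fun T => f T = x with hC'
  have hC'U : C' ⊆ U := (Finset.filter_subset _ _).trans hCU
  have hrich : ∀ T ∈ C', ∀ e ≤ D,
      (lineCount S e P pos (cell S e (par T)) : ℝ) ≤ scalePow S (2 * w + 10 - e + κ) := by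
    intro T hT e he
    refine (hCpoor T (Finset.mem_filter.1 hT).1 e he).trans (mul_scalePow_le h.one_le ?_ ?_)
    · exact (pow_le_pow_right₀ (by norm_num) (he.trans h.D_le)).trans h.const_pow_le
    · linarith
  -- A transition scale gives the second bound, and a critical scale smaller than `D` the third.
  by_cases hxK : x.1 < K
  · right; left
    have hne : C'.Nonempty := by
      by_contra hcon
      rw [Finset.not_nonempty_iff_eq_empty] at hcon
      rw [hcon, Finset.sum_empty] at hx
      exact absurd hx (not_le.2 (scalePow_pos h.one_le _))
    have hfx : ∀ T ∈ C', ρ T x.1 = x.2 ∧ x.1 ≤ x.2 ∧ ¬ A x.1 x.2 ∧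
        ∃ r', x.2 ≤ r' ∧ r' ≤ K ∧ A (x.1 + 1) r' := by
      intro T hT
      have hTx := (Finset.mem_filter.1 hT).2
      have := hf T
      rw [hTx] at this
      rcases this with ⟨h1, _⟩ | ⟨_, h2⟩
      · rw [h1] at hxK; exact absurd hxK (lt_irrefl _)
      · exact h2
    obtain ⟨T₀, hT₀⟩ := hne
    obtain ⟨_, htr, hnA, r', hrr, hr, hA⟩ := hfx T₀ hT₀
    have hmain := h.sq_sum_multiplicity_le_of_transition htr hrr hr hxK hA (fun i h1 h2 => by
      by_contra hcon
      exact hnA ⟨i, h2, by omega, not_le.1 hcon⟩) C' hrich (fun T hT => by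
        have := (hρ T x.1 hxK.le).2.2.1
        rwa [(hfx T hT).1] at this) (fun T hT => by
        have := (hρ T x.1 hxK.le).2.2.2
        rwa [(hfx T hT).1] at this)
    exact le_trans (scalePow_mono h.one_le (by linarith)) (hlow hC'U hx hmain)
  · right; right
    have hm : ∀ T ∈ C', (multiplicity P Tp T : ℝ) ≤ scalePow S (2 * w + 10 + κ - K) := by
      intro T hT
      obtain ⟨hTC, hTx⟩ := Finset.mem_filter.1 hT
      have hr0 : ρ T 0 < D := by
        rcases hf T with ⟨_, h1⟩ | ⟨h1, _⟩
        · exact h1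
        · rw [hTx] at h1; exact absurd h1 hxK
      obtain ⟨_, h2, h3, _⟩ := hρ T 0 (Nat.zero_le K)
      set r := ρ T 0 with hr
      have h4 : localCount S 0 r P Tp pos par (cell S r (par T))
          ≤ lineCount S r P pos (cell S r (par T)) :=
        lineCount_mono _ _ (Finset.filter_subset _ _) _ _
      have h5 := hCpoor T hTC r hr0.le
      have h6 : (multiplicity P Tp T : ℝ) * (S : ℝ) ^ (K - r)
          ≤ 16 ^ K * scalePow S (2 * w + 9 - r + κ) := by
        calc (multiplicity P Tp T : ℝ) * (S : ℝ) ^ (K - r)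
            ≤ 16 ^ (K - r) * (localCount S 0 r P Tp pos par (cell S r (par T)) : ℝ) := by
              exact_mod_cast h3
          _ ≤ 16 ^ (K - r) * (16 ^ r * scalePow S (2 * w + 9 - r + κ)) := by
              refine mul_le_mul_of_nonneg_left (le_trans ?_ h5) (by positivity)
              exact_mod_cast h4
          _ = 16 ^ (K - r + r) * scalePow S (2 * w + 9 - r + κ) := by rw [pow_add]; ring
          _ = _ := by rw [Nat.sub_add_cancel h2]
      have e : (S : ℝ) ^ (K - r) = scalePow S ((K : ℝ) - r) := by
        rw [← Nat.cast_sub h2, scalePow_natCast]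
      rw [e] at h6
      have h7 := h6.trans (mul_scalePow_le h.one_le h.const_pow_le
        (y := 2 * w + 10 - r + κ) (by linarith))
      have e2 : 2 * w + 10 + κ - K = (2 * w + 10 - r + κ) - ((K : ℝ) - r) := by ring
      rw [e2, scalePow_sub h.one_le, le_div_iff₀ (scalePow_pos h.one_le _)]
      exact h7
    have h8 : scalePow S (κ + μ 0 - 2) ≤ U.card * scalePow S (2 * w + 10 + κ - K) := by
      refine hx.trans ((Finset.sum_le_card_nsmul _ _ _ hm).trans ?_)
      rw [nsmul_eq_mul]
      exact mul_le_mul_of_nonneg_right (hsub C' hC'U) (scalePow_pos h.one_le _).le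
    rw [← div_le_iff₀ (scalePow_pos h.one_le _), ← scalePow_sub h.one_le] at h8
    exact le_trans (scalePow_mono h.one_le (by linarith)) h8

end Critical

end UniformConfiguration

/-! ### Reduction to uniform configurations -/

lemma exists_popular {α β : Type*} [DecidableEq β] {A : Finset α} {B : Finset β}
    (f : α → β) (hf : ∀ a ∈ A, f a ∈ B) (hB : B.Nonempty) :
    ∃ b ∈ B, A.card ≤ B.card * (A.filter fun a => f a = b).card := by
  obtain ⟨b, hb, hmax⟩ := Finset.exists_max_image B (fun b => (A.filter fun a => f a = b).card) hB
  refine ⟨b, hb, ?_⟩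
  rw [Finset.card_eq_sum_card_fiberwise hf, ← smul_eq_mul]
  exact Finset.sum_le_card_nsmul _ _ _ hmax

lemma card_filter_le_card_filter {α : Type*} {A B : Finset α} (q : α → Prop) [DecidablePred q]
    (h : A ⊆ B) :
    ((A.filter q).card : ℝ) ≤ (B.filter q).card :=
  Nat.cast_le.2 (Finset.card_le_card (Finset.filter_subset_filter q h))

/-- Every finite set with a tree structure of bounded depth has a large subset that is uniform: the
number of descendants of a node depends, up to a factor `S`, on the level only. The subset is found
by pigeonholing from the finest to the coarsest level; restricting to whole subtrees does not
affect the numbers of descendants at the finer levels. -/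
lemma exists_uniform_subset {α β : Type*} [DecidableEq β] (f : ℕ → α → β)
    (hf : ∀ m n x y, m ≤ n → f n x = f n y → f m x = f m y) {S L K : ℕ} (hS : 2 ≤ S)
    (X : Finset α) (hL : X.card < S ^ (L + 1)) :
    ∃ X' ⊆ X, ∃ b : ℕ → ℕ, X.card ≤ (L + 1) ^ (K + 1) * X'.card ∧ ∀ n ≤ K, b n ≤ L ∧
      ∀ x ∈ X', S ^ b n ≤ (X'.filter fun y => f n y = f n x).card ∧
        (X'.filter fun y => f n y = f n x).card < S ^ (b n + 1) := by
  have main : ∀ j ≤ K + 1, ∃ X' ⊆ X, ∃ b : ℕ → ℕ, X.card ≤ (L + 1) ^ j * X'.card ∧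
      ∀ n ≤ K, K + 1 ≤ n + j → b n ≤ L ∧
      ∀ x ∈ X', S ^ b n ≤ (X'.filter fun y => f n y = f n x).card ∧
        (X'.filter fun y => f n y = f n x).card < S ^ (b n + 1) := by
    intro j
    induction j with
    | zero =>
      intro _
      exact ⟨X, subset_rfl, fun _ => 0, by simp, fun n h1 h2 => by omega⟩
    | succ j ih =>
      intro hj
      obtain ⟨Y, hYX, b, hcard, hb⟩ := ih (by omega)
      set m := K - j with hm
      set v : α → ℕ := fun x => Nat.log S (Y.filter fun y => f m y = f m x).card with hv
      have hvL : ∀ x ∈ Y, v x ∈ Finset.range (L + 1) := by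
        intro x hx
        rw [Finset.mem_range]
        refine Nat.log_lt_of_lt_pow ?_ ?_
        · have hpos : 0 < (Y.filter fun y => f m y = f m x).card :=
            Finset.card_pos.2 ⟨x, Finset.mem_filter.2 ⟨hx, rfl⟩⟩
          exact hpos.ne'
        · exact ((Finset.card_le_card (Finset.filter_subset _ _)).trans
            (Finset.card_le_card hYX)).trans_lt hL
      obtain ⟨c, hc, hpop⟩ := exists_popular v hvL ⟨0, by simp⟩
      rw [Finset.card_range] at hpop
      have hclass : ∀ n, m ≤ n → ∀ x ∈ Y.filter (fun y => v y = c),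
          (Y.filter fun y => v y = c).filter (fun y => f n y = f n x)
            = Y.filter fun y => f n y = f n x := by
        intro n hn x hx
        ext y
        simp only [Finset.mem_filter]
        constructor
        · rintro ⟨⟨h1, _⟩, h2⟩; exact ⟨h1, h2⟩
        · rintro ⟨h1, h2⟩
          refine ⟨⟨h1, ?_⟩, h2⟩
          rw [← (Finset.mem_filter.1 hx).2]
          simp only [hv, hf m n y x hn h2]
      refine ⟨Y.filter (fun y => v y = c), (Finset.filter_subset _ _).trans hYX,
        Function.update b m c, ?_, fun n hn hnj => ?_⟩
      · calc X.card ≤ (L + 1) ^ j * Y.card := hcard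
          _ ≤ (L + 1) ^ j * ((L + 1) * (Y.filter fun a => v a = c).card) :=
            Nat.mul_le_mul_left _ hpop
          _ = _ := by rw [pow_succ, mul_assoc]
      · by_cases hnm : n = m
        · subst hnm
          rw [Function.update_self]
          refine ⟨Nat.lt_succ_iff.1 (Finset.mem_range.1 hc), fun x hx => ?_⟩
          rw [hclass m le_rfl x hx]
          obtain ⟨hx1, hx2⟩ := Finset.mem_filter.1 hx
          have hpos : 0 < (Y.filter fun y => f m y = f m x).card :=
            Finset.card_pos.2 ⟨x, Finset.mem_filter.2 ⟨hx1, rfl⟩⟩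
          rw [← hx2]
          exact ⟨Nat.pow_log_le_self S hpos.ne', Nat.lt_pow_succ_log_self (by omega) _⟩
        · rw [Function.update_of_ne hnm]
          obtain ⟨h1, h2⟩ := hb n hn (by omega)
          refine ⟨h1, fun x hx => ?_⟩
          rw [hclass n (by omega) x hx]
          exact h2 x (Finset.mem_filter.1 hx).1
  obtain ⟨X', h1, b, h2, h3⟩ := main (K + 1) le_rfl
  exact ⟨X', h1, b, h2, fun n hn => h3 n hn (by omega)⟩

open Classical in
/-- The hypotheses of the incidence bound at the scales `1, S⁻¹, …, S⁻ᴷ`, for points `pos p` and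
lines with slope and intercept `par T`, before any uniformization. The base `S` is so large that it
absorbs the constants and the losses in the pigeonholing over branching numbers. -/
structure SpreadConfiguration {ι τ : Type*} (S K D : ℕ) (s M : ℝ)
    (P : Finset ι) (Tp : ι → Finset τ) (pos : ι → ℝ × ℝ) (par : τ → ℝ × ℝ) : Prop where
  large : 10 ^ 12 * (K + 2) ^ 3 * 16 ^ K ≤ S
  large' : (2 * K + 5) ^ (2 * K + 2) ≤ S
  s_le_one : s ≤ 1
  D_le : D ≤ K
  M_pos : 0 < M
  nonempty : P.Nonempty
  pos_mem : ∀ p ∈ P, (0 ≤ (pos p).1 ∧ (pos p).1 < 1) ∧ (0 ≤ (pos p).2 ∧ (pos p).2 < 1)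
  slope_le : ∀ p ∈ P, ∀ T ∈ Tp p, |(par T).1| ≤ 1
  incident : ∀ p ∈ P, ∀ T ∈ Tp p,
    |(pos p).2 - (par T).1 * (pos p).1 - (par T).2| * (S : ℝ) ^ K ≤ 4
  card_tubes : ∀ p ∈ P, M ≤ S * (Tp p).card
  tubes_dim : ∀ p ∈ P, ∀ n ≤ K, ∀ g,
    (((Tp p).filter fun T => cell S n (par T) = g).card : ℝ) ≤ scalePow S (1 - s * n) * M
  tubes_triv : ∀ p ∈ P, ∀ n ≤ K, ∀ g,
    (((Tp p).filter fun T => cell S n (par T) = g).card : ℝ) ≤ scalePow S (1 + (K - n))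
  points_coarse : ∀ n ≤ D, ∀ g,
    ((P.filter fun p => cell S n (pos p) = g).card : ℝ) ≤ scalePow S (4 - n * (2 - s)) * P.card
  points_fine : ∀ n ≤ K, D ≤ n → ∀ g,
    ((P.filter fun p => cell S n (pos p) = g).card : ℝ) ≤ scalePow S (4 + (K - n) * s)

namespace SpreadConfiguration

variable {ι τ : Type*} {S K D : ℕ} {s M : ℝ}
    {P : Finset ι} {Tp : ι → Finset τ} {pos : ι → ℝ × ℝ} {par : τ → ℝ × ℝ}

variable (h : SpreadConfiguration S K D s M P Tp pos par)

include h

lemma const_le : (42 : ℝ) ≤ S := by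
  have h1 : 10 ^ 12 * (1 * 1) ≤ 10 ^ 12 * ((K + 2) ^ 3 * 16 ^ K) := by
    gcongr <;> exact Nat.one_le_pow _ _ (by omega)
  have := h.large
  rw [mul_assoc] at this
  exact_mod_cast (by omega : 42 ≤ S)

lemma two_le : 2 ≤ S := by
  have := h.const_le
  have : (2 : ℝ) ≤ S := by linarith
  exact_mod_cast this

lemma one_le : 1 ≤ S := by have := h.two_le; omega

/-- All lines through a point have their parameters in few unit squares. -/
lemma cell_zero_mem {p : ι} (hp : p ∈ P) {T : τ} (hT : T ∈ Tp p) :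
    cell S 0 (par T) ∈ Finset.Icc (-1 : ℤ) 1 ×ˢ Finset.Icc (-7 : ℤ) 6 := by
  have hx := (h.pos_mem p hp).1
  have hy := (h.pos_mem p hp).2
  have ha := abs_le.1 (h.slope_le p hp T hT)
  have hSK : (1 : ℝ) ≤ (S : ℝ) ^ K := one_le_pow₀ (by exact_mod_cast h.one_le)
  have hi : |(pos p).2 - (par T).1 * (pos p).1 - (par T).2| ≤ 4 :=
    (le_mul_of_one_le_right (abs_nonneg _) hSK).trans (h.incident p hp T hT)
  rw [abs_le] at hi
  simp only [cell, pow_zero, mul_one, Finset.mem_product, Finset.mem_Icc]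
  refine ⟨⟨?_, ?_⟩, ?_, ?_⟩
  · rw [Int.le_floor]; push_cast; linarith
  · have := Int.floor_le (par T).1
    have h2 : (⌊(par T).1⌋ : ℝ) ≤ 1 := by linarith
    exact_mod_cast h2
  · rw [Int.le_floor]; push_cast; nlinarith
  · have := Int.floor_le (par T).2
    have h2 : (⌊(par T).2⌋ : ℝ) ≤ 6 := by nlinarith
    exact_mod_cast h2

lemma card_le_of_cell_zero {p : ι} (hp : p ∈ P) {A : Finset τ} (hA : A ⊆ Tp p) {C : ℝ}
    (hC0 : 0 ≤ C)
    (hC : ∀ T ∈ A, ((A.filter fun T' => cell S 0 (par T') = cell S 0 (par T)).card : ℝ) ≤ C) :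
    (A.card : ℝ) ≤ 42 * C := by
  have h1 := card_le_card_mul_of_fiber (A := A)
    (B := Finset.Icc (-1 : ℤ) 1 ×ˢ Finset.Icc (-7 : ℤ) 6) (fun T => cell S 0 (par T)) (C := C)
    (fun T hT => h.cell_zero_mem hp (hA hT)) (fun g _ => by
      rcases (A.filter fun T => cell S 0 (par T) = g).eq_empty_or_nonempty with h0 | ⟨T, hT⟩
      · rw [h0, Finset.card_empty, Nat.cast_zero]; exact hC0
      · rw [Finset.mem_filter] at hT
        rw [← hT.2]
        exact hC T hT.1)
  refine h1.trans (le_of_eq ?_)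
  have e : (Finset.Icc (-1 : ℤ) 1 ×ˢ Finset.Icc (-7 : ℤ) 6).card = 42 := by
    rw [Finset.card_product, Int.card_Icc, Int.card_Icc]
    rfl
  rw [e]
  norm_num

lemma card_tubes_lt {p : ι} (hp : p ∈ P) : (Tp p).card < S ^ (2 * K + 4 + 1) := by
  classical
  have h1 := h.card_le_of_cell_zero hp subset_rfl (scalePow_pos h.one_le _).le
    (fun T _ => h.tubes_triv p hp 0 (Nat.zero_le _) _)
  have h2 := h1.trans (mul_scalePow_le h.one_le h.const_le (y := (K : ℝ) + 2)
    (by push_cast; linarith))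
  have h3 : scalePow S ((K : ℝ) + 2) = (S : ℝ) ^ (K + 2) := by
    have := scalePow_natCast (S := S) (K + 2); push_cast at this; exact this
  rw [h3] at h2
  have h4 : (Tp p).card ≤ S ^ (K + 2) := by exact_mod_cast h2
  exact h4.trans_lt (Nat.pow_lt_pow_right h.two_le (by omega))

lemma card_points_lt : P.card < S ^ (2 * K + 4 + 1) := by
  classical
  have hS := h.one_le
  have hpos : (0 : ℝ) < (S : ℝ) ^ K := pow_pos (by exact_mod_cast hS) K
  have h1 := card_le_card_mul_of_fiber (A := P)
    (B := Finset.Ico (0 : ℤ) (S ^ K : ℕ) ×ˢ Finset.Ico (0 : ℤ) (S ^ K : ℕ))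
    (fun p => cell S K (pos p)) (C := scalePow S 4) (fun p hp => ?_) (fun g _ => ?_)
  · have h3 : scalePow S 4 = (S : ℝ) ^ 4 := by
      have := scalePow_natCast (S := S) 4; push_cast at this; exact this
    rw [Finset.card_product, Int.card_Ico, h3, sub_zero, Int.toNat_natCast] at h1
    have h4 : P.card ≤ S ^ K * S ^ K * S ^ 4 := by exact_mod_cast h1
    have h5 : S ^ K * S ^ K * S ^ 4 = S ^ (2 * K + 4) := by ring
    rw [h5] at h4
    exact h4.trans_lt (Nat.pow_lt_pow_right h.two_le (by omega))
  · obtain ⟨⟨x0, x1⟩, y0, y1⟩ := h.pos_mem p hp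
    simp only [cell, Finset.mem_product, Finset.mem_Ico]
    refine ⟨⟨Int.floor_nonneg.2 (by positivity), ?_⟩, Int.floor_nonneg.2 (by positivity), ?_⟩
    · rw [Int.floor_lt]; push_cast; nlinarith
    · rw [Int.floor_lt]; push_cast; nlinarith
  · have := h.points_fine K le_rfl h.D_le g
    simpa using this

open Classical in
/-- **Incidence bound for spread configurations.** -/
theorem min_le_card_tubes :
    min (M * P.card) (min (M ^ ((3 : ℝ) / 2) * (P.card : ℝ) ^ ((1 : ℝ) / 2)) ((S : ℝ) ^ K * M))
      ≤ scalePow S 49 * ((P.biUnion Tp).card : ℝ) := by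
  have hS := h.one_le
  have hS2 := h.two_le
  have hS0 : (0 : ℝ) < S := by exact_mod_cast hS
  set L := 2 * K + 4 with hL
  have huni : ∀ p, ∃ X' ⊆ Tp p, ∃ b : ℕ → ℕ, p ∈ P →
      (Tp p).card ≤ (L + 1) ^ (K + 1) * X'.card ∧ ∀ n ≤ K, b n ≤ L ∧
      ∀ x ∈ X', S ^ b n ≤ (X'.filter fun y => cell S n (par y) = cell S n (par x)).card ∧
        (X'.filter fun y => cell S n (par y) = cell S n (par x)).card < S ^ (b n + 1) := by
    intro p
    by_cases hp : p ∈ P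
    · obtain ⟨X', h1, b, h2, h3⟩ := exists_uniform_subset (K := K) (fun n T => cell S n (par T))
        (fun _ _ _ _ hmn hxy => cell_eq_of_le hS hmn hxy) hS2 (Tp p) (h.card_tubes_lt hp)
      exact ⟨X', h1, b, fun _ => ⟨h2, h3⟩⟩
    · exact ⟨∅, Finset.empty_subset _, fun _ => 0, fun hp' => absurd hp' hp⟩
  choose Tp' hTsub b hb using huni
  -- The branching numbers of the uniform subfamilies can be assumed to be the same.
  obtain ⟨c, _, hpop⟩ := exists_popular (A := P)
    (B := (Finset.univ : Finset (Fin (K + 1) → Fin (L + 1))))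
    (fun p i => Fin.ofNat (L + 1) (b p i)) (fun _ _ => Finset.mem_univ _) Finset.univ_nonempty
  set P₁ := P.filter fun p => (fun i : Fin (K + 1) => Fin.ofNat (L + 1) (b p i)) = c with hP₁
  rw [Finset.card_univ, Fintype.card_fun, Fintype.card_fin, Fintype.card_fin] at hpop
  have hP₁P : P₁ ⊆ P := Finset.filter_subset _ _
  obtain ⟨P₂, hP₂, γ, hcard₂, hγ⟩ := exists_uniform_subset (K := K) (L := L)
    (fun n p => cell S n (pos p)) (fun _ _ _ _ hmn hxy => cell_eq_of_le hS hmn hxy) hS2 P₁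
    ((Finset.card_le_card hP₁P).trans_lt h.card_points_lt)
  have hPP : P₂ ⊆ P := hP₂.trans hP₁P
  have hlog : (L + 1) ^ (K + 1) * (L + 1) ^ (K + 1) ≤ S := by
    have := h.large'
    calc _ = (2 * K + 5) ^ (2 * K + 2) := by rw [← pow_add, hL]; congr 1; ring
      _ ≤ S := this
  have hcardP : P.card ≤ S * P₂.card := by
    calc P.card ≤ (L + 1) ^ (K + 1) * P₁.card := hpop
      _ ≤ (L + 1) ^ (K + 1) * ((L + 1) ^ (K + 1) * P₂.card) := Nat.mul_le_mul_left _ hcard₂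
      _ = (L + 1) ^ (K + 1) * (L + 1) ^ (K + 1) * P₂.card := by ring
      _ ≤ S * P₂.card := Nat.mul_le_mul_right _ hlog
  have hP₂ne : P₂.Nonempty := by
    rw [← Finset.card_pos]
    have := h.nonempty.card_pos
    by_contra hcon
    have h0 : P₂.card = 0 := by omega
    rw [h0] at hcardP
    omega
  obtain ⟨p₀, hp₀⟩ := hP₂ne
  set μ : ℕ → ℕ := b p₀ with hμ
  have hbμ : ∀ p ∈ P₂, ∀ n ≤ K, b p n = μ n := by
    intro p hp n hn
    have e1 := (Finset.mem_filter.1 (hP₂ hp)).2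
    have e2 := (Finset.mem_filter.1 (hP₂ hp₀)).2
    have e3 := congrFun (e1.trans e2.symm) ⟨n, by omega⟩
    have e4 := congrArg Fin.val e3
    simp only [Fin.ofNat] at e4
    have l1 := ((hb p (hPP hp)).2 n hn).1
    have l2 := ((hb p₀ (hPP hp₀)).2 n hn).1
    rwa [Nat.mod_eq_of_lt (by omega), Nat.mod_eq_of_lt (by omega)] at e4
  have hcast : ∀ n : ℕ, ((S ^ n : ℕ) : ℝ) = scalePow S n := fun n => by
    rw [scalePow_natCast]; push_cast; rfl
  have hT : ∀ p ∈ P₂, ∀ n ≤ K, ∀ T ∈ Tp' p,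
      scalePow S (μ n)
        ≤ (((Tp' p).filter fun T' => cell S n (par T') = cell S n (par T)).card : ℝ) ∧
      (((Tp' p).filter fun T' => cell S n (par T') = cell S n (par T)).card : ℝ)
        ≤ scalePow S (μ n + 1) := by
    intro p hp n hn T hT
    obtain ⟨h1, h2⟩ := ((hb p (hPP hp)).2 n hn).2 T hT
    rw [hbμ p hp n hn] at h1 h2
    have e := hcast (μ n + 1)
    push_cast at e
    refine ⟨?_, ?_⟩
    · rw [← hcast]; exact_mod_cast h1
    · rw [← e]; exact_mod_cast h2.le
  have hMT : ∀ p ∈ P₂, 0 < (Tp' p).card ∧ M ≤ scalePow S ((μ 0 : ℝ) + 4) := by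
    intro p hp
    have h1 := h.card_tubes p (hPP hp)
    have h2 := (hb p (hPP hp)).1
    have h3 : (Tp p).card ≤ S * (Tp' p).card := h2.trans (Nat.mul_le_mul_right _
      ((Nat.le_mul_of_pos_right _ (by positivity)).trans hlog))
    have h3' : ((Tp p).card : ℝ) ≤ S * (Tp' p).card := by exact_mod_cast h3
    have h4 : M ≤ S * (S * (Tp' p).card) :=
      h1.trans (mul_le_mul_of_nonneg_left h3' hS0.le)
    refine ⟨?_, ?_⟩
    · by_contra hcon
      have h0 : (Tp' p).card = 0 := by omega
      rw [h0] at h4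
      simp at h4
      exact absurd h4 (not_le.2 h.M_pos)
    · have h5 := h.card_le_of_cell_zero (hPP hp) (hTsub p) (scalePow_pos hS _).le
        (fun T hTT => (hT p hp 0 (Nat.zero_le _) T hTT).2)
      have h6 := h5.trans (mul_scalePow_le hS h.const_le (y := (μ 0 : ℝ) + 2) (by linarith))
      calc M ≤ S * (S * (Tp' p).card) := h4
        _ ≤ S * (S * scalePow S ((μ 0 : ℝ) + 2)) := by gcongr
        _ = scalePow S ((μ 0 : ℝ) + 4) := by
            conv_lhs => rw [← scalePow_one (S := S)]
            rw [← scalePow_add hS, ← scalePow_add hS]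
            congr 1
            ring
  have hκ : (P₂.card : ℝ) = scalePow S (Real.logb S P₂.card) := by
    unfold scalePow
    rw [Real.rpow_logb hS0 (by exact_mod_cast (by omega : S ≠ 1))]
    exact_mod_cast Finset.card_pos.2 ⟨p₀, hp₀⟩
  set κ := Real.logb S P₂.card with hκdef
  have hPκ : (P.card : ℝ) ≤ scalePow S (κ + 1) := by
    rw [scalePow_add hS, scalePow_one, ← hκ, mul_comm]
    exact_mod_cast hcardP
  have h_tubes_dim : ∀ n ≤ K, (μ n : ℝ) + s * n ≤ (μ 0 : ℝ) + 5 := by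
    intro n hn
    obtain ⟨T, hTm⟩ := Finset.card_pos.1 (hMT p₀ hp₀).1
    refine le_of_scalePow_le hS2 ?_
    have h1 := (hT p₀ hp₀ n hn T hTm).1.trans ((card_filter_le_card_filter _ (hTsub p₀)).trans
      (h.tubes_dim p₀ (hPP hp₀) n hn _))
    rw [scalePow_add hS]
    calc scalePow S (μ n) * scalePow S (s * n)
        ≤ (scalePow S (1 - s * n) * scalePow S ((μ 0 : ℝ) + 4)) * scalePow S (s * n) := by
          refine mul_le_mul_of_nonneg_right (h1.trans ?_) (scalePow_pos hS _).le
          exact mul_le_mul_of_nonneg_left (hMT p₀ hp₀).2 (scalePow_pos hS _).le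
      _ = scalePow S ((μ 0 : ℝ) + 5) := by
          rw [← scalePow_add hS, ← scalePow_add hS]; congr 1; ring
  have h_tubes_triv : ∀ n ≤ K, (μ n : ℝ) ≤ (K : ℝ) - n + 2 := by
    intro n hn
    obtain ⟨T, hTm⟩ := Finset.card_pos.1 (hMT p₀ hp₀).1
    have h1 := (hT p₀ hp₀ n hn T hTm).1.trans ((card_filter_le_card_filter _ (hTsub p₀)).trans
      (h.tubes_triv p₀ (hPP hp₀) n hn _))
    have := le_of_scalePow_le hS2 h1
    linarith
  have h_points_coarse : ∀ n ≤ D, (γ n : ℝ) + n * (2 - s) ≤ κ + 5 := by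
    intro n hn
    refine le_of_scalePow_le hS2 ?_
    have h0 : scalePow S (γ n)
        ≤ ((P₂.filter fun p => cell S n (pos p) = cell S n (pos p₀)).card : ℝ) := by
      rw [← hcast]; exact_mod_cast ((hγ n (hn.trans h.D_le)).2 p₀ hp₀).1
    have h1 := h0.trans ((card_filter_le_card_filter _ hPP).trans (h.points_coarse n hn _))
    rw [scalePow_add hS]
    calc scalePow S (γ n) * scalePow S (n * (2 - s))
        ≤ (scalePow S (4 - n * (2 - s)) * scalePow S (κ + 1)) * scalePow S (n * (2 - s)) := by
          refine mul_le_mul_of_nonneg_right (h1.trans ?_) (scalePow_pos hS _).le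
          exact mul_le_mul_of_nonneg_left hPκ (scalePow_pos hS _).le
      _ = scalePow S (κ + 5) := by
          rw [← scalePow_add hS, ← scalePow_add hS]; congr 1; ring
  have h_points_fine : ∀ n ≤ K, D ≤ n → (γ n : ℝ) ≤ ((K : ℝ) - n) * s + 5 := by
    intro n hn hDn
    refine le_of_scalePow_le hS2 ?_
    have h0 : scalePow S (γ n)
        ≤ ((P₂.filter fun p => cell S n (pos p) = cell S n (pos p₀)).card : ℝ) := by
      rw [← hcast]; exact_mod_cast ((hγ n hn).2 p₀ hp₀).1
    exact (h0.trans ((card_filter_le_card_filter _ hPP).trans (h.points_fine n hn hDn _))).trans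
      (scalePow_mono hS (by linarith))
  have U : UniformConfiguration S K D s 5 κ (fun n => (μ n : ℝ)) (fun n => (γ n : ℝ))
      P₂ Tp' pos par :=
    { large := h.large
      s_le_one := h.s_le_one
      w_nonneg := by norm_num
      D_le := h.D_le
      card_eq := hκ
      pos_mem := fun p hp => h.pos_mem p (hPP hp)
      slope_le := fun p hp T hT' => h.slope_le p (hPP hp) T (hTsub p hT')
      incident := fun p hp T hT' => h.incident p (hPP hp) T (hTsub p hT')
      nonempty := fun p hp => Finset.card_pos.1 (hMT p hp).1
      tubes_lower := fun p hp T hT' n hn => (hT p hp n hn T hT').1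
      tubes_upper := fun p hp T hT' n hn => (hT p hp n hn T hT').2
      points_lower := fun p hp n hn => by
        rw [← hcast]; exact_mod_cast ((hγ n hn).2 p hp).1
      points_upper := fun p hp n hn => by
        have e := hcast (γ n + 1)
        push_cast at e
        rw [← e]; exact_mod_cast ((hγ n hn).2 p hp).2.le
      tubes_dim := h_tubes_dim
      tubes_triv := h_tubes_triv
      points_coarse := h_points_coarse
      points_fine := h_points_fine }
  have hsubT : ((P₂.biUnion Tp').card : ℝ) ≤ ((P.biUnion Tp).card : ℝ) := by
    refine Nat.cast_le.2 (Finset.card_le_card ?_)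
    intro T hT'
    obtain ⟨p, hp, hTp⟩ := Finset.mem_biUnion.1 hT'
    exact Finset.mem_biUnion.2 ⟨p, hPP hp, hTsub p hTp⟩
  have hM := (hMT p₀ hp₀).2
  have hM0 := h.M_pos
  have hrp : ∀ x y : ℝ, (scalePow S x) ^ y = scalePow S (x * y) := fun x y => by
    unfold scalePow; rw [← Real.rpow_mul hS0.le]
  have hfinish : ∀ {x y z : ℝ}, x ≤ scalePow S y → scalePow S z ≤ ((P₂.biUnion Tp').card : ℝ) →
      y ≤ 49 + z → x ≤ scalePow S 49 * ((P.biUnion Tp).card : ℝ) := by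
    intro x y z h1 h2 h3
    refine h1.trans ((scalePow_mono hS h3).trans ?_)
    rw [scalePow_add hS]
    exact mul_le_mul_of_nonneg_left (h2.trans hsubT) (scalePow_pos hS _).le
  rcases U.card_tubes_ge with h1 | h1 | h1
  · refine (min_le_left _ _).trans (hfinish (y := (μ 0 : ℝ) + 4 + (κ + 1)) ?_ h1 (by linarith))
    rw [scalePow_add hS]
    exact mul_le_mul hM hPκ (Nat.cast_nonneg _) (scalePow_pos hS _).le
  · refine ((min_le_right _ _).trans (min_le_left _ _)).trans
      (hfinish (y := ((μ 0 : ℝ) + 4) * (3 / 2) + (κ + 1) * (1 / 2)) ?_ h1 (by linarith))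
    rw [scalePow_add hS, ← hrp, ← hrp]
    refine mul_le_mul (Real.rpow_le_rpow hM0.le hM (by norm_num))
      (Real.rpow_le_rpow (Nat.cast_nonneg _) hPκ (by norm_num))
      (Real.rpow_nonneg (Nat.cast_nonneg _) _) ?_
    exact Real.rpow_nonneg (scalePow_pos hS _).le _
  · refine ((min_le_right _ _).trans (min_le_right _ _)).trans
      (hfinish (y := (K : ℝ) + ((μ 0 : ℝ) + 4)) ?_ h1 (by linarith))
    rw [scalePow_add hS, scalePow_natCast]
    exact mul_le_mul_of_nonneg_left hM (by positivity)

end SpreadConfiguration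

/-! ### Dyadic squares and dyadic tubes -/

section Dyadic

variable {δ : ℝ}

lemma mem_dyadicCube_iff (hδ : 0 < δ) {a b : ℤ} {x : Plane} :
    x ∈ dyadicCube δ a b ↔ ⌊x 0 / δ⌋ = a ∧ ⌊x 1 / δ⌋ = b := by
  simp only [dyadicCube, Set.mem_ofPred_eq, Set.mem_Ico, Int.floor_eq_iff, le_div_iff₀ hδ,
    div_lt_iff₀ hδ]

/-- The lower left corner of a dyadic square. -/
noncomputable def corner (δ : ℝ) (g : ℤ × ℤ) : Plane := !₂[(g.1 : ℝ) * δ, (g.2 : ℝ) * δ]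

lemma corner_mem (hδ : 0 < δ) (g : ℤ × ℤ) : corner δ g ∈ dyadicCube δ g.1 g.2 := by
  rw [mem_dyadicCube_iff hδ]
  simp [corner, hδ.ne']

/-- A dyadic tube determines the dyadic square of its parameters: its sections by the lines `x = 0`
and `x = 1` are the intervals of the values of `b` and of `a + b`. -/
lemma dualSet_dyadicCube_injective (hδ : 0 < δ) {a b a' b' : ℤ}
    (h : dualSet (dyadicCube δ a b) = dualSet (dyadicCube δ a' b')) : a = a' ∧ b = b' := by
  have key : ∀ {a b a' b' : ℤ}, dualSet (dyadicCube δ a b) = dualSet (dyadicCube δ a' b') →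
      b' = b ∧ a' + b' ≤ a + b := by
    intro a b a' b' h
    have hc := corner_mem hδ (a, b)
    have h0 : (!₂[0, (b : ℝ) * δ] : Plane) ∈ dualSet (dyadicCube δ a b) := by
      refine Set.mem_biUnion hc ?_
      simp [dualLine, corner]
    have h1 : (!₂[1, ((a : ℝ) + b) * δ] : Plane) ∈ dualSet (dyadicCube δ a b) := by
      refine Set.mem_biUnion hc ?_
      simp [dualLine, corner, add_mul]
    rw [h] at h0 h1
    simp only [dualSet, Set.mem_iUnion, dualLine, Set.mem_ofPred_eq, exists_prop] at h0 h1
    obtain ⟨z, hz, hze⟩ := h0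
    obtain ⟨y, hy, hye⟩ := h1
    refine ⟨?_, ?_⟩
    · rw [mem_dyadicCube_iff hδ] at hz
      simp at hze
      rw [← hz.2, ← hze, mul_div_cancel_right₀ _ hδ.ne', Int.floor_intCast]
    · simp only [dyadicCube, Set.mem_ofPred_eq, Set.mem_Ico] at hy
      simp at hye
      have : ((a' : ℝ) + b') * δ ≤ ((a : ℝ) + b) * δ := by rw [hye]; linarith [hy.1.1, hy.2.1]
      exact_mod_cast le_of_mul_le_mul_right this hδ
  have k1 := key h
  have k2 := key h.symm
  omega

open Classical in
/-- The index of a dyadic square. -/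
noncomputable def cubeIndex (δ : ℝ) (Q : Set Plane) : ℤ × ℤ :=
  if h : ∃ g : ℤ × ℤ, Q = dyadicCube δ g.1 g.2 then h.choose else 0

open Classical in
/-- The index of the dyadic square of parameters of a dyadic tube. -/
noncomputable def tubeIndex (δ : ℝ) (T : Set Plane) : ℤ × ℤ :=
  if h : ∃ g : ℤ × ℤ, T = dualSet (dyadicCube δ g.1 g.2) then h.choose else 0

lemma dyadicCube_cubeIndex {Q : Set Plane} (h : ∃ a b : ℤ, Q = dyadicCube δ a b) :
    Q = dyadicCube δ (cubeIndex δ Q).1 (cubeIndex δ Q).2 := by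
  have h' : ∃ g : ℤ × ℤ, Q = dyadicCube δ g.1 g.2 := by
    obtain ⟨a, b, h⟩ := h; exact ⟨(a, b), h⟩
  rw [cubeIndex, dif_pos h']
  exact h'.choose_spec

lemma tubeIndex_dualSet (hδ : 0 < δ) (a b : ℤ) :
    tubeIndex δ (dualSet (dyadicCube δ a b)) = (a, b) := by
  have h' : ∃ g : ℤ × ℤ, dualSet (dyadicCube δ a b) = dualSet (dyadicCube δ g.1 g.2) :=
    ⟨(a, b), rfl⟩
  rw [tubeIndex, dif_pos h']
  obtain ⟨h1, h2⟩ := dualSet_dyadicCube_injective hδ h'.choose_spec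
  exact Prod.ext h1.symm h2.symm

/-- The lower left corner of a dyadic square, in coordinates. -/
noncomputable def cubePos (δ : ℝ) (Q : Set Plane) : ℝ × ℝ :=
  ((cubeIndex δ Q).1 * δ, (cubeIndex δ Q).2 * δ)

/-- Slope and intercept of a distinguished line of a dyadic tube. -/
noncomputable def tubePar (δ : ℝ) (T : Set Plane) : ℝ × ℝ :=
  ((tubeIndex δ T).1 * δ, (tubeIndex δ T).2 * δ)

lemma dyadicCubes_sUnion_inter (hδ : 0 < δ) {𝒬 : Set (Set Plane)}
    (h𝒬 : ∀ Q ∈ 𝒬, ∃ a b : ℤ, Q = dyadicCube δ a b) (E : Set Plane) :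
    dyadicCubes δ (⋃₀ 𝒬 ∩ E) = {Q ∈ 𝒬 | (Q ∩ E).Nonempty} := by
  ext Q
  simp only [dyadicCubes, Set.mem_ofPred_eq]
  constructor
  · rintro ⟨⟨a, b, rfl⟩, x, hx, ⟨q, hq, hxq⟩, hxE⟩
    obtain ⟨a', b', rfl⟩ := h𝒬 q hq
    have e1 := (mem_dyadicCube_iff hδ).1 hx
    have e2 := (mem_dyadicCube_iff hδ).1 hxq
    have e3 : a = a' := e1.1.symm.trans e2.1
    have e4 : b = b' := e1.2.symm.trans e2.2
    subst e3 e4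
    exact ⟨hq, x, hx, hxE⟩
  · rintro ⟨hQ, x, hx, hxE⟩
    exact ⟨h𝒬 Q hQ, x, hx, ⟨Q, hQ, hx⟩, hxE⟩

lemma dyadicCubes_sUnion (hδ : 0 < δ) {𝒬 : Set (Set Plane)}
    (h𝒬 : ∀ Q ∈ 𝒬, ∃ a b : ℤ, Q = dyadicCube δ a b) : dyadicCubes δ (⋃₀ 𝒬) = 𝒬 := by
  have h := dyadicCubes_sUnion_inter hδ h𝒬 Set.univ
  rw [Set.inter_univ] at h
  rw [h]
  ext Q
  simp only [Set.mem_sep_iff, Set.inter_univ, and_iff_left_iff_imp]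
  intro hQ
  obtain ⟨a, b, rfl⟩ := h𝒬 Q hQ
  exact ⟨_, corner_mem hδ (a, b)⟩

open Classical in
lemma coveringIn_eq (hδ : 0 < δ) {P : Finset (Set Plane)}
    (hP : ∀ Q ∈ P, ∃ a b : ℤ, Q = dyadicCube δ a b) (E : Set Plane) :
    coveringIn δ P E = (P.filter fun Q => (Q ∩ E).Nonempty).card := by
  unfold coveringIn coveringNumber
  rw [dyadicCubes_sUnion_inter hδ hP, ← Set.ncard_coe_finset, Finset.coe_filter]
  rfl

lemma mem_ball_of_abs_sub_lt {x y : Plane} {r : ℝ} (h0 : |x 0 - y 0| < r)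
    (h1 : |x 1 - y 1| < r) : x ∈ Metric.ball y (2 * r) := by
  have hr : 0 < r := (abs_nonneg _).trans_lt h0
  rw [Metric.mem_ball, EuclideanSpace.dist_eq, Fin.sum_univ_two, Real.dist_eq, Real.dist_eq,
    Real.sqrt_lt' (by positivity), sq_abs, sq_abs]
  have e0 := sq_lt_sq' (abs_lt.1 h0).1 (abs_lt.1 h0).2
  have e1 := sq_lt_sq' (abs_lt.1 h1).1 (abs_lt.1 h1).2
  nlinarith

lemma abs_sub_lt_of_cell_eq {S n : ℕ} (hS : 1 ≤ S) {z z' : ℝ × ℝ}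
    (h : cell S n z = cell S n z') :
    |z.1 - z'.1| < 1 / (S : ℝ) ^ n ∧ |z.2 - z'.2| < 1 / (S : ℝ) ^ n := by
  have hp : (0 : ℝ) < (S : ℝ) ^ n := pow_pos (by exact_mod_cast hS) n
  have h1 := Int.abs_sub_lt_one_of_floor_eq_floor (congrArg Prod.fst h)
  have h2 := Int.abs_sub_lt_one_of_floor_eq_floor (congrArg Prod.snd h)
  rw [← sub_mul, abs_mul, abs_of_pos hp] at h1 h2
  exact ⟨by rwa [lt_div_iff₀ hp], by rwa [lt_div_iff₀ hp]⟩

open Classical in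
/-- The number of dyadic `δ`-squares of a family with corner in a given square of side `S⁻ⁿ`. -/
lemma card_filter_cell_le_coveringIn (hδ : 0 < δ) {P : Finset (Set Plane)}
    (hP : ∀ Q ∈ P, ∃ a b : ℤ, Q = dyadicCube δ a b) {S n : ℕ} (hS : 1 ≤ S) (g : ℤ × ℤ) :
    ∃ x : Plane, (P.filter fun p => cell S n (cubePos δ p) = g).card
      ≤ coveringIn δ P (Metric.ball x (2 * (1 / (S : ℝ) ^ n))) := by
  rcases (P.filter fun p => cell S n (cubePos δ p) = g).eq_empty_or_nonempty with h0 | ⟨p, hp⟩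
  · exact ⟨0, by rw [h0]; simp⟩
  · refine ⟨corner δ (cubeIndex δ p), ?_⟩
    rw [coveringIn_eq hδ hP]
    refine Finset.card_le_card fun q hq => ?_
    obtain ⟨hqP, hqg⟩ := Finset.mem_filter.1 hq
    obtain ⟨_, hpg⟩ := Finset.mem_filter.1 hp
    refine Finset.mem_filter.2 ⟨hqP, corner δ (cubeIndex δ q), ?_, ?_⟩
    · have := corner_mem hδ (cubeIndex δ q)
      rwa [← dyadicCube_cubeIndex (hP q hqP)] at this
    · obtain ⟨h1, h2⟩ := abs_sub_lt_of_cell_eq hS (hqg.trans hpg.symm)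
      exact mem_ball_of_abs_sub_lt (by simpa [corner, cubePos] using h1)
        (by simpa [corner, cubePos] using h2)

/-- The distinguished line of a dyadic `δ`-tube has slope at most `1`: as `1 / δ` is an
integer, the left side of a dyadic square that meets the strip lies in the strip. -/
lemma tubePar_bounds {n : ℕ} (hδ : δ = (2 : ℝ)⁻¹ ^ n) {T : Set Plane} (hT : T ∈ dyadicTubes δ) :
    |(tubePar δ T).1| ≤ 1 ∧
      T = dualSet (dyadicCube δ (tubeIndex δ T).1 (tubeIndex δ T).2) := by
  have hδ0 : 0 < δ := by rw [hδ]; positivity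
  obtain ⟨q, ⟨⟨a, b, rfl⟩, z, hz, hzs⟩, rfl⟩ := hT
  unfold tubePar
  rw [tubeIndex_dualSet hδ0]
  refine ⟨?_, rfl⟩
  simp only [dyadicCube, Set.mem_ofPred_eq, Set.mem_Ico] at hz
  simp only [strip, Set.mem_ofPred_eq, Set.mem_Icc] at hzs
  rw [abs_le]
  refine ⟨?_, by linarith [hz.1.1]⟩
  have hinv : δ * 2 ^ n = 1 := by rw [hδ, ← mul_pow]; norm_num
  have h1 : (-1 : ℝ) < ((a : ℝ) + 1) * δ := by linarith [hz.1.2]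
  have h2 : -(2 : ℝ) ^ n < a + 1 := by
    have := mul_lt_mul_of_pos_right h1 (show (0 : ℝ) < 2 ^ n by positivity)
    rw [mul_assoc, hinv] at this
    linarith
  have h3 : -(2 : ℤ) ^ n < a + 1 := by exact_mod_cast h2
  have h4 : -(2 : ℤ) ^ n ≤ a := by omega
  have h5 : -(2 : ℝ) ^ n ≤ a := by exact_mod_cast h4
  have := mul_le_mul_of_nonneg_right h5 hδ0.le
  linarith

lemma cubePos_bounds {n : ℕ} (hδ : δ = (2 : ℝ)⁻¹ ^ n) {p : Set Plane}
    (hp : p ∈ dyadicCubes δ unitSquare) :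
    (0 ≤ (cubePos δ p).1 ∧ (cubePos δ p).1 + δ ≤ 1) ∧
      (0 ≤ (cubePos δ p).2 ∧ (cubePos δ p).2 + δ ≤ 1) := by
  have hδ0 : 0 < δ := by rw [hδ]; positivity
  have hpe := dyadicCube_cubeIndex hp.1
  obtain ⟨x, hx, hxu⟩ := hp.2
  rw [hpe] at hx
  have hinv : δ * 2 ^ n = 1 := by rw [hδ, ← mul_pow]; norm_num
  simp only [dyadicCube, Set.mem_ofPred_eq, Set.mem_Ico] at hx
  simp only [unitSquare, Set.mem_ofPred_eq, Set.mem_Ico] at hxu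
  have key : ∀ (a : ℤ) (u : ℝ), (a : ℝ) * δ ≤ u → u < ((a : ℝ) + 1) * δ → 0 ≤ u → u < 1 →
      0 ≤ (a : ℝ) * δ ∧ (a : ℝ) * δ + δ ≤ 1 := by
    intro a u h1 h2 h3 h4
    have h5 : (0 : ℝ) < a + 1 := pos_of_mul_pos_left (h3.trans_lt h2) hδ0.le
    have h6 : 0 ≤ a := by
      have : (0 : ℤ) < a + 1 := by exact_mod_cast h5
      omega
    have h7 : (a : ℝ) * δ < 1 := h1.trans_lt h4
    have h8 : (a : ℝ) < 2 ^ n := by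
      have := mul_lt_mul_of_pos_right h7 (show (0 : ℝ) < 2 ^ n by positivity)
      rw [mul_assoc, hinv] at this
      linarith
    have h9 : a + 1 ≤ 2 ^ n := by
      have : a < 2 ^ n := by exact_mod_cast h8
      omega
    have h10 : (a : ℝ) + 1 ≤ 2 ^ n := by exact_mod_cast h9
    refine ⟨mul_nonneg (by exact_mod_cast h6) hδ0.le, ?_⟩
    have := mul_le_mul_of_nonneg_right h10 hδ0.le
    linarith
  exact ⟨key _ _ hx.1.1 hx.1.2 hxu.1.1 hxu.1.2, key _ _ hx.2.1 hx.2.2 hxu.2.1 hxu.2.2⟩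

/-- A tube that meets a square passes within `4 δ` of its corner. -/
lemma abs_incidence_le {n : ℕ} (hδ : δ = (2 : ℝ)⁻¹ ^ n) {p T : Set Plane}
    (hp : p ∈ dyadicCubes δ unitSquare) (hT : T ∈ dyadicTubes δ) (hpT : (T ∩ p).Nonempty) :
    |(cubePos δ p).2 - (tubePar δ T).1 * (cubePos δ p).1 - (tubePar δ T).2| ≤ 4 * δ := by
  have hδ0 : 0 < δ := by rw [hδ]; positivity
  obtain ⟨hs, hTe⟩ := tubePar_bounds hδ hT
  have hc := cubePos_bounds hδ hp
  have hpe := dyadicCube_cubeIndex hp.1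
  obtain ⟨x, hxT, hxp⟩ := hpT
  rw [hTe] at hxT
  rw [hpe] at hxp
  simp only [dualSet, Set.mem_iUnion, dualLine, Set.mem_ofPred_eq, exists_prop] at hxT
  obtain ⟨z, hz, hxz⟩ := hxT
  simp only [dyadicCube, Set.mem_ofPred_eq, Set.mem_Ico] at hz hxp
  unfold tubePar cubePos at *
  simp only at *
  set i := ((cubeIndex δ p).1 : ℝ) * δ
  set j := ((cubeIndex δ p).2 : ℝ) * δ
  set a := ((tubeIndex δ T).1 : ℝ) * δ
  set b := ((tubeIndex δ T).2 : ℝ) * δ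
  have e : j - a * i - b = -(x 1 - j) + (z 0 - a) * x 0 + a * (x 0 - i) + (z 1 - b) := by
    rw [hxz]; ring
  have b1 : |-(x 1 - j)| ≤ δ := by rw [abs_le]; constructor <;> linarith [hxp.2.1, hxp.2.2]
  have b2 : |(z 0 - a) * x 0| ≤ δ := by
    rw [abs_mul]
    have h1 : |z 0 - a| ≤ δ := by rw [abs_le]; constructor <;> linarith [hz.1.1, hz.1.2]
    have h2 : |x 0| ≤ 1 := by
      rw [abs_le]; constructor <;> linarith [hxp.1.1, hxp.1.2, hc.1.1, hc.1.2]
    calc |z 0 - a| * |x 0| ≤ δ * 1 := mul_le_mul h1 h2 (abs_nonneg _) hδ0.le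
      _ = δ := mul_one _
  have b3 : |a * (x 0 - i)| ≤ δ := by
    rw [abs_mul]
    have h1 : |x 0 - i| ≤ δ := by rw [abs_le]; constructor <;> linarith [hxp.1.1, hxp.1.2]
    calc |a| * |x 0 - i| ≤ 1 * δ := mul_le_mul hs h1 (abs_nonneg _) zero_le_one
      _ = δ := one_mul _
  have b4 : |z 1 - b| ≤ δ := by rw [abs_le]; constructor <;> linarith [hz.2.1, hz.2.2]
  rw [e]
  have t1 := abs_add_le (-(x 1 - j) + (z 0 - a) * x 0 + a * (x 0 - i)) (z 1 - b)
  have t2 := abs_add_le (-(x 1 - j) + (z 0 - a) * x 0) (a * (x 0 - i))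
  have t3 := abs_add_le (-(x 1 - j)) ((z 0 - a) * x 0)
  linarith

open Classical in
/-- The number of tubes of a `(δ, s, C)`-set with parameters in a given square of side `S⁻ⁿ`. -/
lemma IsTubeDeltaSet.card_filter_cell_le (hδ : 0 < δ) {s C : ℝ} {𝒯 : Finset (Set Plane)}
    (h : IsTubeDeltaSet δ s C 𝒯) {S n : ℕ} (hS : 1 ≤ S)
    (h1 : δ ≤ 2 * (1 / (S : ℝ) ^ n)) (h2 : 2 * (1 / (S : ℝ) ^ n) ≤ 1) (g : ℤ × ℤ) :
    ((𝒯.filter fun T => cell S n (tubePar δ T) = g).card : ℝ)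
      ≤ C * (2 * (1 / (S : ℝ) ^ n)) ^ s * 𝒯.card := by
  obtain ⟨𝒬, h𝒬s, h𝒯, _, _, hdim⟩ := h
  have h𝒬 : ∀ Q ∈ 𝒬, ∃ a b : ℤ, Q = dyadicCube δ a b := fun Q hQ => (h𝒬s hQ).1
  have hinj : Set.InjOn dualSet 𝒬 := by
    intro q hq q' hq' he
    obtain ⟨a, b, rfl⟩ := h𝒬 q hq
    obtain ⟨a', b', rfl⟩ := h𝒬 q' hq'
    obtain ⟨e1, e2⟩ := dualSet_dyadicCube_injective hδ he
    rw [e1, e2]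
  have hfin : 𝒬.Finite := by
    refine Set.Finite.of_finite_image ?_ hinj
    rw [← h𝒯]; exact 𝒯.finite_toSet
  have hcard : coveringNumber δ (⋃₀ 𝒬) = 𝒯.card := by
    unfold coveringNumber
    rw [dyadicCubes_sUnion hδ h𝒬, ← Set.ncard_coe_finset, h𝒯, hinj.ncard_image]
  have hlow : ∀ x : Plane, ∀ T₀ ∈ 𝒯, x = corner δ (tubeIndex δ T₀) → cell S n (tubePar δ T₀) = g →
      (𝒯.filter fun T => cell S n (tubePar δ T) = g).card
      ≤ coveringNumber δ (⋃₀ 𝒬 ∩ Metric.ball x (2 * (1 / (S : ℝ) ^ n))) := by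
    rintro x T₀ hT₀ rfl hg
    unfold coveringNumber
    rw [dyadicCubes_sUnion_inter hδ h𝒬]
    set G := {Q ∈ 𝒬 | (Q ∩ Metric.ball (corner δ (tubeIndex δ T₀))
      (2 * (1 / (S : ℝ) ^ n))).Nonempty} with hG
    have hGfin : G.Finite := hfin.subset fun Q hQ => hQ.1
    refine le_trans ?_ (Set.ncard_image_le (f := dualSet) hGfin)
    rw [← Set.ncard_coe_finset]
    refine Set.ncard_le_ncard ?_ (hGfin.image _)
    intro T hT
    rw [Finset.mem_coe, Finset.mem_filter] at hT
    have hTm : T ∈ dualSet '' 𝒬 := by rw [← h𝒯]; exact hT.1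
    obtain ⟨Q, hQ, rfl⟩ := hTm
    obtain ⟨a, b, rfl⟩ := h𝒬 Q hQ
    refine ⟨_, ⟨hQ, corner δ (a, b), corner_mem hδ (a, b), ?_⟩, rfl⟩
    obtain ⟨d1, d2⟩ := abs_sub_lt_of_cell_eq hS (hT.2.trans hg.symm)
    unfold tubePar at d1 d2
    rw [tubeIndex_dualSet hδ] at d1 d2
    exact mem_ball_of_abs_sub_lt (by simpa [corner] using d1) (by simpa [corner] using d2)
  rw [← hcard]
  rcases (𝒯.filter fun T => cell S n (tubePar δ T) = g).eq_empty_or_nonempty with h0 | ⟨T₀, hT₀⟩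
  · rw [h0, Finset.card_empty, Nat.cast_zero]
    exact (Nat.cast_nonneg _).trans (hdim 0 _ h1 h2)
  · obtain ⟨hT1, hT2⟩ := Finset.mem_filter.1 hT₀
    refine le_trans ?_ (hdim (corner δ (tubeIndex δ T₀)) _ h1 h2)
    exact_mod_cast hlow _ T₀ hT1 rfl hT2

end Dyadic

/-! ### From nice configurations to spread configurations -/

lemma exists_transition_scale (Δ : ℝ) {S : ℕ} (hS : 2 ≤ S) (K : ℕ) :
    ∃ D ≤ K, (∀ n < D, Δ < 2 * (1 / (S : ℝ) ^ n)) ∧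
      ∀ n ≤ K, D < n → 2 * (1 / (S : ℝ) ^ n) < Δ := by
  classical
  by_cases hex : ∃ n, n < K ∧ 2 * (1 / (S : ℝ) ^ n) ≤ Δ
  · refine ⟨Nat.find hex, (Nat.find_spec hex).1.le, fun n hn => ?_, fun n _ hDn => ?_⟩
    · have := Nat.find_min hex hn
      push Not at this
      exact this (hn.trans (Nat.find_spec hex).1)
    · refine lt_of_lt_of_le ?_ (Nat.find_spec hex).2
      have hS1 : (1 : ℝ) < S := by exact_mod_cast hS
      gcongr
  · push Not at hex
    exact ⟨K, le_rfl, hex, fun n h1 h2 => by omega⟩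

lemma two_mul_one_div_rpow_le {S : ℕ} (hS : 1 ≤ S) (n : ℕ) {s : ℝ} (hs : s ≤ 2) :
    (2 * (1 / (S : ℝ) ^ n)) ^ s ≤ 4 * scalePow S (-(n * s)) := by
  have hS0 : (0 : ℝ) < S := by exact_mod_cast hS
  rw [Real.mul_rpow (by norm_num) (by positivity)]
  have e : (1 / (S : ℝ) ^ n) ^ s = scalePow S (-(n * s)) := by
    unfold scalePow
    rw [one_div, Real.inv_rpow (by positivity), ← Real.rpow_natCast_mul hS0.le,
      Real.rpow_neg hS0.le]
  rw [e]
  refine mul_le_mul_of_nonneg_right ?_ (scalePow_pos hS _).le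
  calc (2 : ℝ) ^ s ≤ (2 : ℝ) ^ (2 : ℝ) := Real.rpow_le_rpow_of_exponent_le (by norm_num) hs
    _ = 4 := by norm_num

/-- The hypotheses on the base `S` that the reduction needs: `S ^ K` agrees with `δ⁻¹` up to a factor
`2 ^ K`, and `S` dominates the constants that depend on `K` as well as the constant `B` of the
configuration. -/
structure ScaleHypotheses (S K : ℕ) (δ B : ℝ) : Prop where
  pos : 0 < δ
  one_le : 1 ≤ B
  pow_mul_le : (S : ℝ) ^ K * δ ≤ 1
  le_pow_mul : 1 ≤ 2 ^ K * ((S : ℝ) ^ K * δ)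
  large : 10 ^ 12 * (K + 2) ^ 3 * 16 ^ K ≤ S
  large' : (2 * K + 5) ^ (2 * K + 2) ≤ S
  const_le : 40 * 4 ^ K * B ≤ S

namespace ScaleHypotheses

variable {S K : ℕ} {δ B : ℝ} (h : ScaleHypotheses S K δ B)

include h

lemma three_le : 3 ≤ S := by
  have h1 : 10 ^ 12 * (1 * 1) ≤ 10 ^ 12 * ((K + 2) ^ 3 * 16 ^ K) := by
    gcongr <;> exact Nat.one_le_pow _ _ (by omega)
  have := h.large
  rw [mul_assoc] at this
  omega

lemma one_le_S : 1 ≤ S := by have := h.three_le; omega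

lemma pow_pos' (n : ℕ) : (0 : ℝ) < (S : ℝ) ^ n := pow_pos (by exact_mod_cast h.one_le_S) n

lemma delta_le {n : ℕ} (hn : n ≤ K) : δ ≤ 1 / (S : ℝ) ^ n := by
  rw [le_div_iff₀ (h.pow_pos' n), mul_comm]
  refine le_trans (mul_le_mul_of_nonneg_right ?_ h.pos.le) h.pow_mul_le
  exact pow_le_pow_right₀ (by exact_mod_cast h.one_le_S) hn

lemma two_mul_lt_one {n : ℕ} (hn : n ≠ 0) : 2 * (1 / (S : ℝ) ^ n) < 1 := by
  have h3 : (3 : ℝ) ≤ S := by exact_mod_cast h.three_le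
  have : (S : ℝ) ≤ (S : ℝ) ^ n := le_self_pow₀ (by linarith) hn
  rw [mul_one_div, div_lt_one (h.pow_pos' n)]
  linarith

lemma pow_le_const : (40 : ℝ) * 4 ^ K ≤ S :=
  le_trans (le_mul_of_one_le_right (by positivity) h.one_le) h.const_le

/-- The side of a square at level `n`, in units of `δ`. -/
lemma inv_le {n : ℕ} (hn : n ≤ K) : 1 / (S : ℝ) ^ n / δ ≤ 2 ^ K * (S : ℝ) ^ (K - n) := by
  rw [div_div, div_le_iff₀ (mul_pos (h.pow_pos' n) h.pos)]
  refine h.le_pow_mul.trans (le_of_eq ?_)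
  have : (S : ℝ) ^ K = (S : ℝ) ^ (K - n) * (S : ℝ) ^ n := by
    rw [← pow_add, Nat.sub_add_cancel hn]
  rw [this]
  ring

end ScaleHypotheses

lemma abs_index_sub_le {δ r : ℝ} (hδ : 0 < δ) {a b : ℤ} (h : |(a : ℝ) * δ - b * δ| < r) :
    |(a : ℝ) - b| ≤ r / δ := by
  rw [← sub_mul, abs_mul, abs_of_pos hδ] at h
  rw [le_div_iff₀ hδ]
  exact h.le

lemma mem_Icc_floor_intCast {u L : ℝ} {a : ℤ} (h : |(a : ℝ) - u| ≤ L) :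
    a ∈ Finset.Icc ⌊u - L⌋ ⌊u + L⌋ := by
  have := mem_Icc_floor h
  rwa [Int.floor_intCast] at this

open Classical in
/-- The trivial bound for the number of dyadic squares in a square of side `S⁻ᴷ`. -/
lemma ScaleHypotheses.card_points_le {S K : ℕ} {δ B : ℝ} (h : ScaleHypotheses S K δ B)
    {P : Finset (Set Plane)} (hP : ∀ Q ∈ P, ∃ a b : ℤ, Q = dyadicCube δ a b) (g : ℤ × ℤ) :
    ((P.filter fun p => cell S K (cubePos δ p) = g).card : ℝ) ≤ S := by
  rcases (P.filter fun p => cell S K (cubePos δ p) = g).eq_empty_or_nonempty with h0 | ⟨p₀, hp₀⟩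
  · rw [h0, Finset.card_empty, Nat.cast_zero]; positivity
  have hp₀' := Finset.mem_filter.1 hp₀
  set i := cubeIndex δ p₀ with hi
  set L : ℝ := 2 ^ K with hL
  have hL1 : 1 ≤ L := one_le_pow₀ (by norm_num)
  have h1 : ((P.filter fun p => cell S K (cubePos δ p) = g).card : ℝ)
      ≤ ((Finset.Icc ⌊(i.1 : ℝ) - L⌋ ⌊(i.1 : ℝ) + L⌋ ×ˢ
          Finset.Icc ⌊(i.2 : ℝ) - L⌋ ⌊(i.2 : ℝ) + L⌋).card : ℝ) := by
    refine Nat.cast_le.2 (Finset.card_le_card_of_injOn (cubeIndex δ) (fun p hp => ?_) ?_)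
    · have hp' := Finset.mem_filter.1 hp
      obtain ⟨d1, d2⟩ := abs_sub_lt_of_cell_eq h.one_le_S (hp'.2.trans hp₀'.2.symm)
      have hinv := h.inv_le le_rfl
      rw [Nat.sub_self, pow_zero, mul_one] at hinv
      rw [Finset.mem_coe, Finset.mem_product]
      exact ⟨mem_Icc_floor_intCast ((abs_index_sub_le h.pos d1).trans hinv),
        mem_Icc_floor_intCast ((abs_index_sub_le h.pos d2).trans hinv)⟩
    · intro p hp q hq hpq
      rw [dyadicCube_cubeIndex (hP p (Finset.mem_filter.1 hp).1),
        dyadicCube_cubeIndex (hP q (Finset.mem_filter.1 hq).1), hpq]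
  refine h1.trans ?_
  rw [Finset.card_product]
  push_cast
  have c1 := card_Icc_floor_le (i.1 : ℝ) L (by linarith)
  have c2 := card_Icc_floor_le (i.2 : ℝ) L (by linarith)
  have e : L * L = 4 ^ K := by rw [hL, ← mul_pow]; norm_num
  calc _ ≤ (2 * L + 2) * (2 * L + 2) := mul_le_mul c1 c2 (Nat.cast_nonneg _) (by linarith)
    _ ≤ 40 * (L * L) := by nlinarith
    _ ≤ S := by rw [e]; exact h.pow_le_const

open Classical in
/-- The trivial bound for the number of tubes through a point with parameters in a given square:
the slope of such a tube determines its intercept up to a few choices. -/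
lemma ScaleHypotheses.card_tubes_le {S K : ℕ} {δ B : ℝ} (h : ScaleHypotheses S K δ B)
    {z : ℝ × ℝ} {i : ℤ × ℤ} (hz : z.2 = i.2 * δ) {𝒯 : Finset (Set Plane)}
    (hT : ∀ T ∈ 𝒯, T = dualSet (dyadicCube δ (tubeIndex δ T).1 (tubeIndex δ T).2))
    (hinc : ∀ T ∈ 𝒯, |z.2 - (tubePar δ T).1 * z.1 - (tubePar δ T).2| ≤ 4 * δ)
    {n : ℕ} (hn : n ≤ K) (g : ℤ × ℤ) :
    ((𝒯.filter fun T => cell S n (tubePar δ T) = g).card : ℝ) ≤ scalePow S (1 + (K - n)) := by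
  have hpos : 0 < scalePow S (1 + ((K : ℝ) - n)) := scalePow_pos h.one_le_S _
  rcases (𝒯.filter fun T => cell S n (tubePar δ T) = g).eq_empty_or_nonempty with h0 | ⟨T₀, hT₀⟩
  · rw [h0, Finset.card_empty, Nat.cast_zero]; exact hpos.le
  have hT₀' := Finset.mem_filter.1 hT₀
  set a₀ := (tubeIndex δ T₀).1 with ha₀
  set L : ℝ := 2 ^ K * (S : ℝ) ^ (K - n) with hL
  have hS1 : (1 : ℝ) ≤ S := by exact_mod_cast h.one_le_S
  have hL1 : 1 ≤ L := one_le_mul_of_one_le_of_one_le (one_le_pow₀ (by norm_num)) (one_le_pow₀ hS1)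
  have hδ := h.pos
  have h1 := card_le_card_mul_of_fiber
    (A := 𝒯.filter fun T => cell S n (tubePar δ T) = g)
    (B := Finset.Icc ⌊(a₀ : ℝ) - L⌋ ⌊(a₀ : ℝ) + L⌋) (fun T => (tubeIndex δ T).1) (C := 10)
    (fun T hT' => ?_) (fun a _ => ?_)
  · refine h1.trans ?_
    have c1 := card_Icc_floor_le (a₀ : ℝ) L (by linarith)
    have e : scalePow S (1 + ((K : ℝ) - n)) = S * (S : ℝ) ^ (K - n) := by
      rw [scalePow_add h.one_le_S, scalePow_one, ← Nat.cast_sub hn, scalePow_natCast]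
    rw [e]
    have h2 : (2 : ℝ) ^ K ≤ 4 ^ K := pow_le_pow_left₀ (by norm_num) (by norm_num) K
    have h3 := h.pow_le_const
    calc _ ≤ (2 * L + 2) * 10 := by gcongr
      _ ≤ 40 * L := by linarith
      _ = 40 * 2 ^ K * (S : ℝ) ^ (K - n) := by rw [hL]; ring
      _ ≤ S * (S : ℝ) ^ (K - n) := by gcongr; linarith
  · have hT'' := Finset.mem_filter.1 hT'
    obtain ⟨d1, _⟩ := abs_sub_lt_of_cell_eq h.one_le_S (hT''.2.trans hT₀'.2.symm)
    exact mem_Icc_floor_intCast ((abs_index_sub_le hδ d1).trans (h.inv_le hn))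
  · have h2 : ((((𝒯.filter fun T => cell S n (tubePar δ T) = g).filter
        fun T => (tubeIndex δ T).1 = a).card : ℕ) : ℝ)
        ≤ ((Finset.Icc ⌊(i.2 - a * z.1) - 4⌋ ⌊(i.2 - a * z.1) + 4⌋).card : ℝ) := by
      refine Nat.cast_le.2 (Finset.card_le_card_of_injOn (fun T => (tubeIndex δ T).2)
        (fun T hT' => ?_) ?_)
      · obtain ⟨hT1, hT2⟩ := Finset.mem_filter.1 hT'
        have hT3 := hinc T (Finset.mem_filter.1 hT1).1
        simp only [tubePar, hT2, hz] at hT3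
        have e : (i.2 : ℝ) * δ - a * δ * z.1 - (tubeIndex δ T).2 * δ
            = -(((tubeIndex δ T).2 - (i.2 - a * z.1)) * δ) := by ring
        rw [e, abs_neg, abs_mul, abs_of_pos hδ] at hT3
        exact mem_Icc_floor_intCast (le_of_mul_le_mul_right hT3 hδ)
      · intro T hT1 T' hT1' he
        obtain ⟨hT2, hT3⟩ := Finset.mem_filter.1 hT1
        obtain ⟨hT2', hT3'⟩ := Finset.mem_filter.1 hT1'
        have he' : (tubeIndex δ T).2 = (tubeIndex δ T').2 := he
        rw [hT T (Finset.mem_filter.1 hT2).1, hT T' (Finset.mem_filter.1 hT2').1, hT3, hT3', he']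
    refine h2.trans ((card_Icc_floor_le _ 4 (by norm_num)).trans (by norm_num))

/-- A nice configuration whose squares are `(2 - s)`-dimensional above the scale `Δ` and
`s`-dimensional below it is, at the scales `S⁻ⁿ`, a spread configuration. -/
theorem exists_spreadConfiguration {S K J : ℕ} {δ A B C Δ s : ℝ} {M : ℕ}
    {P 𝒯 : Finset (Set Plane)} (hA : 1 ≤ A) (hB : 1 ≤ B) (hC : 1 ≤ C)
    (h : ScaleHypotheses S K δ (A * B * C)) (hδ : δ = (2 : ℝ)⁻¹ ^ J) (hs0 : 0 < s) (hs1 : s ≤ 1)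
    (hM : 0 < M) (hPne : P.Nonempty) (hnice : IsNiceConfiguration A δ s C M P 𝒯)
    (hcoarse : ∀ (x : Plane) (ρ : ℝ), Δ < ρ → ρ < 1 →
      (coveringIn δ P (Metric.ball x ρ) : ℝ) ≤ B * C * ρ ^ (2 - s) * (P.card : ℝ))
    (hfine : ∀ (x : Plane) (ρ : ℝ), δ < ρ → ρ < Δ →
      (coveringIn δ P (Metric.ball x ρ) : ℝ) ≤ B * C * (ρ / δ) ^ s) :
    ∃ (D : ℕ) (Tp : Set Plane → Finset (Set Plane)), (∀ p ∈ P, Tp p ⊆ 𝒯) ∧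
      SpreadConfiguration S K D s M P Tp (cubePos δ) (tubePar δ) := by
  classical
  have hS := h.one_le_S
  have hS0 : (0 : ℝ) < S := by exact_mod_cast hS
  have hP : ∀ Q ∈ P, ∃ a b : ℤ, Q = dyadicCube δ a b := fun Q hQ => (hnice.cubes Q hQ).1
  have hex : ∀ p, ∃ 𝒯p : Finset (Set Plane), p ∈ P → 𝒯p ⊆ 𝒯 ∧ IsTubeDeltaSet δ s C 𝒯p ∧
      A⁻¹ * (M : ℝ) ≤ (𝒯p.card : ℝ) ∧ (𝒯p.card : ℝ) ≤ A * (M : ℝ) ∧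
      ∀ T ∈ 𝒯p, (T ∩ p).Nonempty := by
    intro p
    by_cases hp : p ∈ P
    · obtain ⟨𝒯p, hh⟩ := hnice.nice p hp
      exact ⟨𝒯p, fun _ => hh⟩
    · exact ⟨∅, fun hp' => absurd hp' hp⟩
  choose Tp hTp using hex
  -- Level `D` is the transition: the earlier squares are larger than `Δ`, the later ones smaller.
  obtain ⟨D, hDK, hD1, hD2⟩ := exists_transition_scale Δ (S := S) (by have := h.three_le; omega) K
  have hABC : 40 * (A * B * C) ≤ S := by
    refine le_trans ?_ h.const_le
    have h4 : (1 : ℝ) ≤ 4 ^ K := one_le_pow₀ (by norm_num)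
    have : 0 ≤ A * B * C := by positivity
    nlinarith
  have hAC : 4 * (A * C) ≤ S := by
    have : A * C ≤ A * B * C := by
      have : A * 1 * C ≤ A * B * C := by gcongr
      linarith
    have : 0 ≤ A * C := by positivity
    linarith
  have hBC : 4 * (B * C) ≤ S := by
    have : B * C ≤ A * B * C := by
      have : 1 * B * C ≤ A * B * C := by gcongr
      linarith
    have : 0 ≤ B * C := by positivity
    linarith
  have hAS : A ≤ S := by
    have : A * 1 ≤ A * C := by gcongr
    have : 0 ≤ A * C := by positivity
    linarith
  have hM0 : (0 : ℝ) < M := by exact_mod_cast hM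
  have hTmem : ∀ p ∈ P, ∀ T ∈ Tp p, T ∈ dyadicTubes δ := fun p hp T hT =>
    hnice.tubes T ((hTp p hp).1 hT)
  -- The direct bounds for the number of squares, away from the scale `Δ`.
  have hpc : ∀ n, n ≠ 0 → n < D → ∀ g,
      ((P.filter fun p => cell S n (cubePos δ p) = g).card : ℝ)
        ≤ scalePow S (1 - n * (2 - s)) * P.card := by
    intro n hn0 hnD g
    obtain ⟨x, hx⟩ := card_filter_cell_le_coveringIn h.pos hP (n := n) hS g
    have h1 := hcoarse x _ (hD1 n hnD) (h.two_mul_lt_one hn0)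
    refine (Nat.cast_le.2 hx).trans (h1.trans ?_)
    refine mul_le_mul_of_nonneg_right ?_ (Nat.cast_nonneg _)
    calc B * C * (2 * (1 / (S : ℝ) ^ n)) ^ (2 - s)
        ≤ B * C * (4 * scalePow S (-(n * (2 - s)))) := by
          gcongr; exact two_mul_one_div_rpow_le hS n (by linarith)
      _ = 4 * (B * C) * scalePow S (-(n * (2 - s))) := by ring
      _ ≤ _ := mul_scalePow_le hS hBC (by linarith)
  have hpf : ∀ n ≤ K, D < n → ∀ g,
      ((P.filter fun p => cell S n (cubePos δ p) = g).card : ℝ)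
        ≤ scalePow S (2 + (K - n) * s) := by
    intro n hn hDn g
    obtain ⟨x, hx⟩ := card_filter_cell_le_coveringIn h.pos hP (n := n) hS g
    have hδn := h.delta_le hn
    have hp1 : 0 < 1 / (S : ℝ) ^ n := one_div_pos.2 (h.pow_pos' n)
    have h1 := hfine x _ (by linarith) (hD2 n hn hDn)
    refine (Nat.cast_le.2 hx).trans (h1.trans ?_)
    have h2 : 2 * (1 / (S : ℝ) ^ n) / δ ≤ 2 * 2 ^ K * (S : ℝ) ^ (K - n) := by
      have := h.inv_le hn
      rw [mul_div_assoc]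
      linarith
    have hK1 : (1 : ℝ) ≤ 2 * 2 ^ K := by
      have : (1 : ℝ) ≤ 2 ^ K := one_le_pow₀ (by norm_num)
      linarith
    have h3 : (2 * (1 / (S : ℝ) ^ n) / δ) ^ s ≤ 2 * 2 ^ K * scalePow S ((K - n) * s) := by
      calc (2 * (1 / (S : ℝ) ^ n) / δ) ^ s ≤ (2 * 2 ^ K * (S : ℝ) ^ (K - n)) ^ s :=
            Real.rpow_le_rpow (div_nonneg (by positivity) h.pos.le) h2 hs0.le
        _ = (2 * 2 ^ K : ℝ) ^ s * ((S : ℝ) ^ (K - n)) ^ s :=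
            Real.mul_rpow (by positivity) (by positivity)
        _ ≤ 2 * 2 ^ K * scalePow S ((K - n) * s) := by
            refine mul_le_mul ?_ (le_of_eq ?_) (Real.rpow_nonneg (by positivity) _) (by positivity)
            · calc (2 * 2 ^ K : ℝ) ^ s ≤ (2 * 2 ^ K : ℝ) ^ (1 : ℝ) :=
                  Real.rpow_le_rpow_of_exponent_le hK1 hs1
                _ = _ := Real.rpow_one _
            · unfold scalePow
              rw [← Real.rpow_natCast_mul hS0.le, Nat.cast_sub hn]
    have hKS : 2 * (2 : ℝ) ^ K ≤ S := by
      have h2 : (2 : ℝ) ^ K ≤ 4 ^ K := pow_le_pow_left₀ (by norm_num) (by norm_num) K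
      have h3 := h.pow_le_const
      have : (0 : ℝ) ≤ 4 ^ K := by positivity
      linarith
    have hBCS : B * C ≤ S := by
      have : 0 ≤ B * C := by positivity
      linarith
    calc B * C * (2 * (1 / (S : ℝ) ^ n) / δ) ^ s
        ≤ B * C * (2 * 2 ^ K * scalePow S ((K - n) * s)) := by gcongr
      _ ≤ B * C * scalePow S ((K - n) * s + 1) := by
          refine mul_le_mul_of_nonneg_left (mul_scalePow_le hS hKS le_rfl) (by positivity)
      _ ≤ _ := mul_scalePow_le hS hBCS (by linarith)
  refine ⟨D, Tp, fun p hp => (hTp p hp).1, ?_⟩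
  refine
    { large := h.large
      large' := h.large'
      s_le_one := hs1
      D_le := hDK
      M_pos := hM0
      nonempty := hPne
      pos_mem := fun p hp => ?_
      slope_le := fun p hp T hT => (tubePar_bounds hδ (hTmem p hp T hT)).1
      incident := fun p hp T hT => ?_
      card_tubes := fun p hp => ?_
      tubes_dim := fun p hp n hn g => ?_
      tubes_triv := fun p hp n hn g => ?_
      points_coarse := fun n hn g => ?_
      points_fine := fun n hn hDn g => ?_ }
  · obtain ⟨⟨x0, x1⟩, y0, y1⟩ := cubePos_bounds hδ (hnice.cubes p hp)
    have := h.pos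
    exact ⟨⟨x0, by linarith⟩, y0, by linarith⟩
  · have h1 := abs_incidence_le hδ (hnice.cubes p hp) (hTmem p hp T hT) ((hTp p hp).2.2.2.2 T hT)
    calc _ ≤ 4 * δ * (S : ℝ) ^ K := mul_le_mul_of_nonneg_right h1 (h.pow_pos' K).le
      _ ≤ 4 := by have := h.pow_mul_le; linarith
  · have h1 := (hTp p hp).2.2.1
    rw [inv_mul_le_iff₀ (by linarith)] at h1
    exact h1.trans (mul_le_mul_of_nonneg_right hAS (Nat.cast_nonneg _))
  · have hcard := (hTp p hp).2.2.2.1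
    rcases Nat.eq_zero_or_pos n with rfl | hn0
    · have h1 : (((Tp p).filter fun T => cell S 0 (tubePar δ T) = g).card : ℝ) ≤ (Tp p).card :=
        Nat.cast_le.2 (Finset.card_le_card (Finset.filter_subset _ _))
      have e : scalePow S (1 - s * (0 : ℕ)) = S := by
        rw [Nat.cast_zero, mul_zero, sub_zero, scalePow_one]
      rw [e]
      exact h1.trans (hcard.trans (mul_le_mul_of_nonneg_right hAS hM0.le))
    · have hδn := h.delta_le hn
      have hp1 : 0 < 1 / (S : ℝ) ^ n := one_div_pos.2 (h.pow_pos' n)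
      have h1 := (hTp p hp).2.1.card_filter_cell_le h.pos (n := n) hS (by linarith)
        (h.two_mul_lt_one hn0.ne').le g
      refine h1.trans ?_
      calc C * (2 * (1 / (S : ℝ) ^ n)) ^ s * (Tp p).card
          ≤ C * (4 * scalePow S (-(n * s))) * (A * M) := by
            have h0 := (scalePow_pos hS (-(n * s))).le
            refine mul_le_mul (mul_le_mul_of_nonneg_left
              (two_mul_one_div_rpow_le hS n (s := s) (by linarith)) (by linarith)) hcard
              (Nat.cast_nonneg _) (by positivity)
        _ = 4 * (A * C) * scalePow S (-(n * s)) * M := by ring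
        _ ≤ scalePow S (1 - s * n) * M := by
            refine mul_le_mul_of_nonneg_right (mul_scalePow_le hS hAC ?_) hM0.le
            linarith
  · exact h.card_tubes_le (z := cubePos δ p) (i := cubeIndex δ p) rfl
      (fun T hT => (tubePar_bounds hδ (hTmem p hp T hT)).2)
      (fun T hT => abs_incidence_le hδ (hnice.cubes p hp) (hTmem p hp T hT)
        ((hTp p hp).2.2.2.2 T hT)) hn g
  · -- Squares at level `n` are counted at level `n - 1`, which is strictly above the scale `Δ`.
    have hcardP : (0 : ℝ) ≤ P.card := Nat.cast_nonneg _
    have htriv : ((P.filter fun p => cell S n (cubePos δ p) = g).card : ℝ) ≤ 1 * P.card := by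
      rw [one_mul]; exact Nat.cast_le.2 (Finset.card_le_card (Finset.filter_subset _ _))
    rcases n with _ | n
    · refine htriv.trans (mul_le_mul_of_nonneg_right ?_ hcardP)
      rw [← scalePow_zero (S := S)]
      exact scalePow_mono hS (by push_cast; linarith)
    · rcases Nat.eq_zero_or_pos n with rfl | hn0
      · refine htriv.trans (mul_le_mul_of_nonneg_right ?_ hcardP)
        rw [← scalePow_zero (S := S)]
        exact scalePow_mono hS (by push_cast; linarith)
      · have h1 : ((P.filter fun p => cell S (n + 1) (cubePos δ p) = g).card : ℝ)
            ≤ ((P.filter fun p => cell S n (cubePos δ p) = ancestor S 1 g).card : ℝ) := by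
          refine Nat.cast_le.2 (Finset.card_le_card fun p hp => ?_)
          obtain ⟨h1, h2⟩ := Finset.mem_filter.1 hp
          exact Finset.mem_filter.2 ⟨h1, by rw [← h2, ancestor_cell hS]⟩
        refine h1.trans ((hpc n hn0.ne' hn _).trans (mul_le_mul_of_nonneg_right ?_ hcardP))
        exact scalePow_mono hS (by push_cast; linarith)
  · rcases hn.eq_or_lt with rfl | hlt
    · refine (h.card_points_le hP g).trans ?_
      rw [← scalePow_one (S := S)]
      exact scalePow_mono hS (by linarith)
    · -- Squares at level `n` are split into squares at level `n + 1`, strictly below the scale `Δ`.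
      have hSk : (0 : ℤ) < (S : ℤ) := by exact_mod_cast hS
      have h1 := card_le_card_mul_of_fiber
        (A := P.filter fun p => cell S n (cubePos δ p) = g)
        (B := Finset.Ico (g.1 * (S : ℤ)) (g.1 * S + S) ×ˢ
          Finset.Ico (g.2 * (S : ℤ)) (g.2 * S + S))
        (fun p => cell S (n + 1) (cubePos δ p)) (C := scalePow S (2 + (K - (n + 1 : ℕ)) * s))
        (fun p hp => ?_) (fun b _ => ?_)
      · refine h1.trans ?_
        rw [Finset.card_product, Int.card_Ico, Int.card_Ico, add_sub_cancel_left,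
          add_sub_cancel_left]
        simp only [Int.toNat_natCast]
        push_cast
        rw [← scalePow_one, ← scalePow_add hS]
        exact scalePow_mul_le hS (by linarith)
      · have := (Finset.mem_filter.1 hp).2
        rw [← ancestor_cell hS 1 n] at this
        have h2 : (cell S (n + 1) (cubePos δ p)).1 / (S : ℤ) ^ 1 = g.1 := congrArg Prod.fst this
        have h3 : (cell S (n + 1) (cubePos δ p)).2 / (S : ℤ) ^ 1 = g.2 := congrArg Prod.snd this
        rw [pow_one] at h2 h3
        rw [Finset.mem_product, Finset.mem_Ico, Finset.mem_Ico]
        have q1 := Int.ediv_mul_le (cell S (n + 1) (cubePos δ p)).1 hSk.ne'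
        have q2 := Int.lt_ediv_add_one_mul_self (cell S (n + 1) (cubePos δ p)).1 hSk
        have q3 := Int.ediv_mul_le (cell S (n + 1) (cubePos δ p)).2 hSk.ne'
        have q4 := Int.lt_ediv_add_one_mul_self (cell S (n + 1) (cubePos δ p)).2 hSk
        rw [h2] at q1 q2
        rw [h3] at q3 q4
        refine ⟨⟨?_, ?_⟩, ?_, ?_⟩ <;> linarith
      · refine le_trans ?_ (hpf (n + 1) hlt (by omega) b)
        exact card_filter_le_card_filter _ (Finset.filter_subset _ _)

/-! ### Choice of the scales -/

lemma IsNiceConfiguration.le_mul_card {A δ s C : ℝ} {M : ℕ} {P 𝒯 : Finset (Set Plane)}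
    (h : IsNiceConfiguration A δ s C M P 𝒯) (hA : 1 ≤ A) (hP : P.Nonempty) :
    (M : ℝ) ≤ A * 𝒯.card := by
  obtain ⟨p, hp⟩ := hP
  obtain ⟨𝒯p, h1, _, h2, _⟩ := h.nice p hp
  rw [inv_mul_le_iff₀ (by linarith)] at h2
  refine h2.trans (mul_le_mul_of_nonneg_left ?_ (by linarith))
  exact_mod_cast Finset.card_le_card h1

/-- If `ε` is small in terms of `K`, then `2 ^ (J / K)` is an admissible base for `δ = 2⁻ᴶ` and all
large `J`: the loss `δ ^ (-ε ^ 2)` is at most about `S ^ (1 / 2)`. -/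
lemma exists_scaleHypotheses {ε : ℝ} (hε : 0 < ε) (hε1 : 34 * ε < 1) {B : ℝ} (hB : 1 ≤ B) {K : ℕ}
    (hK1 : 1 ≤ K) (hK2 : (K : ℝ) * ε ^ 2 ≤ 1 / 2) :
    ∃ R : ℕ, ∀ J : ℕ, K * R ≤ J →
      ScaleHypotheses (2 ^ (J / K)) K ((2 : ℝ)⁻¹ ^ J) (B * ((2 : ℝ)⁻¹ ^ J) ^ (-(ε ^ 2))) := by
  set X : ℝ := 40 * 4 ^ K * B with hX
  have hX0 : 0 < X := by positivity
  refine ⟨10 ^ 12 * (K + 2) ^ 3 * 16 ^ K + (2 * K + 5) ^ (2 * K + 2) + ⌈2 * X ^ 2⌉₊, fun J hJ => ?_⟩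
  set R := 10 ^ 12 * (K + 2) ^ 3 * 16 ^ K + (2 * K + 5) ^ (2 * K + 2) + ⌈2 * X ^ 2⌉₊ with hR
  set m := J / K with hm
  have hRm : R ≤ m := by rw [hm, Nat.le_div_iff_mul_le (by omega), mul_comm]; exact hJ
  have hS : R ≤ 2 ^ m := hRm.trans (Nat.lt_two_pow_self).le
  have hδ0 : (0 : ℝ) < (2 : ℝ)⁻¹ ^ J := by positivity
  have hδ1 : (2 : ℝ)⁻¹ ^ J ≤ 1 := pow_le_one₀ (by norm_num) (by norm_num)
  have e1 : (((2 ^ m : ℕ) : ℝ)) ^ K * (2 : ℝ)⁻¹ ^ J * 2 ^ (J - m * K) = 1 := by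
    have hmK : m * K ≤ J := Nat.div_mul_le_self J K
    have : (2 : ℝ) ^ J = 2 ^ (m * K) * 2 ^ (J - m * K) := by
      rw [← pow_add, Nat.add_sub_cancel' hmK]
    push_cast
    rw [← pow_mul, inv_pow, this]
    field_simp
  have hle : (2 : ℝ) ^ (J - m * K) ≤ 2 ^ K := by
    refine pow_le_pow_right₀ (by norm_num) ?_
    have := Nat.div_add_mod J K
    have h2 := Nat.mod_lt J (show K > 0 by omega)
    rw [← hm, mul_comm] at this
    omega
  have h1 : (((2 ^ m : ℕ) : ℝ)) ^ K * (2 : ℝ)⁻¹ ^ J ≤ 1 := by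
    rw [← e1]
    exact le_mul_of_one_le_right (by positivity) (one_le_pow₀ (by norm_num))
  have h2 : 1 ≤ 2 ^ K * ((((2 ^ m : ℕ) : ℝ)) ^ K * (2 : ℝ)⁻¹ ^ J) := by
    conv_lhs => rw [← e1]
    rw [mul_comm]
    exact mul_le_mul_of_nonneg_right hle (by positivity)
  set S : ℕ := 2 ^ m with hSdef
  have hS1 : (1 : ℝ) ≤ S := by exact_mod_cast Nat.one_le_two_pow
  set δ : ℝ := (2 : ℝ)⁻¹ ^ J with hδ
  have hC1 : 1 ≤ δ ^ (-(ε ^ 2)) :=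
    Real.one_le_rpow_of_pos_of_le_one_of_nonpos hδ0 hδ1 (by nlinarith)
  have hC : δ ^ (-(ε ^ 2)) ≤ (2 * (S : ℝ)) ^ ((1 : ℝ) / 2) := by
    have h3 : δ⁻¹ ≤ (2 * (S : ℝ)) ^ K := by
      rw [inv_le_iff_one_le_mul₀ hδ0, mul_pow]
      linarith
    calc δ ^ (-(ε ^ 2)) = (δ⁻¹) ^ (ε ^ 2) := by
          rw [Real.rpow_neg hδ0.le, Real.inv_rpow hδ0.le]
      _ ≤ ((2 * (S : ℝ)) ^ K) ^ (ε ^ 2) :=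
          Real.rpow_le_rpow (inv_nonneg.2 hδ0.le) h3 (by positivity)
      _ = (2 * (S : ℝ)) ^ ((K : ℝ) * ε ^ 2) := (Real.rpow_natCast_mul (by positivity) _ _).symm
      _ ≤ (2 * (S : ℝ)) ^ ((1 : ℝ) / 2) :=
          Real.rpow_le_rpow_of_exponent_le (by linarith) hK2
  refine ⟨hδ0, one_le_mul_of_one_le_of_one_le hB hC1, h1, h2, by omega, by omega, ?_⟩
  have h4 : 2 * X ^ 2 ≤ S := by
    refine (Nat.le_ceil _).trans ?_
    exact_mod_cast (by omega : ⌈2 * X ^ 2⌉₊ ≤ S)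
  calc 40 * 4 ^ K * (B * δ ^ (-(ε ^ 2))) = X * δ ^ (-(ε ^ 2)) := by rw [hX]; ring
    _ ≤ X * (2 * (S : ℝ)) ^ ((1 : ℝ) / 2) := by gcongr
    _ ≤ S := by
        rw [← Real.sqrt_eq_rpow, ← Real.sqrt_sq hX0.le, ← Real.sqrt_mul (sq_nonneg X)]
        rw [Real.sqrt_le_left (by linarith)]
        nlinarith

/-- **Incidence bound for nice configurations**, in a form with an additional constant in the
hypotheses on the squares. -/
theorem exists_incidence_bound {ε : ℝ} (hε : 0 < ε) {A B : ℝ} (hA : 1 ≤ A) (hB : 1 ≤ B) :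
    ∃ c : ℝ, 0 < c ∧ ∀ (δ Δ s : ℝ) (M : ℕ) (P 𝒯 : Finset (Set Plane)),
      IsDyadicScale δ → 0 < s → s ≤ 1 →
      IsNiceConfiguration A δ s (δ ^ (-(ε ^ 2))) M P 𝒯 →
      (∀ (x : Plane) (ρ : ℝ), Δ < ρ → ρ < 1 → (coveringIn δ P (Metric.ball x ρ) : ℝ)
          ≤ B * δ ^ (-(ε ^ 2)) * ρ ^ (2 - s) * (P.card : ℝ)) →
      (∀ (x : Plane) (ρ : ℝ), δ < ρ → ρ < Δ → (coveringIn δ P (Metric.ball x ρ) : ℝ)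
          ≤ B * δ ^ (-(ε ^ 2)) * (ρ / δ) ^ s) →
      c * δ ^ (34 * ε) *
          min ((M : ℝ) * (P.card : ℝ))
            (min ((M : ℝ) ^ ((3 : ℝ) / 2) * (P.card : ℝ) ^ ((1 : ℝ) / 2)) (δ⁻¹ * (M : ℝ)))
        ≤ (𝒯.card : ℝ) := by
  -- The bound `M / A ≤ |𝒯|` suffices when `δ ^ (34 ε)` is at most a multiple of `δ`.
  have htriv : ∀ (c δ : ℝ) (M : ℕ) (P 𝒯 : Finset (Set Plane)) (s C : ℝ), 0 < c → 0 < δ →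
      IsNiceConfiguration A δ s C M P 𝒯 → c * δ ^ (34 * ε) * δ⁻¹ ≤ A⁻¹ →
      c * δ ^ (34 * ε) *
          min ((M : ℝ) * (P.card : ℝ))
            (min ((M : ℝ) ^ ((3 : ℝ) / 2) * (P.card : ℝ) ^ ((1 : ℝ) / 2)) (δ⁻¹ * (M : ℝ)))
        ≤ (𝒯.card : ℝ) := by
    intro c δ M P 𝒯 s C hc hδ hnice hle
    have hcδ : 0 < c * δ ^ (34 * ε) := mul_pos hc (Real.rpow_pos_of_pos hδ _)
    rcases P.eq_empty_or_nonempty with rfl | hP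
    · refine le_trans (mul_nonpos_of_nonneg_of_nonpos hcδ.le ((min_le_left _ _).trans ?_))
        (Nat.cast_nonneg _)
      simp
    · calc _ ≤ c * δ ^ (34 * ε) * (δ⁻¹ * M) :=
            mul_le_mul_of_nonneg_left ((min_le_right _ _).trans (min_le_right _ _)) hcδ.le
        _ = (c * δ ^ (34 * ε) * δ⁻¹) * M := by ring
        _ ≤ A⁻¹ * M := mul_le_mul_of_nonneg_right hle (Nat.cast_nonneg _)
        _ ≤ 𝒯.card := by
            rw [inv_mul_le_iff₀ (by linarith)]
            exact hnice.le_mul_card hA hP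
  have hA0 : 0 < A := by linarith
  rcases le_or_gt 1 (34 * ε) with hbig | hsmall
  · refine ⟨A⁻¹, inv_pos.2 hA0, ?_⟩
    rintro δ Δ s M P 𝒯 ⟨J, hJ⟩ _ _ hnice _ _
    have hδ0 : 0 < δ := by rw [hJ]; positivity
    have hδ1 : δ ≤ 1 := by rw [hJ]; exact pow_le_one₀ (by norm_num) (by norm_num)
    refine htriv _ δ M P 𝒯 s _ (inv_pos.2 hA0) hδ0 hnice ?_
    have h1 : δ ^ (34 * ε) ≤ δ ^ (1 : ℝ) := Real.rpow_le_rpow_of_exponent_ge hδ0 hδ1 hbig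
    rw [Real.rpow_one] at h1
    rw [mul_assoc]
    refine mul_le_of_le_one_right (inv_nonneg.2 hA0.le) ?_
    rw [← div_eq_mul_inv, div_le_one hδ0]
    exact h1
  -- The number of scales is chosen such that `S ^ 49 ≤ δ ^ (-34 ε)`.
  set K : ℕ := ⌈49 / (34 * ε)⌉₊ with hK
  have hK1 : 1 ≤ K := Nat.one_le_iff_ne_zero.2 (Nat.ceil_pos.2 (by positivity)).ne'
  have hKle : (K : ℝ) < 49 / (34 * ε) + 1 := Nat.ceil_lt_add_one (by positivity)
  have hKge : 49 / (34 * ε) ≤ K := Nat.le_ceil _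
  have hK2 : (K : ℝ) * ε ^ 2 ≤ 1 / 2 := by
    have h1 : (K : ℝ) * ε ^ 2 ≤ (49 / (34 * ε) + 1) * ε ^ 2 := by gcongr
    have h2 : (49 / (34 * ε) + 1) * ε ^ 2 = 49 / 34 * ε + ε ^ 2 := by field_simp
    nlinarith
  obtain ⟨R, hR⟩ := exists_scaleHypotheses hε hsmall (one_le_mul_of_one_le_of_one_le hA hB) hK1 hK2
  set c : ℝ := A⁻¹ * (2⁻¹ ^ (K * R) * 2⁻¹ ^ K) with hc
  have hc0 : 0 < c := by positivity
  refine ⟨c, hc0, ?_⟩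
  rintro δ Δ s M P 𝒯 ⟨J, hJ⟩ hs0 hs1 hnice hcoarse hfine
  have hδ0 : 0 < δ := by rw [hJ]; positivity
  have hδ1 : δ ≤ 1 := by rw [hJ]; exact pow_le_one₀ (by norm_num) (by norm_num)
  have hA1 : A⁻¹ ≤ 1 := inv_le_one_of_one_le₀ hA
  rcases lt_or_ge J (K * R) with hJsmall | hJbig
  · refine htriv c δ M P 𝒯 s _ hc0 hδ0 hnice ?_
    have h1 : δ ^ (34 * ε) ≤ 1 := Real.rpow_le_one hδ0.le hδ1 (by positivity)
    have h2 : (2 : ℝ)⁻¹ ^ (K * R) ≤ δ := by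
      rw [hJ]; exact pow_le_pow_of_le_one (by norm_num) (by norm_num) hJsmall.le
    have h3 : (2 : ℝ)⁻¹ ^ K ≤ 1 := pow_le_one₀ (by norm_num) (by norm_num)
    have h4 : (2 : ℝ)⁻¹ ^ (K * R) * 2⁻¹ ^ K ≤ δ * 1 := by gcongr
    calc c * δ ^ (34 * ε) * δ⁻¹ ≤ (A⁻¹ * (δ * 1)) * 1 * δ⁻¹ := by
          rw [hc]; gcongr
      _ = A⁻¹ := by field_simp
  rcases P.eq_empty_or_nonempty with rfl | hPne
  · refine le_trans (mul_nonpos_of_nonneg_of_nonpos (by positivity) ((min_le_left _ _).trans ?_))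
      (Nat.cast_nonneg _)
    simp
  rcases Nat.eq_zero_or_pos M with rfl | hM
  · refine le_trans (mul_nonpos_of_nonneg_of_nonpos (by positivity) ((min_le_left _ _).trans ?_))
      (Nat.cast_nonneg _)
    simp
  have hSc := hR J hJbig
  rw [← hJ] at hSc
  set S : ℕ := 2 ^ (J / K) with hS
  have hC1 : 1 ≤ δ ^ (-(ε ^ 2)) :=
    Real.one_le_rpow_of_pos_of_le_one_of_nonpos hδ0 hδ1 (by nlinarith)
  obtain ⟨D, Tp, hTp, hspread⟩ := exists_spreadConfiguration hA hB hC1 hSc hJ hs0 hs1 hM hPne hnice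
    hcoarse hfine
  have hmain := hspread.min_le_card_tubes.trans (mul_le_mul_of_nonneg_left
    (Nat.cast_le.2 (Finset.card_le_card (Finset.biUnion_subset.2 hTp)))
    (scalePow_pos hSc.one_le_S 49).le)
  have hSK : (S : ℝ) ^ K ≤ δ⁻¹ := by
    rw [← one_div, le_div_iff₀ hδ0]; exact hSc.pow_mul_le
  have hloss : scalePow S 49 ≤ δ ^ (-(34 * ε)) := by
    have hS0 : (0 : ℝ) ≤ S := Nat.cast_nonneg _
    have hK0 : (0 : ℝ) < K := by exact_mod_cast hK1
    have e : scalePow S 49 = ((S : ℝ) ^ K) ^ ((49 : ℝ) / K) := by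
      unfold scalePow
      rw [← Real.rpow_natCast_mul hS0]
      congr 1
      field_simp
    rw [e, Real.rpow_neg hδ0.le, ← Real.inv_rpow hδ0.le]
    refine (Real.rpow_le_rpow (pow_nonneg hS0 _) hSK (by positivity)).trans ?_
    refine Real.rpow_le_rpow_of_exponent_le ((one_le_inv₀ hδ0).2 hδ1) ?_
    rw [div_le_iff₀ hK0]
    rw [div_le_iff₀ (by positivity)] at hKge
    linarith
  set m₁ := (M : ℝ) * (P.card : ℝ) with hm₁
  set m₂ := (M : ℝ) ^ ((3 : ℝ) / 2) * (P.card : ℝ) ^ ((1 : ℝ) / 2) with hm₂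
  have hm₁0 : 0 ≤ m₁ := by positivity
  have hm₂0 : 0 ≤ m₂ := by positivity
  have hM0 : (0 : ℝ) ≤ M := Nat.cast_nonneg _
  have hcmp : 2⁻¹ ^ K * min m₁ (min m₂ (δ⁻¹ * M)) ≤ min m₁ (min m₂ ((S : ℝ) ^ K * M)) := by
    have h2 : (0 : ℝ) ≤ 2⁻¹ ^ K := by positivity
    have h3 : (2 : ℝ)⁻¹ ^ K ≤ 1 := pow_le_one₀ (by norm_num) (by norm_num)
    refine le_min ?_ (le_min ?_ ?_)
    · exact (mul_le_mul_of_nonneg_left (min_le_left _ _) h2).trans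
        (mul_le_of_le_one_left hm₁0 h3)
    · exact (mul_le_mul_of_nonneg_left ((min_le_right _ _).trans (min_le_left _ _)) h2).trans
        (mul_le_of_le_one_left hm₂0 h3)
    · refine (mul_le_mul_of_nonneg_left ((min_le_right _ _).trans (min_le_right _ _)) h2).trans ?_
      rw [← mul_assoc]
      refine mul_le_mul_of_nonneg_right ?_ hM0
      have h4 := hSc.le_pow_mul
      have e : (2 : ℝ)⁻¹ ^ K * 2 ^ K = 1 := by rw [← mul_pow]; norm_num
      have h5 : δ⁻¹ ≤ 2 ^ K * (S : ℝ) ^ K := by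
        rw [inv_le_iff_one_le_mul₀ hδ0]; linarith
      calc (2 : ℝ)⁻¹ ^ K * δ⁻¹ ≤ 2⁻¹ ^ K * (2 ^ K * (S : ℝ) ^ K) := by gcongr
        _ = (2⁻¹ ^ K * 2 ^ K) * (S : ℝ) ^ K := by ring
        _ = (S : ℝ) ^ K := by rw [e, one_mul]
  have hcK : c ≤ 2⁻¹ ^ K := by
    have h3 : (2 : ℝ)⁻¹ ^ (K * R) ≤ 1 := pow_le_one₀ (by norm_num) (by norm_num)
    calc c ≤ 1 * (1 * 2⁻¹ ^ K) := by rw [hc]; gcongr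
      _ = _ := by ring
  have hmin0 : 0 ≤ min m₁ (min m₂ (δ⁻¹ * M)) :=
    le_min hm₁0 (le_min hm₂0 (by positivity))
  have hδε : 0 ≤ δ ^ (34 * ε) := (Real.rpow_pos_of_pos hδ0 _).le
  calc c * δ ^ (34 * ε) * min m₁ (min m₂ (δ⁻¹ * M))
      ≤ 2⁻¹ ^ K * δ ^ (34 * ε) * min m₁ (min m₂ (δ⁻¹ * M)) := by gcongr
    _ = δ ^ (34 * ε) * (2⁻¹ ^ K * min m₁ (min m₂ (δ⁻¹ * M))) := by ring
    _ ≤ δ ^ (34 * ε) * (scalePow S 49 * (𝒯.card : ℝ)) :=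
        mul_le_mul_of_nonneg_left (hcmp.trans hmain) hδε
    _ ≤ δ ^ (34 * ε) * (δ ^ (-(34 * ε)) * (𝒯.card : ℝ)) := by gcongr
    _ = 𝒯.card := by
        rw [← mul_assoc, ← Real.rpow_add hδ0, add_neg_cancel, Real.rpow_zero, one_mul]

/-! ### From dyadic squares to balls, and the Furstenberg bound -/

/-- A ball of radius at most `ρ` is covered by `16` squares of side `ρ`. -/
lemma coveringIn_ball_le {δ : ℝ} (hδ : 0 < δ) {P : Finset (Set Plane)}
    (hP : ∀ Q ∈ P, ∃ a b : ℤ, Q = dyadicCube δ a b) {ρ C : ℝ} (hρ : 0 < ρ)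
    (hC : ∀ a b : ℤ, (coveringIn δ P (dyadicCube ρ a b) : ℝ) ≤ C) (x : Plane) {r : ℝ}
    (hr : r ≤ ρ) : (coveringIn δ P (Metric.ball x r) : ℝ) ≤ 16 * C := by
  classical
  have hex : ∀ Q : Set Plane, ∃ y : Plane,
      (Q ∩ Metric.ball x r).Nonempty → y ∈ Q ∩ Metric.ball x r := fun Q => by
    by_cases h : (Q ∩ Metric.ball x r).Nonempty
    · exact ⟨h.some, fun _ => h.some_mem⟩
    · exact ⟨0, fun h' => absurd h' h⟩
  choose y hy using hex
  have hC0 : 0 ≤ C := (Nat.cast_nonneg _).trans (hC 0 0)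
  set B : Fin 2 → Finset ℤ := fun i => Finset.Icc ⌊x i / ρ - 1⌋ ⌊x i / ρ + 1⌋ with hB
  have hcoord : ∀ {z : Plane}, z ∈ Metric.ball x r → ∀ i, ⌊z i / ρ⌋ ∈ B i := by
    intro z hz i
    refine mem_Icc_floor ?_
    rw [← sub_div, abs_div, abs_of_pos hρ, div_le_one hρ]
    have h1 := PiLp.norm_apply_le (z - x) i
    rw [PiLp.sub_apply, Real.norm_eq_abs] at h1
    rw [Metric.mem_ball, dist_eq_norm] at hz
    linarith
  have hBcard : ∀ i, ((B i).card : ℝ) ≤ 4 := fun i =>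
    (card_Icc_floor_le _ _ zero_le_one).trans (by norm_num)
  rw [coveringIn_eq hδ hP]
  have h1 := card_le_card_mul_of_fiber
    (A := P.filter fun Q => (Q ∩ Metric.ball x r).Nonempty) (B := B 0 ×ˢ B 1)
    (fun Q => (⌊y Q 0 / ρ⌋, ⌊y Q 1 / ρ⌋)) (C := C) ?_ ?_
  · refine h1.trans (mul_le_mul_of_nonneg_right ?_ hC0)
    rw [Finset.card_product]
    push_cast
    calc ((B 0).card : ℝ) * (B 1).card ≤ 4 * 4 := by gcongr <;> exact hBcard _
      _ = 16 := by norm_num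
  · intro Q hQ
    have hyQ := (hy Q (Finset.mem_filter.1 hQ).2).2
    exact Finset.mem_product.2 ⟨hcoord hyQ 0, hcoord hyQ 1⟩
  · rintro ⟨a, b⟩ -
    refine le_trans ?_ (hC a b)
    rw [coveringIn_eq hδ hP]
    refine Nat.cast_le.2 (Finset.card_le_card fun Q hQ => ?_)
    obtain ⟨hQ1, hQ2⟩ := Finset.mem_filter.1 hQ
    obtain ⟨hQP, hQr⟩ := Finset.mem_filter.1 hQ1
    refine Finset.mem_filter.2 ⟨hQP, y Q, (hy Q hQr).1, ?_⟩
    rw [mem_dyadicCube_iff hρ]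
    exact ⟨congrArg Prod.fst hQ2, congrArg Prod.snd hQ2⟩

/-- A bound for the dyadic squares gives one for the balls, by comparison of a ball of radius `r`
with dyadic squares of side in `[r, 2r)`. -/
lemma coveringIn_ball_le_max {δ s A C : ℝ} (hδ : 0 < δ) (hs0 : 0 < s) (hs1 : s ≤ 1)
    {P : Finset (Set Plane)} (hP : ∀ Q ∈ P, ∃ a b : ℤ, Q = dyadicCube δ a b)
    (hA : 0 ≤ A) (hC : 0 ≤ C)
    (h : ∀ ρ : ℝ, IsDyadicScale ρ → δ ≤ ρ →
      ∀ Q ∈ dyadicCubes ρ (⋃₀ (P : Set (Set Plane))), (coveringIn δ P Q : ℝ)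
        ≤ A * C * max (ρ ^ (2 - s) * (P.card : ℝ)) ((ρ / δ) ^ s))
    (x : Plane) {r : ℝ} (hr : δ < r) (hr1 : r ≤ 1) :
    (coveringIn δ P (Metric.ball x r) : ℝ)
      ≤ 64 * A * C * max (r ^ (2 - s) * (P.card : ℝ)) ((r / δ) ^ s) := by
  have hr0 : 0 < r := hδ.trans hr
  obtain ⟨n, hn1, hn2⟩ := exists_nat_pow_near_of_lt_one hr0 hr1
    (show (0 : ℝ) < 2⁻¹ by norm_num) (by norm_num)
  set ρ : ℝ := (2 : ℝ)⁻¹ ^ n with hρ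
  have hρ0 : 0 < ρ := by positivity
  have hρr : ρ ≤ 2 * r := by rw [pow_succ] at hn1; linarith
  have hcell : ∀ a b : ℤ, (coveringIn δ P (dyadicCube ρ a b) : ℝ)
      ≤ A * C * max (ρ ^ (2 - s) * (P.card : ℝ)) ((ρ / δ) ^ s) := by
    intro a b
    by_cases hmeet : (dyadicCube ρ a b ∩ ⋃₀ (P : Set (Set Plane))).Nonempty
    · exact h ρ ⟨n, rfl⟩ (by linarith) _ ⟨⟨a, b, rfl⟩, hmeet⟩
    · rw [Set.not_nonempty_iff_eq_empty, Set.inter_comm] at hmeet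
      have : coveringIn δ P (dyadicCube ρ a b) = 0 := by
        unfold coveringIn coveringNumber dyadicCubes
        rw [hmeet]
        simp
      rw [this, Nat.cast_zero]
      exact mul_nonneg (mul_nonneg hA hC) ((Real.rpow_nonneg (by positivity) _).trans
        (le_max_right _ _))
  refine (coveringIn_ball_le hδ hP hρ0 hcell x hn2).trans ?_
  have h4 : ∀ e : ℝ, e ≤ 2 → (2 : ℝ) ^ e ≤ 4 := fun e he =>
    (Real.rpow_le_rpow_of_exponent_le one_le_two he).trans (by norm_num)
  have hmax : max (ρ ^ (2 - s) * (P.card : ℝ)) ((ρ / δ) ^ s)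
      ≤ 4 * max (r ^ (2 - s) * (P.card : ℝ)) ((r / δ) ^ s) := by
    refine max_le ?_ ?_
    · refine le_trans ?_ (mul_le_mul_of_nonneg_left (le_max_left _ _) (by norm_num))
      rw [← mul_assoc]
      refine mul_le_mul_of_nonneg_right ?_ (Nat.cast_nonneg _)
      calc ρ ^ (2 - s) ≤ (2 * r) ^ (2 - s) := Real.rpow_le_rpow hρ0.le hρr (by linarith)
        _ = 2 ^ (2 - s) * r ^ (2 - s) := Real.mul_rpow (by norm_num) hr0.le
        _ ≤ 4 * r ^ (2 - s) := mul_le_mul_of_nonneg_right (h4 _ (by linarith))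
            (Real.rpow_nonneg hr0.le _)
    · refine le_trans ?_ (mul_le_mul_of_nonneg_left (le_max_right _ _) (by norm_num))
      have hrδ : 0 ≤ r / δ := by positivity
      calc (ρ / δ) ^ s ≤ (2 * (r / δ)) ^ s := by
            refine Real.rpow_le_rpow (by positivity) ?_ hs0.le
            rw [← mul_div_assoc]
            exact div_le_div_of_nonneg_right hρr hδ.le
        _ = 2 ^ s * (r / δ) ^ s := Real.mul_rpow (by norm_num) hrδ
        _ ≤ 4 * (r / δ) ^ s := mul_le_mul_of_nonneg_right (h4 _ (by linarith))
            (Real.rpow_nonneg hrδ _)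
  calc 16 * (A * C * max (ρ ^ (2 - s) * (P.card : ℝ)) ((ρ / δ) ^ s))
      ≤ 16 * (A * C * (4 * max (r ^ (2 - s) * (P.card : ℝ)) ((r / δ) ^ s))) := by gcongr
    _ = _ := by ring

/-- The non-concentration of the tubes at scale `δ` bounds their number from below. -/
lemma IsNiceConfiguration.rpow_le {A δ s η : ℝ} {M : ℕ} {P 𝒯 : Finset (Set Plane)}
    (h : IsNiceConfiguration A δ s (δ ^ (-η)) M P 𝒯) (hA : 1 ≤ A) (hs1 : s ≤ 1)
    (hδ : IsDyadicScale δ) (hδ1 : δ < 1) (hP : P.Nonempty) :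
    (2 * A)⁻¹ * δ ^ (η - s) ≤ M := by
  classical
  obtain ⟨J, hJ⟩ := hδ
  have hδ0 : 0 < δ := by rw [hJ]; positivity
  have hJ0 : J ≠ 0 := by rintro rfl; rw [hJ] at hδ1; norm_num at hδ1
  have hδJ : 1 / ((2 : ℕ) : ℝ) ^ J = δ := by rw [hJ, inv_pow, one_div, Nat.cast_ofNat]
  have h2δ : 2 * δ ≤ 1 := by
    rw [hJ]
    have : (2 : ℝ)⁻¹ ^ J ≤ 2⁻¹ := pow_le_of_le_one (by norm_num) (by norm_num) hJ0
    linarith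
  obtain ⟨p, hp⟩ := hP
  obtain ⟨𝒯p, _, hset, _, hcard, _⟩ := h.nice p hp
  have hne : 𝒯p.Nonempty := by
    obtain ⟨𝒬, _, himage, ⟨_, Q, hQ, _⟩, _⟩ := hset
    have : dualSet Q ∈ (𝒯p : Set (Set Plane)) := himage ▸ Set.mem_image_of_mem _ hQ
    exact ⟨_, this⟩
  obtain ⟨T, hT⟩ := hne
  have h1 := hset.card_filter_cell_le hδ0 (S := 2) (n := J) one_le_two
    (by rw [hδJ]; linarith) (by rw [hδJ]; exact h2δ) (cell 2 J (tubePar δ T))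
  rw [hδJ] at h1
  have h2 : (1 : ℝ) ≤
      ((𝒯p.filter fun T' => cell 2 J (tubePar δ T') = cell 2 J (tubePar δ T)).card : ℝ) := by
    exact Nat.one_le_cast.2 (Finset.card_pos.2 ⟨T, Finset.mem_filter.2 ⟨hT, rfl⟩⟩)
  have h3 : (2 * δ) ^ s ≤ 2 * δ ^ s := by
    rw [Real.mul_rpow (by norm_num) hδ0.le]
    refine mul_le_mul_of_nonneg_right ?_ (Real.rpow_nonneg hδ0.le _)
    exact (Real.rpow_le_rpow_of_exponent_le one_le_two hs1).trans (by norm_num)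
  have hη0 : 0 < δ ^ (-η) := Real.rpow_pos_of_pos hδ0 _
  have hs' : 0 < δ ^ s := Real.rpow_pos_of_pos hδ0 _
  have h4 : (1 : ℝ) ≤ δ ^ (-η) * (2 * δ ^ s) * (A * M) :=
    (h2.trans h1).trans (by gcongr)
  have e1 : δ ^ (η - s) * (δ ^ (-η) * δ ^ s) = 1 := by
    rw [← Real.rpow_add hδ0, ← Real.rpow_add hδ0]
    convert Real.rpow_zero δ using 2
    ring
  have hp0 : 0 < δ ^ (η - s) := Real.rpow_pos_of_pos hδ0 _
  rw [inv_mul_le_iff₀ (by linarith)]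
  calc δ ^ (η - s) = δ ^ (η - s) * 1 := (mul_one _).symm
    _ ≤ δ ^ (η - s) * (δ ^ (-η) * (2 * δ ^ s) * (A * M)) := by gcongr
    _ = (δ ^ (η - s) * (δ ^ (-η) * δ ^ s)) * (2 * A * M) := by ring
    _ = 2 * A * M := by rw [e1, one_mul]

/-- At the scale `Δ = δ ^ ((t - s) / (2 - 2 s))` the two terms `ρ ^ (2 - s) δ ^ (-t)` and
`(ρ / δ) ^ s` agree; the first dominates above it and the second below it. -/
lemma rpow_compare_of_threshold {δ s t ρ : ℝ} (hδ : 0 < δ) (hδρ : δ < ρ)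
    (hs1 : s ≤ 1) (hst : s ≤ t) (hts : t ≤ 2 - s) :
    (δ ^ ((t - s) / (2 - 2 * s)) < ρ → (ρ / δ) ^ s ≤ ρ ^ (2 - s) * δ ^ (-t)) ∧
      (ρ < δ ^ ((t - s) / (2 - 2 * s)) → ρ ^ (2 - s) * δ ^ (-t) ≤ (ρ / δ) ^ s) := by
  have hρ0 : 0 < ρ := hδ.trans hδρ
  set Δ := δ ^ ((t - s) / (2 - 2 * s)) with hΔ
  have hΔ0 : 0 < Δ := Real.rpow_pos_of_pos hδ _
  have hΔe : Δ ^ (2 - 2 * s) = δ ^ (t - s) := by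
    rw [hΔ, ← Real.rpow_mul hδ.le]
    -- For `s = 1` the exponent is `0 / 0 = 0`, but then `t = 1` and there is nothing to prove.
    rcases hs1.eq_or_lt with rfl | hlt
    · have : t = 1 := by linarith
      subst this
      norm_num
    · rw [div_mul_cancel₀ _ (by linarith)]
  have e1 : ρ ^ (2 - s) * δ ^ (-t) = (ρ ^ (2 - 2 * s) * δ ^ (-(t - s))) * (ρ / δ) ^ s := by
    rw [Real.div_rpow hρ0.le hδ.le, div_eq_mul_inv, ← Real.rpow_neg hδ.le]
    have a1 : ρ ^ (2 - s) = ρ ^ (2 - 2 * s) * ρ ^ s := by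
      rw [← Real.rpow_add hρ0]; congr 1; ring
    have a2 : δ ^ (-t) = δ ^ (-(t - s)) * δ ^ (-s) := by
      rw [← Real.rpow_add hδ]; congr 1; ring
    rw [a1, a2]; ring
  have hpos : 0 ≤ (ρ / δ) ^ s := Real.rpow_nonneg (by positivity) _
  have hδt : 0 < δ ^ (-(t - s)) := Real.rpow_pos_of_pos hδ _
  have e2 : Δ ^ (2 - 2 * s) * δ ^ (-(t - s)) = 1 := by
    rw [hΔe, ← Real.rpow_add hδ, add_neg_cancel, Real.rpow_zero]
  rw [e1]
  refine ⟨fun hlt => ?_, fun hlt => ?_⟩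
  · refine le_mul_of_one_le_left hpos ?_
    rw [← e2]
    exact mul_le_mul_of_nonneg_right (Real.rpow_le_rpow hΔ0.le hlt.le (by linarith)) hδt.le
  · refine mul_le_of_le_one_left hpos ?_
    rw [← e2]
    exact mul_le_mul_of_nonneg_right (Real.rpow_le_rpow hρ0.le hlt.le (by linarith)) hδt.le

/-- Under the hypotheses of the Furstenberg bound, each term of the minimum in the incidence bound
is at least a multiple of `δ ^ (η / 2 - (s + t) / 2) M`. -/
lemma rpow_mul_le_min {A δ s t η M W : ℝ} (hA : 1 ≤ A) (hδ0 : 0 < δ) (hδ1 : δ ≤ 1) (hη : 0 ≤ η)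
    (hst : s ≤ t) (hts : t ≤ 2 - s) (hM : (2 * A)⁻¹ * δ ^ (η - s) ≤ M)
    (hW : A⁻¹ * δ ^ (-t) ≤ W) :
    (2 * A ^ 2)⁻¹ * δ ^ (η / 2 - (s + t) / 2) * M
      ≤ min (M * W) (min (M ^ ((3 : ℝ) / 2) * W ^ ((1 : ℝ) / 2)) (δ⁻¹ * M)) := by
  have hA0 : 0 < A := by linarith
  have hM0 : 0 < M := lt_of_lt_of_le (mul_pos (by positivity) (Real.rpow_pos_of_pos hδ0 _)) hM
  have hW0 : 0 < W := lt_of_lt_of_le (mul_pos (by positivity) (Real.rpow_pos_of_pos hδ0 _)) hW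
  have hc1 : (2 * A ^ 2)⁻¹ ≤ 1 := inv_le_one_of_one_le₀ (by nlinarith)
  have hcA : (2 * A ^ 2)⁻¹ ≤ A⁻¹ := inv_anti₀ hA0 (by nlinarith)
  have hδp : 0 < δ ^ (η / 2 - (s + t) / 2) := Real.rpow_pos_of_pos hδ0 _
  refine le_min ?_ (le_min ?_ ?_)
  · rw [mul_comm M W]
    refine mul_le_mul_of_nonneg_right (le_trans ?_ hW) hM0.le
    refine mul_le_mul hcA ?_ hδp.le (by positivity)
    exact Real.rpow_le_rpow_of_exponent_ge hδ0 hδ1 (by linarith)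
  · have e : M ^ ((3 : ℝ) / 2) * W ^ ((1 : ℝ) / 2) = (M * W) ^ ((1 : ℝ) / 2) * M := by
      rw [Real.mul_rpow hM0.le hW0.le]
      have : M ^ ((3 : ℝ) / 2) = M ^ ((1 : ℝ) / 2) * M := by
        rw [← Real.rpow_add_one hM0.ne']; norm_num
      rw [this]; ring
    rw [e]
    refine mul_le_mul_of_nonneg_right ?_ hM0.le
    have h1 : (2 * A ^ 2)⁻¹ * δ ^ (η - s - t) ≤ M * W := by
      have := mul_le_mul hM hW (mul_pos (by positivity) (Real.rpow_pos_of_pos hδ0 _)).le hM0.le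
      refine le_trans (le_of_eq ?_) this
      rw [show η - s - t = (η - s) + (-t) by ring, Real.rpow_add hδ0]
      field_simp
    have h2 := Real.rpow_le_rpow (mul_pos (by positivity) (Real.rpow_pos_of_pos hδ0 _)).le h1
      (show (0 : ℝ) ≤ 1 / 2 by norm_num)
    refine le_trans ?_ h2
    rw [Real.mul_rpow (by positivity) (Real.rpow_nonneg hδ0.le _), ← Real.rpow_mul hδ0.le]
    refine mul_le_mul ?_ (le_of_eq (by congr 1; ring)) hδp.le (by positivity)
    calc (2 * A ^ 2)⁻¹ = ((2 * A ^ 2)⁻¹) ^ (1 : ℝ) := (Real.rpow_one _).symm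
      _ ≤ _ := Real.rpow_le_rpow_of_exponent_ge (by positivity) hc1 (by norm_num)
  · refine mul_le_mul_of_nonneg_right ?_ hM0.le
    calc (2 * A ^ 2)⁻¹ * δ ^ (η / 2 - (s + t) / 2) ≤ 1 * δ ^ (-1 : ℝ) := by
          refine mul_le_mul hc1 ?_ hδp.le zero_le_one
          exact Real.rpow_le_rpow_of_exponent_ge hδ0 hδ1 (by linarith)
      _ = δ⁻¹ := by rw [one_mul, Real.rpow_neg_one]

/-- **Furstenberg bound** for semi-well-spaced squares, from the incidence bound with the exponent
`ε / 35` and the threshold `Δ = δ ^ ((t - s) / (2 - 2 s))`. -/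
theorem exists_furstenberg_bound {ε : ℝ} (hε : 0 < ε) {A : ℝ} (hA : 1 ≤ A) :
    ∃ c : ℝ, 0 < c ∧ ∀ (s t δ : ℝ) (M : ℕ) (P 𝒯 : Finset (Set Plane)),
      0 < s → s ≤ 1 → s ≤ t → t ≤ 2 - s → IsDyadicScale δ → δ < 1 →
      IsNiceConfiguration A δ s (δ ^ (-(ε ^ 2 / 1225))) M P 𝒯 →
      A⁻¹ * δ ^ (-t) ≤ (P.card : ℝ) → (P.card : ℝ) ≤ A * δ ^ (-t) →
      (∀ ρ : ℝ, IsDyadicScale ρ → δ ≤ ρ →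
        ∀ Q ∈ dyadicCubes ρ (⋃₀ (P : Set (Set Plane))),
          (coveringIn δ P Q : ℝ) ≤ A * δ ^ (-(ε ^ 2 / 1225)) *
            max (ρ ^ (2 - s) * (P.card : ℝ)) ((ρ / δ) ^ s)) →
      c * δ ^ (-((s + t) / 2) + ε) * (M : ℝ) ≤ (𝒯.card : ℝ) := by
  have hA0 : 0 < A := by linarith
  have hPne : ∀ {δ t : ℝ} {P : Finset (Set Plane)}, 0 < δ → A⁻¹ * δ ^ (-t) ≤ (P.card : ℝ) →
      P.Nonempty := by
    intro δ t P hδ h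
    have : (0 : ℝ) < P.card :=
      lt_of_lt_of_le (mul_pos (by positivity) (Real.rpow_pos_of_pos hδ _)) h
    exact Finset.card_pos.1 (by exact_mod_cast this)
  rcases le_total 1 ε with hε1 | hε1
  · refine ⟨A⁻¹, by positivity, ?_⟩
    intro s t δ M P 𝒯 hs0 hs1 hst hts ⟨J, hJ⟩ hδ1 hnice hW1 _ _
    have hδ0 : 0 < δ := by rw [hJ]; positivity
    have h1 := hnice.le_mul_card hA (hPne hδ0 hW1)
    have h2 : δ ^ (-((s + t) / 2) + ε) ≤ 1 :=
      Real.rpow_le_one hδ0.le hδ1.le (by linarith)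
    calc A⁻¹ * δ ^ (-((s + t) / 2) + ε) * (M : ℝ) ≤ A⁻¹ * 1 * (A * 𝒯.card) := by gcongr
      _ = 𝒯.card := by field_simp
  · -- The losses are `34 ε / 35` in the incidence bound and `η / 2` in the minimum.
    obtain ⟨c, hc, H⟩ := exists_incidence_bound (ε := ε / 35) (by positivity) hA
      (B := 64 * A ^ 2) (by nlinarith)
    refine ⟨c * (2 * A ^ 2)⁻¹, by positivity, ?_⟩
    intro s t δ M P 𝒯 hs0 hs1 hst hts hδ hδ1 hnice hW1 hW2 hcov
    obtain ⟨J, hJ⟩ := id hδ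
    have hδ0 : 0 < δ := by rw [hJ]; positivity
    have hP := hPne hδ0 hW1
    have hη : ε ^ 2 / 1225 = (ε / 35) ^ 2 := by ring
    have hCη : 0 ≤ δ ^ (-(ε ^ 2 / 1225)) := Real.rpow_nonneg hδ0.le _
    have hball := fun (x : Plane) (ρ : ℝ) (h1 : δ < ρ) (h2 : ρ ≤ 1) =>
      coveringIn_ball_le_max hδ0 hs0 hs1 (fun Q hQ => (hnice.cubes Q hQ).1) hA0.le hCη hcov x h1 h2
    have hmin := rpow_mul_le_min hA hδ0 hδ1.le (show 0 ≤ ε ^ 2 / 1225 by positivity) hst hts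
      (hnice.rpow_le hA hs1 hδ hδ1 hP) hW1
    have hδΔ : δ ≤ δ ^ ((t - s) / (2 - 2 * s)) := by
      conv_lhs => rw [← Real.rpow_one δ]
      refine Real.rpow_le_rpow_of_exponent_ge hδ0 hδ1.le ?_
      exact div_le_one_of_le₀ (by linarith) (by linarith)
    have hW1' : δ ^ (-t) ≤ A * P.card := by rwa [inv_mul_le_iff₀ hA0] at hW1
    have hcoarse : ∀ (x : Plane) (ρ : ℝ), δ ^ ((t - s) / (2 - 2 * s)) < ρ → ρ < 1 →
        (coveringIn δ P (Metric.ball x ρ) : ℝ)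
          ≤ 64 * A ^ 2 * δ ^ (-((ε / 35) ^ 2)) * ρ ^ (2 - s) * (P.card : ℝ) := by
      intro x ρ h1 h2
      have hδρ := hδΔ.trans_lt h1
      have hρ0 := hδ0.trans hδρ
      refine (hball x ρ hδρ h2.le).trans ?_
      have hX : 0 ≤ ρ ^ (2 - s) := Real.rpow_nonneg hρ0.le _
      have h3 : max (ρ ^ (2 - s) * (P.card : ℝ)) ((ρ / δ) ^ s)
          ≤ A * (ρ ^ (2 - s) * P.card) := by
        refine max_le (le_mul_of_one_le_left (by positivity) hA) ?_
        refine ((rpow_compare_of_threshold hδ0 hδρ hs1 hst hts).1 h1).trans ?_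
        calc ρ ^ (2 - s) * δ ^ (-t) ≤ ρ ^ (2 - s) * (A * P.card) := by gcongr
          _ = _ := by ring
      rw [hη] at hCη ⊢
      calc _ ≤ 64 * A * δ ^ (-((ε / 35) ^ 2)) * (A * (ρ ^ (2 - s) * P.card)) := by gcongr
        _ = _ := by ring
    have hfine : ∀ (x : Plane) (ρ : ℝ), δ < ρ → ρ < δ ^ ((t - s) / (2 - 2 * s)) →
        (coveringIn δ P (Metric.ball x ρ) : ℝ)
          ≤ 64 * A ^ 2 * δ ^ (-((ε / 35) ^ 2)) * (ρ / δ) ^ s := by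
      intro x ρ h1 h2
      have hρ0 := hδ0.trans h1
      have hρ1 : ρ < 1 := h2.trans_le (Real.rpow_le_one hδ0.le hδ1.le
        (div_nonneg (by linarith) (by linarith)))
      refine (hball x ρ h1 hρ1.le).trans ?_
      have hX : 0 ≤ ρ ^ (2 - s) := Real.rpow_nonneg hρ0.le _
      have hY : 0 ≤ (ρ / δ) ^ s := Real.rpow_nonneg (by positivity) _
      have h3 : max (ρ ^ (2 - s) * (P.card : ℝ)) ((ρ / δ) ^ s) ≤ A * (ρ / δ) ^ s := by
        refine max_le ?_ (le_mul_of_one_le_left hY hA)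
        calc ρ ^ (2 - s) * (P.card : ℝ) ≤ ρ ^ (2 - s) * (A * δ ^ (-t)) := by gcongr
          _ = A * (ρ ^ (2 - s) * δ ^ (-t)) := by ring
          _ ≤ _ := mul_le_mul_of_nonneg_left
              ((rpow_compare_of_threshold hδ0 h1 hs1 hst hts).2 h2) hA0.le
      rw [hη] at hCη ⊢
      calc _ ≤ 64 * A * δ ^ (-((ε / 35) ^ 2)) * (A * (ρ / δ) ^ s) := by gcongr
        _ = _ := by ring
    have hnice' := hnice
    rw [hη] at hnice'
    have hfinal := H δ _ s M P 𝒯 hδ hs0 hs1 hnice' hcoarse hfine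
    refine le_trans ?_ hfinal
    have hδ34 : 0 < δ ^ (34 * (ε / 35)) := Real.rpow_pos_of_pos hδ0 _
    refine le_trans ?_ (mul_le_mul_of_nonneg_left hmin (mul_pos hc hδ34).le)
    have hexp : δ ^ (-((s + t) / 2) + ε)
        ≤ δ ^ (34 * (ε / 35)) * δ ^ (ε ^ 2 / 1225 / 2 - (s + t) / 2) := by
      rw [← Real.rpow_add hδ0]
      refine Real.rpow_le_rpow_of_exponent_ge hδ0 hδ1.le ?_
      nlinarith
    calc c * (2 * A ^ 2)⁻¹ * δ ^ (-((s + t) / 2) + ε) * (M : ℝ)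
        ≤ c * (2 * A ^ 2)⁻¹ *
          (δ ^ (34 * (ε / 35)) * δ ^ (ε ^ 2 / 1225 / 2 - (s + t) / 2)) * (M : ℝ) := by gcongr
      _ = _ := by ring

end Furstenberg

theorem mainTheorem5 :
    -- the semi-well-spaced incidence bound
    (∀ ε : ℝ, 0 < ε → ∀ A : ℝ, 1 ≤ A → ∃ c : ℝ, 0 < c ∧
      ∀ (δ Δ s : ℝ) (M : ℕ) (P 𝒯 : Finset (Set Furstenberg.Plane)),
        Furstenberg.IsDyadicScale δ → Furstenberg.IsDyadicScale Δ → δ ≤ Δ →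
        0 < s → s ≤ 1 →
        Furstenberg.IsNiceConfiguration A δ s (δ ^ (-(ε ^ 2))) M P 𝒯 →
        (∀ (x : Furstenberg.Plane) (ρ : ℝ), Δ < ρ → ρ < 1 →
          (Furstenberg.coveringIn δ P (Metric.ball x ρ) : ℝ)
            ≤ δ ^ (-(ε ^ 2)) * ρ ^ (2 - s) * (P.card : ℝ)) →
        (∀ (x : Furstenberg.Plane) (ρ : ℝ), δ < ρ → ρ < Δ →
          (Furstenberg.coveringIn δ P (Metric.ball x ρ) : ℝ)
            ≤ δ ^ (-(ε ^ 2)) * (ρ / δ) ^ s) →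
        c * δ ^ (35 * ε) *
            min ((M : ℝ) * (P.card : ℝ))
              (min ((M : ℝ) ^ ((3 : ℝ) / 2) * (P.card : ℝ) ^ ((1 : ℝ) / 2))
                (δ⁻¹ * (M : ℝ)))
          ≤ (𝒯.card : ℝ)) ∧
    -- the resulting Furstenberg bound
    (∀ ε : ℝ, 0 < ε → ∀ A : ℝ, 1 ≤ A → ∃ c : ℝ, 0 < c ∧
      ∀ s t : ℝ, 0 < s → s ≤ 1 → s ≤ t → t ≤ 2 - s → ∃ δ₀ : ℝ, 0 < δ₀ ∧
      ∀ (δ : ℝ) (M : ℕ) (P 𝒯 : Finset (Set Furstenberg.Plane)),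
        Furstenberg.IsDyadicScale δ → δ < δ₀ →
        Furstenberg.IsNiceConfiguration A δ s (δ ^ (-(ε ^ 2 / 1225))) M P 𝒯 →
        A⁻¹ * δ ^ (-t) ≤ (P.card : ℝ) → (P.card : ℝ) ≤ A * δ ^ (-t) →
        (∀ ρ : ℝ, Furstenberg.IsDyadicScale ρ → δ ≤ ρ →
          ∀ Q ∈ Furstenberg.dyadicCubes ρ (⋃₀ (P : Set (Set Furstenberg.Plane))),
            (Furstenberg.coveringIn δ P Q : ℝ)
              ≤ A * δ ^ (-(ε ^ 2 / 1225)) *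
                  max (ρ ^ (2 - s) * (P.card : ℝ)) ((ρ / δ) ^ s)) →
        c * δ ^ (-((s + t) / 2) + ε) * (M : ℝ) ≤ (𝒯.card : ℝ)) := by
  refine ⟨fun ε hε A hA => ?_, fun ε hε A hA => ?_⟩
  · obtain ⟨c, hc, H⟩ := Furstenberg.exists_incidence_bound hε hA le_rfl
    refine ⟨c, hc, fun δ Δ s M P 𝒯 hδ _ _ hs0 hs1 hnice hcoarse hfine => ?_⟩
    obtain ⟨J, hJ⟩ := id hδ
    have hδ0 : 0 < δ := by rw [hJ]; positivity
    have hδ1 : δ ≤ 1 := by rw [hJ]; exact pow_le_one₀ (by norm_num) (by norm_num)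
    refine le_trans (mul_le_mul_of_nonneg_right (mul_le_mul_of_nonneg_left ?_ hc.le) ?_)
      (H δ Δ s M P 𝒯 hδ hs0 hs1 hnice (by simpa only [one_mul] using hcoarse)
        (by simpa only [one_mul] using hfine))
    · exact Real.rpow_le_rpow_of_exponent_ge hδ0 hδ1 (by linarith)
    · exact le_min (by positivity) (le_min (by positivity) (by positivity))
  · obtain ⟨c, hc, H⟩ := Furstenberg.exists_furstenberg_bound hε hA
    exact ⟨c, hc, fun s t hs0 hs1 hst hts => ⟨1, one_pos, fun δ M P 𝒯 hδ hδ1 hnice hW1 hW2 hcov =>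
      H s t δ M P 𝒯 hs0 hs1 hst hts hδ hδ1 hnice hW1 hW2 hcov⟩⟩
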